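/- **Theorem (Representation of the stray field).** For $M\in L^2(\mathbb R^3;\mathbb R^3)$ let $\mathcal H(M)=-\nabla\Phi\in L^2(\mathbb R^3;\mathbb R^3)$ be the stray field of $M$, where $\Delta\Phi=\operatorname{div}M$ in the sense of distributions; that is, $\nabla\Phi$ is the orthogonal projection of $M$ onto the rotation free fields, i.e. onto the $L^2$-closure of $\{\nabla\varphi:\varphi\in C_c^\infty(\mathbb R^3)\}$. Define $\Gamma,\Theta:[0,\infty)\to\mathbb R$ by $$\Gamma(\alpha)=2\alpha^2\Big(1-\frac{\alpha}{\sqrt{1+\alpha^2}}\Big),\qquad \Theta(\alpha)=2\Big(\alpha\,\operatorname{arsinh}\big(\tfrac1\alpha\big)+\alpha^2-\alpha\sqrt{1+\alpha^2}\Big)\ (\alpha>0),\quad \Theta(0)=0.$$ Then $\Gamma$ and $\Theta$ are strictly increasing on $[0,\infty)$, $\Gamma(0)=\Theta(0)=0$ with $\Theta(\alpha)\to0$ as $\alpha\downarrow0$, and $\Gamma(\alpha),\Theta(\alpha)\to1$ as $\alpha\to\infty$. Let $t>0$ and let $M=(M_1,M_2,M_3)\in H^1(\mathbb R^3;\mathbb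 R^3)$ vanish a.e. outside $\mathbb R^2\times[0,t]$. For $x\in\mathbb R^2$ put $\overline M(x)=\frac1t\int_0^tM(x,s)\,ds$, and denote by $\overline M$ also the field $\overline M(x)\chi_{[0,t]}(x_3)$ on $\mathbb R^3$. Write $\overline{M'}=(\overline M_1,\overline M_2,0)$, $e_3=(0,0,1)$. Then $\overline M$, $\overline M_3e_3$, $\overline{M'}$ belong to $L^2(\mathbb R^3;\mathbb R^3)$ and $$\int_{\mathbb R^3}|\mathcal H(\overline M)|^2=\int_{\mathbb R^3}|\mathcal H(\overline M_3e_3)|^2+\int_{\mathbb R^3}|\mathcal H(\overline{M'})|^2 .$$ Moreover: 1. $\displaystyle\int_{\mathbb R^3}|\mathcal H(\overline M_3e_3)|^2=t\int_{\mathbb R^2}\overline M_3^2\,dx-\frac{t^2}{8\pi}\iint_{\mathbb R^4}\Gamma\big(\tfrac{|x-x'|}t\big)\frac{|\overline M_3(x)-\overline M_3(x')|^2}{|x-x'|^3}\,dx\,dx',$ where both integrals converge. 2. The planar weak divergence $D=\operatorname{div}\overline{M'}=\partial_1\overline M_1+\partial_2\overline M_2$ exists in $L^2(\mathbb R^2)$,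 and $$\int_{\mathbb R^3}|\mathcal H(\overline{M'})|^2=\frac{t^2}{4\pi}\iint_{\mathbb R^4}\Theta\big(\tfrac{|x-x'|}t\big)\frac{D(x)D(x')}{|x-x'|}\,dx\,dx'$$ whenever the double integral converges absolutely. It does so if $D\in L^1(\mathbb R^2)$, and $D\in L^1(\mathbb R^2)$ holds if $M$ vanishes a.e. outside a bounded set. For every $M$ as above, the formula holds if the double integral is understood as the limit, as $\varepsilon\downarrow0$, of the (absolutely convergent) double integrals with the additional factor $e^{-\varepsilon|x-x'|^2}$. -/

import Mathlib

open MeasureTheory Filter Topology Set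
open scoped ContDiff RealInnerProductSpace

namespace ThinFilm

/-- The film plane `ℝ²`, with the Euclidean norm. -/
abbrev E2 : Type := EuclideanSpace ℝ (Fin 2)

/-- The space `ℝ³`, with the Euclidean norm; the coordinates are numbered `0, 1, 2`, and
coordinate `2` is the vertical one. -/
abbrev E3 : Type := EuclideanSpace ℝ (Fin 3)

/-- Test functions: smooth, real valued, compactly supported. -/
def IsTest {n : ℕ} (φ : EuclideanSpace ℝ (Fin n) → ℝ) : Prop :=
  ContDiff ℝ ∞ φ ∧ HasCompactSupport φ

/-- The classical partial derivative `∂ᵢ φ`. -/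
noncomputable def partialDeriv {n : ℕ} (i : Fin n) (φ : EuclideanSpace ℝ (Fin n) → ℝ)
    (x : EuclideanSpace ℝ (Fin n)) : ℝ :=
  fderiv ℝ φ x (EuclideanSpace.single i 1)

/-- `G` is the weak partial derivative `∂ᵢ M` on the whole space (for `M`, `G` locally
integrable). -/
def IsWeakPartial {n k : ℕ} (i : Fin n)
    (M G : EuclideanSpace ℝ (Fin n) → EuclideanSpace ℝ (Fin k)) : Prop :=
  ∀ φ : EuclideanSpace ℝ (Fin n) → ℝ, IsTest φ →
    ∫ x, partialDeriv i φ x • M x = -∫ x, φ x • G x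

/-- The Sobolev space `H¹(ℝⁿ; ℝᵏ)`. -/
def MemH1 {n k : ℕ} (M : EuclideanSpace ℝ (Fin n) → EuclideanSpace ℝ (Fin k)) : Prop :=
  MemLp M 2 volume ∧
    ∀ i : Fin n, ∃ G : EuclideanSpace ℝ (Fin n) → EuclideanSpace ℝ (Fin k),
      MemLp G 2 volume ∧ IsWeakPartial i M G

/-- The closed subspace of gradient (that is, rotation free) fields in `L²(ℝ³; ℝ³)`: the
`L²`-closure of the gradients of test functions. -/
noncomputable def gradientFields : Submodule ℝ (Lp E3 2 (volume : Measure E3)) :=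
  (Submodule.span ℝ {F : Lp E3 2 (volume : Measure E3) |
    ∃ φ : E3 → ℝ, IsTest φ ∧ F =ᵐ[volume] fun x => gradient φ x}).topologicalClosure

noncomputable instance : CompleteSpace gradientFields :=
  Submodule.topologicalClosure.completeSpace _

noncomputable instance : gradientFields.HasOrthogonalProjection :=
  Submodule.HasOrthogonalProjection.ofCompleteSpace _

open Classical in
/-- The stray field `ℋ(M) = -∇Φ`, `ΔΦ = div M`, of a field `M ∈ L²(ℝ³; ℝ³)`: `∇Φ` is the orthogonal
projection of `M` onto the gradient fields (`ΔΦ = div M` says exactly that `∇Φ - M` is orthogonal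
to all gradients of test functions). The value for `M ∉ L²` is irrelevant. -/
noncomputable def strayField (M : E3 → E3) : E3 → E3 :=
  if h : MemLp M 2 (volume : Measure E3) then
    ⇑(-(gradientFields.starProjection (h.toLp M)))
  else 0

/-- The stray field energy `∫_{ℝ³} |ℋ(M)|²`. -/
noncomputable def strayEnergy (M : E3 → E3) : ℝ := ∫ x, ‖strayField M x‖ ^ 2

/-- The stray field is a square integrable field. -/
theorem memLp_strayField (M : E3 → E3) : MemLp (strayField M) 2 (volume : Measure E3) := by
  unfold strayField
  split_ifs with h
  · exact Lp.memLp _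
  · exact MemLp.zero

/-- The weak form of `div ℋ(M) = -div M`, that is of `ΔΦ = div M` with `ℋ(M) = -∇Φ`. -/
theorem strayField_weak {M : E3 → E3} (hM : MemLp M 2 (volume : Measure E3)) {φ : E3 → ℝ}
    (hφ : IsTest φ) :
    ∫ x, ⟪strayField M x, gradient φ x⟫ = -∫ x, ⟪M x, gradient φ x⟫ := by
  have hcont : Continuous (fun x => gradient φ x) :=
    (InnerProductSpace.toDual ℝ E3).symm.continuous.comp (hφ.1.continuous_fderiv (by simp))
  have hsupp : HasCompactSupport (fun x => gradient φ x) :=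
    (hφ.2.fderiv (𝕜 := ℝ)).comp_left (g := (InnerProductSpace.toDual ℝ E3).symm) (by simp)
  have hg : MemLp (fun x => gradient φ x) 2 (volume : Measure E3) :=
    hcont.memLp_of_hasCompactSupport hsupp
  set F := hg.toLp _ with hF
  have hmem : F ∈ gradientFields :=
    Submodule.le_topologicalClosure _ (Submodule.subset_span ⟨φ, hφ, hg.coeFn_toLp⟩)
  have h0 : ⟪hM.toLp M - gradientFields.starProjection (hM.toLp M), F⟫ = 0 :=
    Submodule.starProjection_inner_eq_zero _ _ hmem
  rw [inner_sub_left, sub_eq_zero] at h0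
  have h1 : ⟪-(gradientFields.starProjection (hM.toLp M)), F⟫ = -⟪hM.toLp M, F⟫ := by
    rw [inner_neg_left, h0]
  rw [L2.inner_def, L2.inner_def] at h1
  have e1 : ∫ x, ⟪strayField M x, gradient φ x⟫ =
      ∫ x, ⟪(-(gradientFields.starProjection (hM.toLp M)) : Lp E3 2 (volume : Measure E3)) x,
        F x⟫ := by
    apply integral_congr_ae
    filter_upwards [hg.coeFn_toLp] with x hx
    rw [hF, hx]
    simp only [strayField, dif_pos hM]
  have e2 : ∫ x, ⟪M x, gradient φ x⟫ = ∫ x, ⟪hM.toLp M x, F x⟫ := by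
    apply integral_congr_ae
    filter_upwards [hg.coeFn_toLp, hM.coeFn_toLp] with x hx hy
    rw [hF, hx, hy]
  rw [e1, e2, h1]

/-- The average `M̄(x) = t⁻¹ ∫₀ᵗ M(x, s) ds` over the thickness of the film, for `x ∈ ℝ²`. -/
noncomputable def thicknessAverage (t : ℝ) (M : E3 → E3) (x : E2) : E3 :=
  t⁻¹ • ∫ s in (0 : ℝ)..t, M !₂[x 0, x 1, s]

/-- The field `(m ⊗ χ_{[0,t]})(x, x₃) = m(x) χ_{[0,t]}(x₃)`. -/
noncomputable def filmField (t : ℝ) (m : E2 → E3) (y : E3) : E3 :=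
  (Icc (0 : ℝ) t).indicator (fun _ => m !₂[y 0, y 1]) (y 2)

/-- The vertical part `M₃ e₃ = (0, 0, M₃)` of a field. -/
noncomputable def verticalPart {X : Type*} (M : X → E3) (x : X) : E3 := !₂[0, 0, M x 2]

/-- The in-plane part `M' = (M₁, M₂, 0)` of a field. -/
noncomputable def inPlanePart {X : Type*} (M : X → E3) (x : X) : E3 := !₂[M x 0, M x 1, 0]

/-- `D ∈ L²(ℝ²)` is the weak divergence `div m'` of the in-plane components `m' = (m₁, m₂)` of a
field `m` on `ℝ²`. -/
def IsPlanarDiv (m : E2 → E3) (D : E2 → ℝ) : Prop :=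
  MemLp D 2 volume ∧ ∀ φ : E2 → ℝ, IsTest φ →
    ∫ x, (m x 0 * partialDeriv 0 φ x + m x 1 * partialDeriv 1 φ x) = -∫ x, D x * φ x

/-- `Γ(α) = 2α² (1 - α / √(1 + α²))`. -/
noncomputable def Gam (α : ℝ) : ℝ := 2 * α ^ 2 * (1 - α / √(1 + α ^ 2))

/-- `Θ(α) = 2 (α arsinh(1/α) + α² - α √(1 + α²))`; the value at `α = 0` is `0`. -/
noncomputable def Thet (α : ℝ) : ℝ :=
  2 * (α * Real.arsinh (1 / α) + α ^ 2 - α * √(1 + α ^ 2))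

/-- The integrand `Γ(|x - x'| / t) |f(x) - f(x')|² / |x - x'|³` on `ℝ² × ℝ²`. -/
noncomputable def verticalIntegrand (t : ℝ) (f : E2 → ℝ) (p : E2 × E2) : ℝ :=
  Gam (‖p.1 - p.2‖ / t) * (f p.1 - f p.2) ^ 2 / ‖p.1 - p.2‖ ^ 3

/-- The integrand `Θ(|x - x'| / t) D(x) D(x') / |x - x'|` on `ℝ² × ℝ²`. -/
noncomputable def inPlaneIntegrand (t : ℝ) (D : E2 → ℝ) (p : E2 × E2) : ℝ :=
  Thet (‖p.1 - p.2‖ / t) * (D p.1 * D p.2) / ‖p.1 - p.2‖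

end ThinFilm

open ThinFilm

/-! On the Fourier side, projecting onto gradient fields means projecting each Fourier coefficient
onto the line spanned by its frequency. Being curl free makes the transform of the stray field
parallel to ξ, and the equation for its divergence fixes the component along ξ. Hence the energy of
a field F is the integral of |ξ·F̂|²/|ξ|² (`strayEnergy_eq`).

For a film field F̂ is the product of the planar transform and the transform ŝ(k) of the slab
(`l2Fourier_tensor`). The energy density is therefore |ŝ(k)|² |σ(ξ) + k m̂₃(ξ)|² / (|ξ|² + k²), with
ξ now planar and σ the `planarSymbol`. The reflection k ↦ -k changes the sign of the cross term and
of nothing else, so the energies of the two parts add (`strayEnergy_split`).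

The way back to real space goes through Gaussians: 1/(4π²R) is the integral over l > 0 of (2π)⁻¹ l⁻³
exp(-πR/l²). With R = |ξ|² + k² every Gaussian factors into a planar and a vertical one
(`integral_gaussian_superposition`), and each factor is a Gaussian interaction energy in real space
(`gaussian_energy`). Integrating over l by Fubini (`integral_gaussian_mul_swap`) produces the
kernels.

For the vertical part, 4π²k²|ŝ(k)|² = 2 - 2cos(2πtk), and the kernel is 1/r - 1/√(r² + t²), the
interaction of two charged planes. It is integrable on ℝ² with integral 2πt, so expanding (f(x) -
f(x'))² turns the bilinear form into the stated formula (`strayEnergy_vertical_formula`).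

For the in-plane part, the density is D and the vertical factor is the self-interaction of [0,t].
Integrating 1/(2√(r² + s²)), with s the difference of two heights, over the square [0,t]² gives
(t²/2) Θ(r/t)/r. This kernel is not integrable at infinity, so the formula is proved with a factor
exp(-εr²), which merely replaces l² by l² + ε/π. The limit ε ↓ 0 is taken in the l-integral, under
the bound C/(1 + l²) for the Gaussian energy of D (`exists_planarGauss_le`); boundedness for small l
holds because D is a divergence. -/

namespace ThinFilm

open FourierTransform SchwartzMap

/-! ### The Fourier transform on L², realised on functions. -/

section L2Fourier

variable {V : Type*} [NormedAddCommGroup V] [InnerProductSpace ℝ V] [FiniteDimensional ℝ V]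
  [MeasurableSpace V] [BorelSpace V]

open Classical in
/-- The `L²` Fourier transform, as a function; its value is `0` outside `L²`. -/
noncomputable def l2Fourier (u : V → ℂ) : V → ℂ :=
  if h : MemLp u 2 (volume : Measure V) then ⇑(𝓕 (h.toLp u) : Lp ℂ 2 (volume : Measure V)) else 0

theorem l2Fourier_of_memLp {u : V → ℂ} (h : MemLp u 2 (volume : Measure V)) :
    l2Fourier u = ⇑(𝓕 (h.toLp u) : Lp ℂ 2 (volume : Measure V)) := dif_pos h

theorem memLp_l2Fourier (u : V → ℂ) : MemLp (l2Fourier u) 2 (volume : Measure V) := by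
  unfold l2Fourier
  split_ifs with h
  · exact Lp.memLp _
  · exact MemLp.zero

theorem toLp_l2Fourier {u : V → ℂ} (h : MemLp u 2 (volume : Measure V)) :
    (memLp_l2Fourier u).toLp (l2Fourier u) = 𝓕 (h.toLp u) := by
  apply Lp.ext
  rw [← l2Fourier_of_memLp h]
  exact MemLp.coeFn_toLp _

theorem l2Fourier_add {u v : V → ℂ} (hu : MemLp u 2 (volume : Measure V))
    (hv : MemLp v 2 (volume : Measure V)) :
    l2Fourier (u + v) =ᵐ[volume] l2Fourier u + l2Fourier v := by
  rw [l2Fourier_of_memLp (hu.add hv), l2Fourier_of_memLp hu, l2Fourier_of_memLp hv,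
    MemLp.toLp_add, FourierTransform.fourier_add]
  exact Lp.coeFn_add _ _

theorem l2Fourier_const_smul (c : ℂ) {u : V → ℂ} (hu : MemLp u 2 (volume : Measure V)) :
    l2Fourier (c • u) =ᵐ[volume] c • l2Fourier u := by
  rw [l2Fourier_of_memLp (hu.const_smul c), l2Fourier_of_memLp hu,
    MemLp.toLp_const_smul, FourierTransform.fourier_smul]
  exact Lp.coeFn_smul _ _

theorem l2Fourier_sub {u v : V → ℂ} (hu : MemLp u 2 (volume : Measure V))
    (hv : MemLp v 2 (volume : Measure V)) :
    l2Fourier (u - v) =ᵐ[volume] l2Fourier u - l2Fourier v := by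
  have h1 := l2Fourier_add hu (hv.const_smul (-1 : ℂ))
  have h2 := l2Fourier_const_smul (-1) hv
  have : u - v = u + (-1 : ℂ) • v := by simp [sub_eq_add_neg]
  rw [this]
  filter_upwards [h1, h2] with x h1 h2
  rw [h1, Pi.add_apply, h2]
  simp [sub_eq_add_neg]

/-- Plancherel. -/
theorem eLpNorm_l2Fourier {u : V → ℂ} (hu : MemLp u 2 (volume : Measure V)) :
    eLpNorm (l2Fourier u) 2 volume = eLpNorm u 2 volume := by
  have h := Lp.norm_fourier_eq (hu.toLp u)
  rw [← toLp_l2Fourier hu, Lp.norm_toLp, Lp.norm_toLp] at h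
  exact (ENNReal.toReal_eq_toReal_iff' (memLp_l2Fourier u).2.ne hu.2.ne).1 h

theorem eLpNorm_l2Fourier_sub {u v : V → ℂ} (hu : MemLp u 2 (volume : Measure V))
    (hv : MemLp v 2 (volume : Measure V)) :
    eLpNorm (l2Fourier u - l2Fourier v) 2 volume = eLpNorm (u - v) 2 volume := by
  rw [← eLpNorm_l2Fourier (hu.sub hv)]
  exact eLpNorm_congr_ae (l2Fourier_sub hu hv).symm

theorem integral_norm_sq_eq_eLpNorm {X F : Type*} [MeasurableSpace X] {μ : Measure X}
    [NormedAddCommGroup F] {u : X → F} (hu : MemLp u 2 μ) :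
    ∫ x, ‖u x‖ ^ 2 ∂μ = (eLpNorm u 2 μ).toReal ^ 2 := by
  rw [hu.eLpNorm_eq_integral_rpow_norm (by norm_num) (by norm_num)]
  have h0 : 0 ≤ ∫ x, ‖u x‖ ^ 2 ∂μ := integral_nonneg fun x => by positivity
  simp only [ENNReal.toReal_ofNat, Real.rpow_ofNat]
  rw [ENNReal.toReal_ofReal (by positivity), ← Real.rpow_natCast, ← Real.rpow_mul h0]
  simp

theorem integral_norm_sq_l2Fourier {u : V → ℂ} (hu : MemLp u 2 (volume : Measure V)) :
    ∫ x, ‖l2Fourier u x‖ ^ 2 = ∫ x, ‖u x‖ ^ 2 := by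
  rw [integral_norm_sq_eq_eLpNorm (memLp_l2Fourier u), integral_norm_sq_eq_eLpNorm hu,
    eLpNorm_l2Fourier hu]

/-- The L² transform agrees with the transform of tempered distributions, which is defined by this
duality. -/
theorem integral_schwartz_mul_l2Fourier (ψ : 𝓢(V, ℂ)) {u : V → ℂ}
    (hu : MemLp u 2 (volume : Measure V)) :
    ∫ x, ψ x * l2Fourier u x = ∫ x, (𝓕 ψ) x * u x := by
  have h := congrArg (fun T => T ψ) (Lp.fourier_toTemperedDistribution_eq (hu.toLp u))
  simp only [TemperedDistribution.fourier_apply, Lp.toTemperedDistribution_apply,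
    smul_eq_mul] at h
  rw [l2Fourier_of_memLp hu, ← h]
  apply integral_congr_ae
  filter_upwards [hu.coeFn_toLp] with x hx
  rw [hx]

/-- The fundamental lemma of the calculus of variations. Restricting to compactly supported ψ lets
it apply to locally integrable functions such as a frequency times an L² transform. -/
theorem ae_eq_of_integral_schwartz_mul {g h : V → ℂ} (hg : LocallyIntegrable g volume)
    (hh : LocallyIntegrable h volume)
    (H : ∀ ψ : 𝓢(V, ℂ), HasCompactSupport ψ → ∫ x, ψ x * g x = ∫ x, ψ x * h x) :
    g =ᵐ[volume] h := by
  have := ae_eq_zero_of_integral_contDiff_smul_eq_zero (f := g - h) (μ := volume)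
    (hg.sub hh) ?_
  · filter_upwards [this] with x hx
    exact sub_eq_zero.1 hx
  intro φ hφ hc
  have hc' : HasCompactSupport (fun x => (φ x : ℂ)) := hc.comp_left (g := fun r : ℝ => (r : ℂ)) rfl
  have hs : ContDiff ℝ ∞ (fun x => (φ x : ℂ)) := Complex.ofRealCLM.contDiff.comp hφ
  have key := H (hc'.toSchwartzMap hs) hc'
  simp only [HasCompactSupport.toSchwartzMap_toFun] at key
  have i1 : Integrable (fun x => (φ x : ℂ) * g x) := by
    simpa using hg.integrable_smul_left_of_hasCompactSupport hs.continuous hc'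
  have i2 : Integrable (fun x => (φ x : ℂ) * h x) := by
    simpa using hh.integrable_smul_left_of_hasCompactSupport hs.continuous hc'
  rw [← sub_eq_zero, ← integral_sub i1 i2] at key
  rw [← key]
  congr 1 with x
  simp [mul_sub]

/-- Both transforms satisfy the same duality formula against Schwartz functions. -/
theorem l2Fourier_ae_eq_fourier {u : V → ℂ} (hu : MemLp u 2 (volume : Measure V))
    (hi : Integrable u) : l2Fourier u =ᵐ[volume] 𝓕 u := by
  apply ae_eq_of_integral_schwartz_mul
  · exact (memLp_l2Fourier u).locallyIntegrable (by norm_num)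
  · exact (VectorFourier.fourierIntegral_continuous Real.continuous_fourierChar
      (by exact continuous_inner) hi).locallyIntegrable
  intro ψ _
  rw [integral_schwartz_mul_l2Fourier ψ hu]
  have := VectorFourier.integral_fourierIntegral_smul_eq_flip (L := innerₗ V)
    Real.continuous_fourierChar continuous_inner (ψ.integrable (μ := volume)) hi
  simpa [SchwartzMap.fourier_coe] using! this

end L2Fourier

end ThinFilm

namespace ThinFilm

open FourierTransform SchwartzMap

/-! ### Weak divergence and its Fourier symbol. -/

section WeakDivergence

variable {n : ℕ}

local notation "E" => EuclideanSpace ℝ (Fin n)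

theorem continuous_partialDeriv {φ : E → ℝ} (hφ : ContDiff ℝ ∞ φ) (i : Fin n) :
    Continuous (partialDeriv i φ) :=
  (hφ.continuous_fderiv (by simp)).clm_apply continuous_const

theorem contDiff_partialDeriv {φ : E → ℝ} (hφ : ContDiff ℝ ∞ φ) (i : Fin n) :
    ContDiff ℝ ∞ (partialDeriv i φ) :=
  (hφ.fderiv_right (by simp)).clm_apply contDiff_const

theorem IsTest.partialDeriv {φ : E → ℝ} (hφ : IsTest φ) (i : Fin n) :
    IsTest (partialDeriv i φ) :=
  ⟨contDiff_partialDeriv hφ.1 i,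
    (hφ.2.fderiv (𝕜 := ℝ)).comp_left (g := fun L : E →L[ℝ] ℝ => L (EuclideanSpace.single i 1))
      (by simp)⟩

theorem IsTest.memLp {φ : E → ℝ} (hφ : IsTest φ) (p : ENNReal) : MemLp φ p volume :=
  hφ.1.continuous.memLp_of_hasCompactSupport hφ.2

theorem partialDeriv_mul {φ ψ : E → ℝ} (hφ : ContDiff ℝ ∞ φ) (hψ : ContDiff ℝ ∞ ψ) (i : Fin n)
    (x : E) : partialDeriv i (fun y => φ y * ψ y) x =
      φ x * partialDeriv i ψ x + ψ x * partialDeriv i φ x := by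
  unfold partialDeriv
  rw [fderiv_fun_mul (hφ.differentiable (by simp) x) (hψ.differentiable (by simp) x)]
  simp

theorem partialDeriv_comp_smul {φ : E → ℝ} (hφ : ContDiff ℝ ∞ φ) (c : ℝ) (i : Fin n) (x : E) :
    partialDeriv i (fun y => φ (c • y)) x = c * partialDeriv i φ (c • x) := by
  unfold partialDeriv
  have h1 : HasFDerivAt (fun y : E => c • y) (c • ContinuousLinearMap.id ℝ E) x :=
    (hasFDerivAt_id x).const_smul c
  have h := ((hφ.differentiable (by simp) (c • x)).hasFDerivAt).comp x h1
  rw [show (fun y => φ (c • y)) = φ ∘ fun y : E => c • y from rfl, h.fderiv]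
  simp

/-- A sequence of cutoff functions. -/
theorem exists_cutoff : ∃ χ : E → ℝ, IsTest χ ∧ χ 0 = 1 ∧ (∀ x, |χ x| ≤ 1) ∧
    ∃ C, ∀ i x, |partialDeriv i χ x| ≤ C := by
  let b : ContDiffBump (0 : E) := ⟨1, 2, by norm_num, by norm_num⟩
  have hb : IsTest (b : E → ℝ) := ⟨b.contDiff, b.hasCompactSupport⟩
  refine ⟨b, hb, b.one_of_mem_closedBall (by simp [b.rIn_pos.le]), fun x => ?_, ?_⟩
  · rw [abs_of_nonneg b.nonneg]; exact b.le_one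
  have : ∀ i, ∃ C, ∀ x, ‖partialDeriv i b x‖ ≤ C := fun i =>
    (hb.partialDeriv i).2.exists_bound_of_continuous (hb.partialDeriv i).1.continuous
  choose C hC using this
  refine ⟨∑ i, |C i|, fun i x => (hC i x).trans ((le_abs_self _).trans ?_)⟩
  exact Finset.single_le_sum (f := fun i => |C i|) (fun j _ => abs_nonneg _) (Finset.mem_univ i)

/-- A weak divergence identity extends from test functions to smooth functions which are square
integrable together with their first derivatives. -/
theorem weakDiv_extend {u : Fin n → E → ℝ} {ρ : E → ℝ} (hu : ∀ i, MemLp (u i) 2 volume)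
    (hρ : MemLp ρ 2 volume)
    (H : ∀ φ : E → ℝ, IsTest φ → ∫ x, ∑ i, u i x * partialDeriv i φ x = -∫ x, ρ x * φ x)
    {φ : E → ℝ} (hφ : ContDiff ℝ ∞ φ) (h0 : MemLp φ 2 volume)
    (h1 : ∀ i, MemLp (partialDeriv i φ) 2 volume) :
    ∫ x, ∑ i, u i x * partialDeriv i φ x = -∫ x, ρ x * φ x := by
  obtain ⟨χ, hχ, hχ0, hχ1, C, hC⟩ := exists_cutoff (n := n)
  -- The cutoffs χ(c_k x) tend to 1 pointwise, and their gradients carry a factor c_k → 0. So the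
  -- cutoff term in the product rule disappears in the limit.
  let c : ℕ → ℝ := fun k => 1 / ((k : ℝ) + 1)
  have hc : Tendsto c atTop (𝓝 0) := tendsto_one_div_add_atTop_nhds_zero_nat
  have hc0 : ∀ k, c k ≠ 0 := fun k => by simp only [c]; positivity
  have hc1 : ∀ k, |c k| ≤ 1 := fun k => by
    simp only [c]; rw [abs_of_nonneg (by positivity), div_le_one (by positivity)]
    linarith [k.cast_nonneg (α := ℝ)]
  have hχk : ∀ k, IsTest (fun x => χ (c k • x)) := fun k =>
    ⟨hχ.1.comp (contDiff_const_smul _), hχ.2.comp_smul (hc0 k)⟩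
  have key : ∀ k, ∫ x, ∑ i, u i x * partialDeriv i (fun y => χ (c k • y) * φ y) x =
      -∫ x, ρ x * (χ (c k • x) * φ x) := fun k =>
    H _ ⟨(hχk k).1.mul hφ, (hχk k).2.mul_right⟩
  have hlim : ∀ x : E, Tendsto (fun k => χ (c k • x)) atTop (𝓝 1) := fun x => by
    rw [← hχ0]
    have : Tendsto (fun k => c k • x) atTop (𝓝 0) := by simpa using hc.smul_const x
    exact (hχ.1.continuous.tendsto 0).comp this
  have hd : ∀ k i x, partialDeriv i (fun y => χ (c k • y) * φ y) x =
      χ (c k • x) * partialDeriv i φ x + φ x * (c k * partialDeriv i χ (c k • x)) := by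
    intro k i x
    rw [partialDeriv_mul (hχk k).1 hφ, partialDeriv_comp_smul hχ.1]
  have L1 : Tendsto (fun k => ∫ x, ∑ i, u i x * partialDeriv i (fun y => χ (c k • y) * φ y) x)
      atTop (𝓝 (∫ x, ∑ i, u i x * partialDeriv i φ x)) := by
    apply tendsto_integral_of_dominated_convergence
      (fun x => ∑ i, |u i x| * (|partialDeriv i φ x| + |φ x| * C))
    · intro k
      refine Finset.aestronglyMeasurable_fun_sum _ fun i _ => (hu i).1.mul ?_
      exact (continuous_partialDeriv ((hχk k).1.mul hφ) i).aestronglyMeasurable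
    · refine integrable_finsetSum _ fun i _ => ?_
      exact (hu i).abs.integrable_mul ((h1 i).abs.add (h0.abs.mul_const C))
    · intro k
      filter_upwards with x
      refine (norm_sum_le _ _).trans (Finset.sum_le_sum fun i _ => ?_)
      rw [norm_mul, hd]
      refine mul_le_mul_of_nonneg_left ((norm_add_le _ _).trans (add_le_add ?_ ?_)) (norm_nonneg _)
      · rw [norm_mul]
        exact mul_le_of_le_one_left (norm_nonneg _) (hχ1 _)
      · rw [norm_mul, norm_mul]
        refine mul_le_mul_of_nonneg_left ?_ (norm_nonneg _)
        exact (mul_le_of_le_one_left (norm_nonneg _) (hc1 k)).trans (hC i _)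
    · filter_upwards with x
      refine tendsto_finsetSum _ fun i _ => Tendsto.const_mul _ ?_
      simp only [hd]
      have e2 : Tendsto (fun k => φ x * (c k * partialDeriv i χ (c k • x))) atTop (𝓝 0) := by
        have : Tendsto (fun k => c k * partialDeriv i χ (c k • x)) atTop (𝓝 0) := by
          apply bdd_le_mul_tendsto_zero' C _ hc |>.congr _
          · exact fun k => partialDeriv i χ (c k • x)
          · exact fun k => mul_comm _ _
          · filter_upwards with k using hC i _
        simpa using this.const_mul (φ x)
      simpa using ((hlim x).mul_const (partialDeriv i φ x)).add e2
  have L2 : Tendsto (fun k => -∫ x, ρ x * (χ (c k • x) * φ x)) atTop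
      (𝓝 (-∫ x, ρ x * φ x)) := by
    apply Tendsto.neg
    apply tendsto_integral_of_dominated_convergence (fun x => |ρ x| * |φ x|)
    · intro k
      exact hρ.1.mul ((hχk k).1.mul hφ).continuous.aestronglyMeasurable
    · exact hρ.abs.integrable_mul h0.abs
    · intro k
      filter_upwards with x
      rw [norm_mul, norm_mul]
      exact mul_le_mul_of_nonneg_left (mul_le_of_le_one_left (norm_nonneg _) (hχ1 _))
        (norm_nonneg _)
    · filter_upwards with x
      simpa using ((hlim x).mul_const (φ x)).const_mul (ρ x)
  simp only [key] at L1
  exact tendsto_nhds_unique L1 L2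

/-- The `L²` Fourier transform of a real function. -/
noncomputable def realFourier (u : E → ℝ) : E → ℂ := l2Fourier fun x => (u x : ℂ)

theorem memLp_ofReal {X : Type*} [MeasurableSpace X] {μ : Measure X} {p : ENNReal} {u : X → ℝ}
    (hu : MemLp u p μ) : MemLp (fun x => (u x : ℂ)) p μ :=
  hu.ofReal

theorem memLp_realFourier (u : E → ℝ) : MemLp (realFourier u) 2 volume := memLp_l2Fourier _

theorem partialDeriv_comp_clm (L : ℂ →L[ℝ] ℝ) (ψ : 𝓢(E, ℂ)) (i : Fin n) (x : E) :
    partialDeriv i (fun y => L (ψ y)) x =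
      L ((LineDeriv.lineDerivOp (EuclideanSpace.single i (1 : ℝ)) ψ : 𝓢(E, ℂ)) x) := by
  unfold partialDeriv
  have h := (L.hasFDerivAt (x := ψ x)).comp x (ψ.differentiableAt (x := x)).hasFDerivAt
  rw [show (fun y => L (ψ y)) = L ∘ ψ from rfl, h.fderiv, lineDerivOp_apply_eq_fderiv]
  simp

/-- `weakDiv_extend` applies to the real and the imaginary part of ψ, both of the form L ∘ ψ with L
real linear. -/
theorem weakDiv_schwartz {u : Fin n → E → ℝ} {ρ : E → ℝ} (hu : ∀ i, MemLp (u i) 2 volume)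
    (hρ : MemLp ρ 2 volume)
    (H : ∀ φ : E → ℝ, IsTest φ → ∫ x, ∑ i, u i x * partialDeriv i φ x = -∫ x, ρ x * φ x)
    (ψ : 𝓢(E, ℂ)) :
    ∑ i, ∫ x, (LineDeriv.lineDerivOp (EuclideanSpace.single i (1 : ℝ)) ψ : 𝓢(E, ℂ)) x *
        (u i x : ℂ) =
      -∫ x, ψ x * (ρ x : ℂ) := by
  have hL : ∀ L : ℂ →L[ℝ] ℝ,
      L (∑ i, ∫ x, (LineDeriv.lineDerivOp (EuclideanSpace.single i (1 : ℝ)) ψ : 𝓢(E, ℂ)) x *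
        (u i x : ℂ)) =
      L (-∫ x, ψ x * (ρ x : ℂ)) := by
    intro L
    have hm : ∀ (η : 𝓢(E, ℂ)), MemLp (fun x => L (η x)) 2 volume := fun η =>
      L.comp_memLp' (η.memLp 2)
    have h := weakDiv_extend hu hρ H (φ := fun x => L (ψ x))
      (L.contDiff.comp (ψ.smooth ⊤)) (hm ψ)
      (fun i => by
        simp only [funext (partialDeriv_comp_clm L ψ i)]
        exact hm _)
    have hr : ∀ (z : ℂ) (r : ℝ), L (z * r) = r * L z := fun z r => by
      rw [mul_comm, ← Complex.real_smul, map_smul, smul_eq_mul]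
    have hint : ∀ (η : 𝓢(E, ℂ)) {v : E → ℝ}, MemLp v 2 volume →
        Integrable (fun x => η x * (v x : ℂ)) := fun η v hv =>
      (η.memLp 2).integrable_mul (memLp_ofReal hv)
    rw [map_sum, map_neg, ← L.integral_comp_comm (hint ψ hρ)]
    simp only [hr]
    rw [← h, integral_finsetSum]
    · refine Finset.sum_congr rfl fun i _ => ?_
      rw [← L.integral_comp_comm (hint _ (hu i))]
      simp only [hr, partialDeriv_comp_clm]
    · intro i _
      simp only [partialDeriv_comp_clm]
      exact (hu i).integrable_mul (hm _)
  exact Complex.ext (hL Complex.reCLM) (hL Complex.imCLM)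

/-- The Fourier transform turns the weak divergence into multiplication by the frequency. -/
theorem realFourier_weakDiv {u : Fin n → E → ℝ} {ρ : E → ℝ} (hu : ∀ i, MemLp (u i) 2 volume)
    (hρ : MemLp ρ 2 volume)
    (H : ∀ φ : E → ℝ, IsTest φ → ∫ x, ∑ i, u i x * partialDeriv i φ x = -∫ x, ρ x * φ x) :
    realFourier ρ =ᵐ[volume]
      fun ξ => 2 * Real.pi * Complex.I * ∑ i, (ξ i : ℂ) * realFourier (u i) ξ := by
  have hloc : ∀ v : E → ℝ, LocallyIntegrable (realFourier v) volume := fun v =>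
    (memLp_realFourier v).locallyIntegrable (by norm_num)
  have hloc' : ∀ i, LocallyIntegrable (fun ξ : E => (ξ i : ℂ) * realFourier (u i) ξ) volume :=
    fun i => (hloc (u i)).continuous_mul (by fun_prop)
  apply ae_eq_of_integral_schwartz_mul (hloc ρ)
  · refine LocallyIntegrable.continuous_mul continuous_const ?_
    exact locallyIntegrable_finsetSum _ fun i _ => hloc' i
  intro ψ hψ
  -- Testing with 𝓕 ψ, which need not have compact support, is the reason for the extension to
  -- Schwartz functions. A derivative of 𝓕 ψ is the transform of ψ times a coordinate, and duality
  -- moves the transform onto u and ρ.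
  have h := weakDiv_schwartz hu hρ H (𝓕 ψ)
  rw [← integral_schwartz_mul_l2Fourier ψ (memLp_ofReal hρ)] at h
  have e : ∀ i, ∫ x, (LineDeriv.lineDerivOp (EuclideanSpace.single i (1 : ℝ)) (𝓕 ψ) : 𝓢(E, ℂ)) x *
      (u i x : ℂ) = -(2 * Real.pi * Complex.I) *
        ∫ ξ, ψ ξ * ((ξ i : ℂ) * realFourier (u i) ξ) := by
    intro i
    rw [SchwartzMap.lineDerivOp_fourier_eq,
      ← integral_schwartz_mul_l2Fourier _ (memLp_ofReal (hu i)), ← integral_const_mul]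
    congr 1 with ξ
    have : (fun x : E => inner ℝ x (EuclideanSpace.single i (1 : ℝ))).HasTemperateGrowth := by
      fun_prop
    rw [smul_apply, smulLeftCLM_apply_apply this]
    simp [EuclideanSpace.inner_single_right, realFourier]
    ring
  simp only [e] at h
  rw [← Finset.mul_sum, ← neg_eq_iff_eq_neg, ← neg_mul, neg_neg] at h
  have h' : ∫ x, ψ x * realFourier ρ x = _ := h.symm
  rw [h', ← integral_finsetSum, ← integral_const_mul]
  · congr 1 with ξ
    simp only [Finset.mul_sum]
    refine Finset.sum_congr rfl fun i _ => by ring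
  · intro i _
    simpa using (hloc' i).integrable_smul_left_of_hasCompactSupport ψ.continuous hψ

end WeakDivergence

end ThinFilm

namespace ThinFilm

/-! ### The stray field energy in Fourier space. -/

section Energy

variable {n : ℕ}

local notation "E" => EuclideanSpace ℝ (Fin n)

theorem realFourier_linear {u v : E → ℝ} (hu : MemLp u 2 volume) (hv : MemLp v 2 volume)
    (a b : ℝ) : realFourier (fun x => a * u x + b * v x) =ᵐ[volume]
      fun ξ => a * realFourier u ξ + b * realFourier v ξ := by
  have hu' := memLp_ofReal hu
  have hv' := memLp_ofReal hv
  have e : (fun x => ((a * u x + b * v x : ℝ) : ℂ)) =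
      (a : ℂ) • (fun x => (u x : ℂ)) + (b : ℂ) • (fun x => (v x : ℂ)) := by
    ext x; simp
  unfold realFourier
  rw [e]
  filter_upwards [l2Fourier_add (hu'.const_smul (a : ℂ)) (hv'.const_smul (b : ℂ)),
    l2Fourier_const_smul (a : ℂ) hu', l2Fourier_const_smul (b : ℂ) hv'] with ξ h1 h2 h3
  rw [h1, Pi.add_apply, h2, h3]
  simp

theorem realFourier_zero : realFourier (fun _ : E => (0 : ℝ)) =ᵐ[volume] 0 := by
  have h := realFourier_linear (n := n) (u := fun _ => 0) (v := fun _ => 0)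
    MemLp.zero MemLp.zero 0 0
  simp only [mul_zero, add_zero, Complex.ofReal_zero, zero_mul] at h
  exact h

theorem IsTest.memLp_smul {F : Type*} [NormedAddCommGroup F] [NormedSpace ℝ F] {φ : E → ℝ}
    (hφ : IsTest φ) (v : F) : MemLp (fun x => φ x • v) 2 volume :=
  (hφ.1.continuous.smul continuous_const).memLp_of_hasCompactSupport hφ.2.smul_right

theorem integral_norm_sq_realFourier {u : E → ℝ} (hu : MemLp u 2 volume) :
    ∫ ξ, ‖realFourier u ξ‖ ^ 2 = ∫ x, u x ^ 2 := by
  rw [realFourier, integral_norm_sq_l2Fourier (memLp_ofReal hu)]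
  simp

theorem gradient_apply {φ : E → ℝ} (x : E) (i : Fin n) :
    gradient φ x i = partialDeriv i φ x := by
  have h : inner ℝ (gradient φ x) (EuclideanSpace.single i (1 : ℝ)) = partialDeriv i φ x := by
    unfold gradient partialDeriv
    rw [InnerProductSpace.toDual_symm_apply]
  rw [← h, EuclideanSpace.inner_single_right]
  simp

theorem inner_gradient {φ : E → ℝ} (v x : E) :
    inner ℝ v (gradient φ x) = ∑ i, v i * partialDeriv i φ x := by
  rw [PiLp.inner_apply]
  simp [gradient_apply, mul_comm]

theorem partialDeriv_comm {φ : E → ℝ} (hφ : ContDiff ℝ ∞ φ) (i j : Fin n) (x : E) :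
    partialDeriv i (partialDeriv j φ) x = partialDeriv j (partialDeriv i φ) x := by
  have hs : IsSymmSndFDerivAt ℝ φ x :=
    (hφ.contDiffAt (x := x)).isSymmSndFDerivAt (by
      rw [minSmoothness_of_isRCLikeNormedField]
      exact WithTop.coe_le_coe.2 (le_top (a := (2 : ℕ∞))))
  have hd : DifferentiableAt ℝ (fderiv ℝ φ) x :=
    (hφ.fderiv_right (m := ∞) (by simp)).differentiable (by simp) x
  have h : ∀ k l : Fin n, partialDeriv k (partialDeriv l φ) x =
      fderiv ℝ (fderiv ℝ φ) x (EuclideanSpace.single k 1) (EuclideanSpace.single l 1) := by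
    intro k l
    have : HasFDerivAt (partialDeriv l φ) _ x :=
      hd.hasFDerivAt.clm_apply (hasFDerivAt_const (EuclideanSpace.single l (1 : ℝ)) x)
    rw [partialDeriv, this.fderiv]
    simp
  rw [h, h, hs.eq]

theorem integral_mul_partialDeriv {φ ψ : E → ℝ} (hφ : IsTest φ) (hψ : IsTest ψ) (i : Fin n) :
    ∫ x, φ x * partialDeriv i ψ x = -∫ x, partialDeriv i φ x * ψ x := by
  apply integral_mul_fderiv_eq_neg_fderiv_mul_of_integrable
  · exact ((hφ.partialDeriv i).memLp 2).integrable_mul (hψ.memLp 2)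
  · exact (hφ.memLp 2).integrable_mul ((hψ.partialDeriv i).memLp 2)
  · exact (hφ.memLp 2).integrable_mul (hψ.memLp 2)
  · exact fun x _ => hφ.1.differentiable (by simp) x
  · exact fun x _ => hψ.1.differentiable (by simp) x

/-- Integration by parts moves one derivative onto φ, where mixed second derivatives commute. This
is the vanishing of the curl of a gradient, tested against φ. -/
theorem integral_partialDeriv_mul_comm {φ ψ : E → ℝ} (hφ : IsTest φ) (hψ : IsTest ψ)
    (i j : Fin n) : ∫ x, partialDeriv i φ x * partialDeriv j ψ x =
      ∫ x, partialDeriv j φ x * partialDeriv i ψ x := by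
  rw [integral_mul_partialDeriv (hφ.partialDeriv i) hψ,
    integral_mul_partialDeriv (hφ.partialDeriv j) hψ]
  simp only [partialDeriv_comm hφ.1]

theorem MemLp.apply_euclidean {X : Type*} [MeasurableSpace X] {μ : Measure X} {p : ENNReal}
    {u : X → E} (hu : MemLp u p μ) (i : Fin n) : MemLp (fun x => u x i) p μ :=
  (EuclideanSpace.proj i : E →L[ℝ] ℝ).comp_memLp' hu

/-- Gradient fields are curl free in the weak sense. -/
theorem weakCurl_gradientFields {G : Lp E3 2 (volume : Measure E3)} (hG : G ∈ gradientFields)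
    (i j : Fin 3) {φ : E3 → ℝ} (hφ : IsTest φ) :
    ∫ x, (G x i * partialDeriv j φ x - G x j * partialDeriv i φ x) = 0 := by
  have hw : MemLp (fun x => partialDeriv j φ x • EuclideanSpace.single i (1 : ℝ) -
      partialDeriv i φ x • EuclideanSpace.single j (1 : ℝ) : E3 → E3) 2 volume :=
    ((hφ.partialDeriv j).memLp_smul _).sub ((hφ.partialDeriv i).memLp_smul _)
  set w := hw.toLp _ with hwdef
  have hin : ∀ F : Lp E3 2 (volume : Measure E3), inner ℝ w F =
      ∫ x, (F x i * partialDeriv j φ x - F x j * partialDeriv i φ x) := by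
    intro F
    rw [L2.inner_def]
    apply integral_congr_ae
    filter_upwards [hw.coeFn_toLp] with x hx
    rw [hwdef, hx, inner_sub_left, inner_smul_left, inner_smul_left,
      EuclideanSpace.inner_single_left, EuclideanSpace.inner_single_left]
    simp [mul_comm]
  -- The weak curl is the pairing with a fixed w ∈ L², so its kernel is closed and checking
  -- gradients of test functions is enough.
  have hle : gradientFields ≤ (ℝ ∙ w)ᗮ := by
    refine Submodule.topologicalClosure_minimal _ (Submodule.span_le.2 ?_)
      (Submodule.isClosed_orthogonal _)
    rintro F ⟨ψ, hψ, hF⟩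
    rw [SetLike.mem_coe, Submodule.mem_orthogonal_singleton_iff_inner_right, hin]
    have h1 : Integrable (fun x => partialDeriv i ψ x * partialDeriv j φ x) :=
      ((hψ.partialDeriv i).memLp 2).integrable_mul ((hφ.partialDeriv j).memLp 2)
    have h2 : Integrable (fun x => partialDeriv j ψ x * partialDeriv i φ x) :=
      ((hψ.partialDeriv j).memLp 2).integrable_mul ((hφ.partialDeriv i).memLp 2)
    rw [integral_congr_ae (g := fun x => partialDeriv i ψ x * partialDeriv j φ x -
      partialDeriv j ψ x * partialDeriv i φ x), integral_sub h1 h2,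
      integral_partialDeriv_mul_comm hψ hφ i j, sub_self]
    filter_upwards [hF] with x hx
    rw [hx, gradient_apply, gradient_apply]
  rw [← hin]
  exact (Submodule.mem_orthogonal_singleton_iff_inner_right).1 (hle hG)

/-- A component of the curl is itself a divergence: the field with entry Gᵢ in direction j and -Gⱼ
in direction i is weakly divergence free, so its symbol vanishes. -/
theorem realFourier_gradientFields {G : Lp E3 2 (volume : Measure E3)} (hG : G ∈ gradientFields)
    (i j : Fin 3) : ∀ᵐ ξ : E3, (ξ j : ℂ) * realFourier (fun x => G x i) ξ =
      ξ i * realFourier (fun x => G x j) ξ := by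
  have hm : ∀ i, MemLp (fun x => G x i) 2 volume := fun i =>
    MemLp.apply_euclidean (Lp.memLp G) i
  -- Coefficients that write this auxiliary field as aₖ Gᵢ + bₖ Gⱼ; they also cover i = j, where the
  -- field is zero.
  let a : Fin 3 → ℝ := fun k => if k = j then 1 else 0
  let b : Fin 3 → ℝ := fun k => if k = i then -1 else 0
  have h := realFourier_weakDiv (u := fun k x => a k * G x i + b k * G x j) (ρ := fun _ => 0)
    (fun k => ((hm i).const_mul _).add ((hm j).const_mul _)) MemLp.zero ?_
  · have h0 := realFourier_zero (n := 3)
    have hl : ∀ᵐ ξ : E3, ∀ k, _ := ae_all_iff.2 fun k =>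
      realFourier_linear (hm i) (hm j) (a k) (b k)
    filter_upwards [h, h0, hl] with ξ h h0 hl
    rw [h0] at h
    simp only [hl] at h
    have h' := (mul_eq_zero.1 h.symm).resolve_left (by simp [Real.pi_ne_zero])
    simp only [mul_add, Finset.sum_add_distrib, a, b] at h'
    have e1 : ∀ z : ℂ, ∑ k, (ξ k : ℂ) * (((if k = j then 1 else 0 : ℝ) : ℂ) * z) = ξ j * z := by
      intro z
      rw [Finset.sum_eq_single j] <;> simp +contextual
    have e2 : ∀ z : ℂ, ∑ k, (ξ k : ℂ) * (((if k = i then -1 else 0 : ℝ) : ℂ) * z) =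
        -(ξ i * z) := by
      intro z
      rw [Finset.sum_eq_single i] <;> simp +contextual
    rw [e1, e2] at h'
    linear_combination h'
  · intro φ hφ
    have := weakCurl_gradientFields hG i j hφ
    simp only [zero_mul, integral_zero, neg_zero]
    rw [← this]
    congr 1 with x
    simp only [add_mul, Finset.sum_add_distrib, a, b]
    rw [Finset.sum_eq_single j, Finset.sum_eq_single i] <;> simp +contextual
    ring

/-- Parallelism gives |ξ|² z = (ξ·z) ξ; taking squared norms gives the claim. -/
theorem sum_norm_sq_of_parallel {ξ : E} (hξ : ξ ≠ 0) {z : Fin n → ℂ}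
    (h : ∀ i j, (ξ j : ℂ) * z i = ξ i * z j) :
    ∑ i, ‖z i‖ ^ 2 = ‖∑ i, (ξ i : ℂ) * z i‖ ^ 2 / ‖ξ‖ ^ 2 := by
  set s := ∑ i, (ξ i : ℂ) * z i
  have h1 : ∀ i, ((‖ξ‖ ^ 2 : ℝ) : ℂ) * z i = ξ i * s := by
    intro i
    rw [EuclideanSpace.real_norm_sq_eq]
    simp only [s, Finset.mul_sum]
    push_cast
    rw [Finset.sum_mul]
    refine Finset.sum_congr rfl fun j _ => ?_
    linear_combination (ξ j : ℂ) * h i j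
  have h2 : ∀ i, ‖ξ‖ ^ 4 * ‖z i‖ ^ 2 = ξ i ^ 2 * ‖s‖ ^ 2 := by
    intro i
    have := congrArg (fun w => ‖w‖ ^ 2) (h1 i)
    simp only [norm_mul, mul_pow, Complex.norm_real, Real.norm_eq_abs, sq_abs] at this
    rw [← this]
    ring
  have h3 : ‖ξ‖ ^ 4 * ∑ i, ‖z i‖ ^ 2 = ‖ξ‖ ^ 2 * ‖s‖ ^ 2 := by
    rw [Finset.mul_sum, Finset.sum_congr rfl fun i _ => h2 i, ← Finset.sum_mul,
      EuclideanSpace.real_norm_sq_eq]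
  have hn : ‖ξ‖ ≠ 0 := norm_ne_zero_iff.2 hξ
  rw [eq_div_iff (by positivity)]
  have : ‖ξ‖ ^ 2 ≠ 0 := by positivity
  apply mul_left_cancel₀ this
  linear_combination h3

/-- The stray field energy in Fourier space. -/
theorem strayEnergy_eq {F : E3 → E3} (hF : MemLp F 2 volume) :
    strayEnergy F = ∫ ξ : E3, ‖∑ i, (ξ i : ℂ) * realFourier (fun x => F x i) ξ‖ ^ 2 / ‖ξ‖ ^ 2 := by
  have hS := memLp_strayField F
  have hSm := fun i => MemLp.apply_euclidean hS i
  have hFm := fun i => MemLp.apply_euclidean hF i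
  have hpar : ∀ᵐ ξ : E3, ∀ i j, (ξ j : ℂ) * realFourier (fun x => strayField F x i) ξ =
      ξ i * realFourier (fun x => strayField F x j) ξ := by
    refine ae_all_iff.2 fun i => ae_all_iff.2 fun j => ?_
    have hmem : -(gradientFields.starProjection (hF.toLp F)) ∈ gradientFields :=
      neg_mem (Submodule.starProjection_apply_mem _ _)
    have := realFourier_gradientFields hmem i j
    simpa only [strayField, dif_pos hF] using this
  -- The stray field plus F is weakly divergence free, so its frequency component is minus that of
  -- F. The factors 1 match the form of `realFourier_linear`.
  have hdiv := realFourier_weakDiv (u := fun i x => 1 * strayField F x i + 1 * F x i)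
    (ρ := fun _ => 0) (fun i => ((hSm i).const_mul 1).add ((hFm i).const_mul 1)) MemLp.zero (by
      intro φ hφ
      have h := strayField_weak hF hφ
      simp only [inner_gradient] at h
      have i1 : ∀ {u : E3 → E3}, MemLp u 2 volume →
          Integrable (fun x => ∑ i, u x i * partialDeriv i φ x) := fun hu =>
        integrable_finsetSum _ fun i _ =>
          (MemLp.apply_euclidean hu i).integrable_mul ((hφ.partialDeriv i).memLp 2)
      simp only [one_mul, add_mul, Finset.sum_add_distrib, zero_mul, integral_zero, neg_zero]
      rw [integral_add (i1 hS) (i1 hF), h, neg_add_cancel])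
  have h0 := realFourier_zero (n := 3)
  have hl : ∀ᵐ ξ : E3, ∀ k, _ := ae_all_iff.2 fun k => realFourier_linear (hSm k) (hFm k) 1 1
  have e : strayEnergy F = ∑ i, ∫ ξ, ‖realFourier (fun x => strayField F x i) ξ‖ ^ 2 := by
    unfold strayEnergy
    simp only [EuclideanSpace.real_norm_sq_eq]
    rw [integral_finsetSum _ fun i _ => (hSm i).integrable_sq]
    exact Finset.sum_congr rfl fun i _ => (integral_norm_sq_realFourier (hSm i)).symm
  rw [e, ← integral_finsetSum _ fun i _ => (memLp_realFourier _).integrable_norm_pow (by simp)]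
  apply integral_congr_ae
  have hne : ∀ᵐ ξ : E3, ξ ≠ 0 := by simp [ae_iff]
  filter_upwards [hpar, hdiv, h0, hl, hne] with ξ hpar hdiv h0 hl hne
  rw [sum_norm_sq_of_parallel hne hpar]
  rw [h0] at hdiv
  simp only [hl] at hdiv
  have h' := (mul_eq_zero.1 hdiv.symm).resolve_left (by simp [Real.pi_ne_zero])
  simp only [Complex.ofReal_one, one_mul, mul_add, Finset.sum_add_distrib] at h'
  rw [eq_neg_of_add_eq_zero_left h', norm_neg]

end Energy

end ThinFilm

namespace ThinFilm

open FourierTransform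

/-! ### L² norms of products, and approximation by truncation to balls. -/

section Truncation

theorem eLpNorm_two_eq {X F : Type*} [MeasurableSpace X] {μ : Measure X} [NormedAddCommGroup F]
    (u : X → F) : eLpNorm u 2 μ = (∫⁻ x, ‖u x‖ₑ ^ 2 ∂μ) ^ (1 / 2 : ℝ) := by
  rw [eLpNorm_eq_lintegral_rpow_enorm_toReal (by norm_num) (by norm_num)]
  simp

theorem eLpNorm_prod_mul {X Y : Type*} [MeasurableSpace X] [MeasurableSpace Y] {μ : Measure X}
    {ν : Measure Y} [SFinite ν] {a : X → ℂ} {b : Y → ℂ} (ha : AEStronglyMeasurable a μ)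
    (hb : AEStronglyMeasurable b ν) :
    eLpNorm (fun p : X × Y => a p.1 * b p.2) 2 (μ.prod ν) = eLpNorm a 2 μ * eLpNorm b 2 ν := by
  simp only [eLpNorm_two_eq, enorm_mul, mul_pow]
  rw [lintegral_prod_mul (f := fun x => ‖a x‖ₑ ^ 2) (g := fun x => ‖b x‖ₑ ^ 2)
    (ha.enorm.pow_const _) (hb.enorm.pow_const _), ENNReal.mul_rpow_of_nonneg _ _ (by norm_num)]

theorem memLp_prod_mul {X Y : Type*} [MeasurableSpace X] [MeasurableSpace Y] {μ : Measure X}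
    {ν : Measure Y} [SFinite μ] [SFinite ν] {a : X → ℂ} {b : Y → ℂ} (ha : MemLp a 2 μ)
    (hb : MemLp b 2 ν) : MemLp (fun p : X × Y => a p.1 * b p.2) 2 (μ.prod ν) := by
  refine ⟨ha.1.comp_fst.mul hb.1.comp_snd, ?_⟩
  rw [eLpNorm_prod_mul ha.1 hb.1]
  exact ENNReal.mul_lt_top ha.2 hb.2

variable {V F : Type*} [NormedAddCommGroup V] [NormedAddCommGroup F]

/-- Truncation of a function to the ball of radius `k`. -/
noncomputable def truncate (k : ℕ) (u : V → F) : V → F := (Metric.ball 0 k).indicator u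

theorem norm_truncate_le (k : ℕ) (u : V → F) (x : V) : ‖truncate k u x‖ ≤ ‖u x‖ :=
  norm_indicator_le_norm_self _ _

theorem truncate_eventually_eq (u : V → F) (x : V) : ∀ᶠ k : ℕ in atTop, truncate k u x = u x := by
  obtain ⟨N, hN⟩ := exists_nat_gt ‖x‖
  filter_upwards [eventually_ge_atTop N] with k hk
  have : (N : ℝ) ≤ k := by exact_mod_cast hk
  exact indicator_of_mem (by simp; linarith) _

variable [MeasurableSpace V] [BorelSpace V]

theorem memLp_truncate {μ : Measure V} {u : V → F} {p : ENNReal} (hu : MemLp u p μ) (k : ℕ) :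
    MemLp (truncate k u) p μ := hu.indicator measurableSet_ball

theorem integrable_truncate [ProperSpace V] {μ : Measure V} [IsFiniteMeasureOnCompacts μ]
    {u : V → F} (hu : MemLp u 2 μ) (k : ℕ) : Integrable (truncate k u) μ := by
  have h : MemLp u 2 (μ.restrict (Metric.ball 0 k)) := hu.restrict _
  have : IsFiniteMeasure (μ.restrict (Metric.ball (0 : V) k)) :=
    ⟨by simpa using measure_ball_lt_top⟩
  exact IntegrableOn.integrable_indicator (h.integrable (by norm_num)) measurableSet_ball

theorem tendsto_eLpNorm_truncate {μ : Measure V} {u : V → F} (hu : MemLp u 2 μ) :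
    Tendsto (fun k => eLpNorm (truncate k u - u) 2 μ) atTop (𝓝 0) := by
  simp only [eLpNorm_two_eq]
  have h0 : (0 : ENNReal) = 0 ^ (1 / 2 : ℝ) := by simp
  rw [h0]
  refine (ENNReal.continuous_rpow_const.tendsto 0).comp ?_
  have hfin : ∫⁻ x, ‖u x‖ₑ ^ 2 ∂μ ≠ ⊤ := by
    intro htop
    have := hu.2.ne
    rw [eLpNorm_two_eq, htop] at this
    simp at this
  rw [← lintegral_zero (μ := μ)]
  apply tendsto_lintegral_of_dominated_convergence' (fun x => ‖u x‖ₑ ^ 2)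
  · exact fun k => ((memLp_truncate hu k).1.sub hu.1).enorm.pow_const _
  · intro k
    filter_upwards with x
    gcongr
    rw [Pi.sub_apply]
    by_cases hx : x ∈ Metric.ball (0 : V) k
    · simp [ThinFilm.truncate, indicator_of_mem hx]
    · simp [ThinFilm.truncate, indicator_of_notMem hx]
  · exact hfin
  · filter_upwards with x
    refine tendsto_const_nhds.congr' ?_
    filter_upwards [truncate_eventually_eq u x] with k hk
    simp [hk]

end Truncation

/-! ### Splitting ℝ³ into plane and vertical line; transforms of products. -/

section Film

/-- Splitting of space points into their planar and vertical components. -/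
noncomputable def splitEquiv : E3 ≃ᵐ E2 × ℝ where
  toFun y := (!₂[y 0, y 1], y 2)
  invFun p := !₂[p.1 0, p.1 1, p.2]
  left_inv y := by ext i; fin_cases i <;> rfl
  right_inv p := by
    refine Prod.ext ?_ rfl
    ext i; fin_cases i <;> rfl
  measurable_toFun := by
    refine Measurable.prodMk ?_ ?_ <;> simp only <;> fun_prop
  measurable_invFun := by
    simp only [Equiv.coe_fn_symm_mk]
    refine (MeasurableEquiv.toLp 2 (Fin 3 → ℝ)).measurable.comp (measurable_pi_lambda _ fun i => ?_)
    fin_cases i <;> simp <;> fun_prop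

theorem splitEquiv_apply (y : E3) : splitEquiv y = (!₂[y 0, y 1], y 2) := rfl

theorem splitEquiv_symm_apply (p : E2 × ℝ) : splitEquiv.symm p = !₂[p.1 0, p.1 1, p.2] := rfl

theorem measurePreserving_splitEquiv : MeasurePreserving splitEquiv volume volume := by
  have h1 := EuclideanSpace.volume_preserving_symm_measurableEquiv_toLp (Fin 3)
  have h2 := volume_preserving_piFinSuccAbove (fun _ : Fin 3 => ℝ) 2
  have h3 := (EuclideanSpace.volume_preserving_symm_measurableEquiv_toLp (Fin 2)).symm
  have h4 : MeasurePreserving (Prod.swap : ℝ × (Fin 2 → ℝ) → _) volume volume :=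
    Measure.measurePreserving_swap
  have h5 := (h3.prod (MeasurePreserving.id (volume : Measure ℝ))).comp (h4.comp (h2.comp h1))
  have e : (splitEquiv : E3 → E2 × ℝ) =
      Prod.map (MeasurableEquiv.toLp 2 (Fin 2 → ℝ)).symm.symm id ∘ Prod.swap ∘
        MeasurableEquiv.piFinSuccAbove (fun _ : Fin 3 => ℝ) 2 ∘
        (MeasurableEquiv.toLp 2 (Fin 3 → ℝ)).symm := by
    funext y
    refine Prod.ext ?_ rfl
    ext i
    fin_cases i <;> rfl
  rw [e]
  exact h5

theorem inner_E3_eq (x y : E3) : inner ℝ x y =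
    inner ℝ (splitEquiv x).1 (splitEquiv y).1 + (splitEquiv x).2 * (splitEquiv y).2 := by
  simp [PiLp.inner_apply, Fin.sum_univ_three, Fin.sum_univ_two, splitEquiv_apply, mul_comm]

theorem norm_sq_E3_eq (x : E3) :
    ‖x‖ ^ 2 = ‖(splitEquiv x).1‖ ^ 2 + (splitEquiv x).2 ^ 2 := by
  simp [EuclideanSpace.real_norm_sq_eq, Fin.sum_univ_three, Fin.sum_univ_two, splitEquiv_apply]

/-- The function `a(x) b(x₃)` on space. -/
noncomputable def tensor (a : E2 → ℂ) (b : ℝ → ℂ) (y : E3) : ℂ :=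
  a (splitEquiv y).1 * b (splitEquiv y).2

theorem memLp_tensor {a : E2 → ℂ} {b : ℝ → ℂ} (ha : MemLp a 2 volume) (hb : MemLp b 2 volume) :
    MemLp (tensor a b) 2 volume :=
  (memLp_prod_mul ha hb).comp_measurePreserving measurePreserving_splitEquiv

theorem eLpNorm_tensor {a : E2 → ℂ} {b : ℝ → ℂ} (ha : AEStronglyMeasurable a volume)
    (hb : AEStronglyMeasurable b volume) :
    eLpNorm (tensor a b) 2 volume = eLpNorm a 2 volume * eLpNorm b 2 volume := by
  rw [← eLpNorm_prod_mul ha hb]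
  exact eLpNorm_comp_measurePreserving (g := fun p : E2 × ℝ => a p.1 * b p.2)
    (ha.comp_fst.mul hb.comp_snd) measurePreserving_splitEquiv

theorem tensor_sub_left (a a' : E2 → ℂ) (b : ℝ → ℂ) :
    tensor a b - tensor a' b = tensor (a - a') b := by
  ext y; simp [tensor, sub_mul]

theorem fourier_tensor (a : E2 → ℂ) (b : ℝ → ℂ) : 𝓕 (tensor a b) = tensor (𝓕 a) (𝓕 b) := by
  ext ξ
  simp only [tensor, Real.fourier_eq']
  rw [← integral_prod_mul, ← Measure.volume_eq_prod,
    ← measurePreserving_splitEquiv.integral_comp splitEquiv.measurableEmbedding]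
  congr 1 with y
  rw [inner_E3_eq]
  simp only [smul_eq_mul]
  rw [show ((-2 * Real.pi * (inner ℝ (splitEquiv y).1 (splitEquiv ξ).1 +
      (splitEquiv y).2 * (splitEquiv ξ).2) : ℝ) : ℂ) * Complex.I =
      ((-2 * Real.pi * inner ℝ (splitEquiv y).1 (splitEquiv ξ).1 : ℝ) : ℂ) * Complex.I +
      ((-2 * Real.pi * inner ℝ (splitEquiv y).2 (splitEquiv ξ).2 : ℝ) : ℂ) * Complex.I by
    push_cast; simp; ring, Complex.exp_add]
  ring

theorem integrable_tensor {a : E2 → ℂ} {b : ℝ → ℂ} (ha : Integrable a) (hb : Integrable b) :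
    Integrable (tensor a b) :=
  measurePreserving_splitEquiv.integrable_comp_of_integrable (ha.mul_prod hb)

/-- For truncated a the integral transform applies and factors by Fubini. By Plancherel both sides
depend continuously on a in L², so the truncation can be removed. -/
theorem l2Fourier_tensor {a : E2 → ℂ} {b : ℝ → ℂ} (ha : MemLp a 2 volume)
    (hb : MemLp b 2 volume) (hb' : Integrable b) :
    l2Fourier (tensor a b) =ᵐ[volume] tensor (l2Fourier a) (𝓕 b) := by
  have hc : l2Fourier b =ᵐ[volume] 𝓕 b := l2Fourier_ae_eq_fourier hb hb'
  have hc2 : MemLp (𝓕 b) 2 volume := (memLp_l2Fourier b).ae_eq hc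
  have hA := memLp_tensor ha hb
  have hB := memLp_tensor (memLp_l2Fourier a) hc2
  have hk : ∀ k, l2Fourier (tensor (truncate k a) b) =ᵐ[volume]
      tensor (l2Fourier (truncate k a)) (𝓕 b) := by
    intro k
    have h1 := memLp_truncate ha k
    have h2 := integrable_truncate ha k
    have h3 := l2Fourier_ae_eq_fourier (memLp_tensor h1 hb) (integrable_tensor h2 hb')
    have h4 := l2Fourier_ae_eq_fourier h1 h2
    have h5 : ∀ᵐ y : E3, l2Fourier (truncate k a) (splitEquiv y).1 =
        𝓕 (truncate k a) (splitEquiv y).1 :=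
      measurePreserving_splitEquiv.quasiMeasurePreserving.ae
        (Measure.quasiMeasurePreserving_fst.ae h4)
    filter_upwards [h3, h5] with y h3 h5
    rw [h3, fourier_tensor, tensor, tensor, h5]
  have hle : ∀ k, eLpNorm (l2Fourier (tensor a b) - tensor (l2Fourier a) (𝓕 b)) 2 volume ≤
      eLpNorm (truncate k a - a) 2 volume * eLpNorm b 2 volume +
        eLpNorm (truncate k a - a) 2 volume * eLpNorm (𝓕 b) 2 volume := by
    intro k
    have h1 := memLp_truncate ha k
    have e : l2Fourier (tensor a b) - tensor (l2Fourier a) (𝓕 b) =ᵐ[volume]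
        (l2Fourier (tensor a b) - l2Fourier (tensor (truncate k a) b)) +
        (tensor (l2Fourier (truncate k a)) (𝓕 b) - tensor (l2Fourier a) (𝓕 b)) := by
      filter_upwards [hk k] with y hy
      simp [hy]
    rw [eLpNorm_congr_ae e]
    refine (eLpNorm_add_le ((memLp_l2Fourier _).sub (memLp_l2Fourier _)).1
      ((memLp_tensor (memLp_l2Fourier _) hc2).sub hB).1 (by norm_num)).trans ?_
    rw [eLpNorm_l2Fourier_sub hA (memLp_tensor h1 hb), tensor_sub_left, tensor_sub_left,
      eLpNorm_tensor (ha.sub h1).1 hb.1,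
      eLpNorm_tensor ((memLp_l2Fourier _).sub (memLp_l2Fourier _)).1 hc2.1,
      eLpNorm_l2Fourier_sub h1 ha, eLpNorm_sub_comm]
  have hlim := tendsto_eLpNorm_truncate ha
  have hlim2 := (ENNReal.Tendsto.mul_const (b := eLpNorm b 2 volume) hlim (Or.inr hb.2.ne)).add
    (ENNReal.Tendsto.mul_const (b := eLpNorm (𝓕 b) 2 volume) hlim (Or.inr hc2.2.ne))
  simp only [zero_mul, add_zero] at hlim2
  have h0 : eLpNorm (l2Fourier (tensor a b) - tensor (l2Fourier a) (𝓕 b)) 2 volume = 0 :=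
    le_antisymm (ge_of_tendsto' hlim2 hle) bot_le
  rw [eLpNorm_eq_zero_iff ((memLp_l2Fourier _).sub hB).1 (by norm_num)] at h0
  filter_upwards [h0] with y hy
  exact sub_eq_zero.1 hy

end Film

end ThinFilm

namespace ThinFilm

open FourierTransform

/-! ### The Fourier transform of the characteristic function of [0,t]. -/

section Slab

/-- The characteristic function of `[0, t]`. -/
noncomputable def slab (t : ℝ) : ℝ → ℂ := (Icc 0 t).indicator 1

theorem integrable_slab (t : ℝ) : Integrable (slab t) :=
  (integrable_indicator_iff measurableSet_Icc).2
    (continuous_const (y := (1 : ℂ))).integrableOn_Icc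

theorem memLp_slab (t : ℝ) : MemLp (slab t) 2 volume :=
  memLp_indicator_const 2 measurableSet_Icc 1 (Or.inr (by simp))

theorem memLp_fourier_slab (t : ℝ) : MemLp (𝓕 (slab t)) 2 volume :=
  (memLp_l2Fourier _).ae_eq (l2Fourier_ae_eq_fourier (memLp_slab t) (integrable_slab t))

theorem continuous_fourier_slab (t : ℝ) : Continuous (𝓕 (slab t)) :=
  VectorFourier.fourierIntegral_continuous Real.continuous_fourierChar
    (by exact continuous_inner) (integrable_slab t)

theorem fourier_slab {t : ℝ} (ht : 0 < t) (k : ℝ) :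
    𝓕 (slab t) k = ∫ s in (0 : ℝ)..t, Complex.exp (-2 * Real.pi * k * Complex.I * s) := by
  rw [Real.fourier_eq', intervalIntegral.integral_of_le ht.le, ← integral_Icc_eq_integral_Ioc,
    ← integral_indicator measurableSet_Icc]
  congr 1 with s
  unfold slab
  by_cases hs : s ∈ Icc 0 t
  · rw [indicator_of_mem hs, indicator_of_mem hs]
    simp
    ring_nf
  · rw [indicator_of_notMem hs, indicator_of_notMem hs, smul_zero]

/-- Integrating the exponential gives |exp(-iθ) - 1|² = 2 - 2 cos θ with θ = 2πtk. The form without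
a quotient includes k = 0. -/
theorem sq_mul_norm_fourier_slab {t : ℝ} (ht : 0 < t) (k : ℝ) :
    4 * Real.pi ^ 2 * k ^ 2 * ‖𝓕 (slab t) k‖ ^ 2 = 2 - 2 * Real.cos (2 * Real.pi * t * k) := by
  rcases eq_or_ne k 0 with rfl | hk
  · simp
  have hc : (-2 * Real.pi * k * Complex.I : ℂ) ≠ 0 := by
    simp [hk, Real.pi_ne_zero]
  rw [fourier_slab ht, integral_exp_mul_complex hc, norm_div, div_pow]
  have e1 : ‖(-2 * Real.pi * k * Complex.I : ℂ)‖ ^ 2 = 4 * Real.pi ^ 2 * k ^ 2 := by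
    simp [mul_pow]; norm_num
  rw [e1, mul_div_cancel₀ _ (by positivity)]
  have e2 : (-2 * Real.pi * k * Complex.I * t : ℂ) = ((-(2 * Real.pi * t * k) : ℝ) : ℂ) *
      Complex.I := by
    push_cast; ring
  rw [e2]
  generalize 2 * Real.pi * t * k = θ
  rw [Complex.exp_mul_I, ← Complex.ofReal_cos, ← Complex.ofReal_sin, Complex.sq_norm,
    Complex.normSq_apply]
  simp [-Complex.ofReal_cos, -Complex.ofReal_sin]
  nlinarith [Real.sin_sq_add_cos_sq θ]

/-- The slab function is real, so its transform at -k is the complex conjugate. This makes the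
reflection in `strayEnergy_split` admissible. -/
theorem norm_fourier_slab_neg {t : ℝ} (ht : 0 < t) (k : ℝ) :
    ‖𝓕 (slab t) (-k)‖ = ‖𝓕 (slab t) k‖ := by
  rw [fourier_slab ht, fourier_slab ht, ← RCLike.norm_conj,
    intervalIntegral.integral_of_le ht.le, intervalIntegral.integral_of_le ht.le, ← integral_conj]
  congr 2 with s
  rw [← Complex.exp_conj]
  simp [map_ofNat]

end Slab

/-! ### Energies of film fields and their splitting. -/

section FilmEnergy

variable {t : ℝ} {m : E2 → E3}

theorem ofReal_filmField (t : ℝ) (m : E2 → E3) (i : Fin 3) :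
    (fun y => ((filmField t m y i : ℝ) : ℂ)) = tensor (fun x => (m x i : ℂ)) (slab t) := by
  ext y
  unfold filmField tensor slab
  by_cases h : y 2 ∈ Icc 0 t
  · rw [indicator_of_mem h, indicator_of_mem (by exact h)]
    simp [splitEquiv_apply]
  · rw [indicator_of_notMem h, indicator_of_notMem (by exact h)]
    simp

theorem memLp_filmField (t : ℝ) (hm : MemLp m 2 volume) : MemLp (filmField t m) 2 volume := by
  refine MemLp.of_eval_piLp fun i => ?_
  have h := memLp_tensor (memLp_ofReal (MemLp.apply_euclidean hm i)) (memLp_slab t)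
  rw [← ofReal_filmField] at h
  simpa using h.re

/-- `(2πi)⁻¹` times the symbol of the planar divergence. -/
noncomputable def planarSymbol (m : E2 → E3) (ξ : E2) : ℂ :=
  ξ 0 * realFourier (fun x => m x 0) ξ + ξ 1 * realFourier (fun x => m x 1) ξ

theorem sum_filmField (t : ℝ) (hm : MemLp m 2 volume) : ∀ᵐ ξ : E3,
    ∑ i, (ξ i : ℂ) * realFourier (fun x => filmField t m x i) ξ =
      𝓕 (slab t) (splitEquiv ξ).2 * (planarSymbol m (splitEquiv ξ).1 +
        (splitEquiv ξ).2 * realFourier (fun x => m x 2) (splitEquiv ξ).1) := by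
  have h : ∀ᵐ ξ : E3, ∀ i, realFourier (fun x => filmField t m x i) ξ =
      tensor (realFourier fun x => m x i) (𝓕 (slab t)) ξ := by
    refine ae_all_iff.2 fun i => ?_
    have := l2Fourier_tensor (memLp_ofReal (MemLp.apply_euclidean hm i)) (memLp_slab t)
      (integrable_slab t)
    rwa [← ofReal_filmField] at this
  filter_upwards [h] with ξ h
  simp only [h, Fin.sum_univ_three, tensor, planarSymbol, splitEquiv_apply]
  simp
  ring

theorem strayEnergy_filmField (t : ℝ) (hm : MemLp m 2 volume) :
    strayEnergy (filmField t m) = ∫ p : E2 × ℝ, ‖𝓕 (slab t) p.2‖ ^ 2 *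
      ‖planarSymbol m p.1 + p.2 * realFourier (fun x => m x 2) p.1‖ ^ 2 /
        (‖p.1‖ ^ 2 + p.2 ^ 2) := by
  rw [strayEnergy_eq (memLp_filmField t hm),
    ← measurePreserving_splitEquiv.integral_comp splitEquiv.measurableEmbedding]
  apply integral_congr_ae
  filter_upwards [sum_filmField t hm] with ξ h
  rw [h, norm_mul, mul_pow, norm_sq_E3_eq]

theorem verticalPart_filmField (t : ℝ) (m : E2 → E3) :
    verticalPart (filmField t m) = filmField t (verticalPart m) := by
  ext y i
  unfold verticalPart filmField
  by_cases h : y 2 ∈ Icc 0 t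
  · simp [indicator_of_mem h]
  · simp only [indicator_of_notMem h]; fin_cases i <;> simp

theorem inPlanePart_filmField (t : ℝ) (m : E2 → E3) :
    inPlanePart (filmField t m) = filmField t (inPlanePart m) := by
  ext y i
  unfold inPlanePart filmField
  by_cases h : y 2 ∈ Icc 0 t
  · simp [indicator_of_mem h]
  · simp only [indicator_of_notMem h]; fin_cases i <;> simp

theorem memLp_verticalPart (hm : MemLp m 2 volume) : MemLp (verticalPart m) 2 volume := by
  refine MemLp.of_eval_piLp fun i => ?_
  fin_cases i
  · exact MemLp.zero
  · exact MemLp.zero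
  · exact MemLp.apply_euclidean hm 2

theorem memLp_inPlanePart (hm : MemLp m 2 volume) : MemLp (inPlanePart m) 2 volume := by
  refine MemLp.of_eval_piLp fun i => ?_
  fin_cases i
  · exact MemLp.apply_euclidean hm 0
  · exact MemLp.apply_euclidean hm 1
  · exact MemLp.zero

theorem strayEnergy_vertical (t : ℝ) (hm : MemLp m 2 volume) :
    strayEnergy (verticalPart (filmField t m)) = ∫ p : E2 × ℝ, ‖𝓕 (slab t) p.2‖ ^ 2 *
      (p.2 ^ 2 * ‖realFourier (fun x => m x 2) p.1‖ ^ 2) / (‖p.1‖ ^ 2 + p.2 ^ 2) := by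
  rw [verticalPart_filmField, strayEnergy_filmField t (memLp_verticalPart hm)]
  apply integral_congr_ae
  have h0 := Measure.quasiMeasurePreserving_fst (ν := (volume : Measure ℝ)) |>.ae
    (realFourier_zero (n := 2))
  filter_upwards [h0] with p h0
  simp [planarSymbol, verticalPart, h0, mul_pow]

theorem strayEnergy_inPlane (t : ℝ) (hm : MemLp m 2 volume) :
    strayEnergy (inPlanePart (filmField t m)) = ∫ p : E2 × ℝ, ‖𝓕 (slab t) p.2‖ ^ 2 *
      ‖planarSymbol m p.1‖ ^ 2 / (‖p.1‖ ^ 2 + p.2 ^ 2) := by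
  rw [inPlanePart_filmField, strayEnergy_filmField t (memLp_inPlanePart hm)]
  apply integral_congr_ae
  have h0 := Measure.quasiMeasurePreserving_fst (ν := (volume : Measure ℝ)) |>.ae
    (realFourier_zero (n := 2))
  filter_upwards [h0] with p h0
  simp [planarSymbol, inPlanePart, h0]

/-- Cauchy–Schwarz in ℝ². The factor |ξ|² compensates the singular denominator |ξ|² + k², and later
the singularity at l = 0. -/
theorem norm_planarSymbol_sq_le (m : E2 → E3) (ξ : E2) : ‖planarSymbol m ξ‖ ^ 2 ≤
    ‖ξ‖ ^ 2 * (‖realFourier (fun x => m x 0) ξ‖ ^ 2 + ‖realFourier (fun x => m x 1) ξ‖ ^ 2) := by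
  set a := ‖realFourier (fun x => m x 0) ξ‖
  set b := ‖realFourier (fun x => m x 1) ξ‖
  have h : ‖planarSymbol m ξ‖ ≤ |ξ 0| * a + |ξ 1| * b := by
    refine (norm_add_le _ _).trans ?_
    simp [a, b]
  refine (pow_le_pow_left₀ (norm_nonneg _) h 2).trans ?_
  rw [EuclideanSpace.real_norm_sq_eq, Fin.sum_univ_two, ← sq_abs (ξ 0), ← sq_abs (ξ 1)]
  nlinarith [sq_nonneg (|ξ 0| * b - |ξ 1| * a)]

theorem aestronglyMeasurable_planarSymbol (m : E2 → E3) :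
    AEStronglyMeasurable (planarSymbol m) volume := by
  unfold planarSymbol
  refine (AEStronglyMeasurable.mul ?_ (memLp_realFourier _).1).add
    (AEStronglyMeasurable.mul ?_ (memLp_realFourier _).1)
  all_goals
    refine Continuous.aestronglyMeasurable ?_
    fun_prop

theorem integrable_inPlane_symbol (t : ℝ) (m : E2 → E3) :
    Integrable fun p : E2 × ℝ => ‖𝓕 (slab t) p.2‖ ^ 2 *
      ‖planarSymbol m p.1‖ ^ 2 / (‖p.1‖ ^ 2 + p.2 ^ 2) := by
  have hs := (memLp_fourier_slab t).integrable_norm_pow (by simp)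
  have h0 := ((memLp_realFourier fun x => m x 0).integrable_norm_pow (by simp)).add
    ((memLp_realFourier fun x => m x 1).integrable_norm_pow (by simp))
  refine (h0.mul_prod hs).mono' ?_ ?_
  · refine AEStronglyMeasurable.div₀ (AEStronglyMeasurable.mul ?_ ?_) ?_
    · exact hs.1.comp_snd
    · exact ((aestronglyMeasurable_planarSymbol m).norm.pow 2).comp_fst
    · exact Continuous.aestronglyMeasurable (by fun_prop)
  · filter_upwards with p
    rw [Real.norm_of_nonneg (by positivity)]
    refine div_le_of_le_mul₀ (by positivity) (by simp only [Pi.add_apply]; positivity) ?_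
    have h := norm_planarSymbol_sq_le m p.1
    simp only [Pi.add_apply] at *
    have hc : 0 ≤ ‖𝓕 (slab t) p.2‖ ^ 2 := by positivity
    have := mul_le_mul_of_nonneg_left h hc
    have : 0 ≤ (‖realFourier (fun x => m x 0) p.1‖ ^ 2 + ‖realFourier (fun x => m x 1) p.1‖ ^ 2) *
      ‖𝓕 (slab t) p.2‖ ^ 2 * p.2 ^ 2 := by positivity
    linarith

theorem integrable_vertical_symbol (t : ℝ) (m : E2 → E3) :
    Integrable fun p : E2 × ℝ => ‖𝓕 (slab t) p.2‖ ^ 2 *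
      (p.2 ^ 2 * ‖realFourier (fun x => m x 2) p.1‖ ^ 2) / (‖p.1‖ ^ 2 + p.2 ^ 2) := by
  have hs := (memLp_fourier_slab t).integrable_norm_pow (by simp)
  have h0 := (memLp_realFourier fun x => m x 2).integrable_norm_pow (by simp)
  refine (h0.mul_prod hs).mono' ?_ ?_
  · refine AEStronglyMeasurable.div₀
      (AEStronglyMeasurable.mul ?_ (AEStronglyMeasurable.mul ?_ ?_)) ?_
    · exact hs.1.comp_snd
    · exact Continuous.aestronglyMeasurable (by fun_prop)
    · exact h0.1.comp_fst
    · exact Continuous.aestronglyMeasurable (by fun_prop)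
  · filter_upwards with p
    rw [Real.norm_of_nonneg (by positivity)]
    refine div_le_of_le_mul₀ (by positivity) (by positivity) ?_
    have : 0 ≤ ‖realFourier (fun x => m x 2) p.1‖ ^ 2 *
      ‖𝓕 (slab t) p.2‖ ^ 2 * ‖p.1‖ ^ 2 := by positivity
    linarith

/-- The reflection of the vertical frequency. -/
theorem measurePreserving_neg_snd :
    MeasurePreserving (fun p : E2 × ℝ => (p.1, -p.2)) volume volume :=
  (MeasurePreserving.id (volume : Measure E2)).prod
    (Measure.measurePreserving_neg (volume : Measure ℝ))

/-- The energies of the vertical and the in-plane part of a film field add up. -/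
theorem strayEnergy_split (ht : 0 < t) (hm : MemLp m 2 volume) :
    strayEnergy (filmField t m) = strayEnergy (verticalPart (filmField t m)) +
      strayEnergy (inPlanePart (filmField t m)) := by
  -- J 1 is the density of the full energy and J (-1) its reflection, with the same integral. By the
  -- parallelogram law their sum is free of cross terms.
  let J : ℝ → E2 × ℝ → ℝ := fun s p => ‖𝓕 (slab t) p.2‖ ^ 2 *
      ‖planarSymbol m p.1 + (s * p.2 : ℝ) * realFourier (fun x => m x 2) p.1‖ ^ 2 /
        (‖p.1‖ ^ 2 + p.2 ^ 2)
  have hV := integrable_vertical_symbol t m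
  have hI := integrable_inPlane_symbol t m
  have hpar : ∀ p, J 1 p + J (-1) p = 2 * (‖𝓕 (slab t) p.2‖ ^ 2 *
      (p.2 ^ 2 * ‖realFourier (fun x => m x 2) p.1‖ ^ 2) / (‖p.1‖ ^ 2 + p.2 ^ 2) +
      ‖𝓕 (slab t) p.2‖ ^ 2 * ‖planarSymbol m p.1‖ ^ 2 / (‖p.1‖ ^ 2 + p.2 ^ 2)) := by
    intro p
    have h := parallelogram_law_with_norm ℝ (planarSymbol m p.1)
      ((p.2 : ℂ) * realFourier (fun x => m x 2) p.1)
    have e : ‖(p.2 : ℂ) * realFourier (fun x => m x 2) p.1‖ ^ 2 =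
        p.2 ^ 2 * ‖realFourier (fun x => m x 2) p.1‖ ^ 2 := by simp [mul_pow]
    rw [e] at h
    simp only [J, one_mul, neg_mul, Complex.ofReal_neg, ← sub_eq_add_neg]
    rw [← add_div, ← mul_add, h]
    ring
  have hJ0 : ∀ s p, 0 ≤ J s p := fun s p => by simp only [J]; positivity
  have hJm : ∀ s, AEStronglyMeasurable (J s) volume := by
    intro s
    have hs := (memLp_fourier_slab t).1.comp_snd (μ := (volume : Measure E2))
    have h2 := (memLp_realFourier fun x => m x 2).1.comp_fst (ν := (volume : Measure ℝ))
    have h3 := (aestronglyMeasurable_planarSymbol m).comp_fst (ν := (volume : Measure ℝ))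
    refine AEStronglyMeasurable.div₀ (AEStronglyMeasurable.mul (hs.norm.pow 2)
      ((h3.add (AEStronglyMeasurable.mul ?_ h2)).norm.pow 2)) ?_
    · exact Continuous.aestronglyMeasurable (by fun_prop)
    · exact Continuous.aestronglyMeasurable (by fun_prop)
  have hint : Integrable (fun p => J 1 p + J (-1) p) := by
    simp only [hpar]
    exact (hV.add hI).const_mul 2
  have h1 : Integrable (J 1) := hint.mono' (hJm 1) (by
    filter_upwards with p
    rw [Real.norm_of_nonneg (hJ0 _ _)]
    linarith [hJ0 (-1) p])
  have h2 : Integrable (J (-1)) := hint.mono' (hJm _) (by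
    filter_upwards with p
    rw [Real.norm_of_nonneg (hJ0 _ _)]
    linarith [hJ0 1 p])
  have hsymm : ∫ p, J (-1) p = ∫ p, J 1 p := by
    have hE : MeasurableEmbedding (fun p : E2 × ℝ => (p.1, -p.2)) :=
      (MeasurableEquiv.prodCongr (MeasurableEquiv.refl E2)
        (MeasurableEquiv.neg ℝ)).measurableEmbedding
    rw [← measurePreserving_neg_snd.integral_comp hE]
    simp only [J, norm_fourier_slab_neg ht]
    simp
  have hsum : ∫ p, (J 1 p + J (-1) p) = _ := integral_add h1 h2
  rw [hsymm] at hsum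
  simp only [hpar] at hsum
  rw [integral_const_mul, integral_add hV hI] at hsum
  rw [strayEnergy_vertical t hm, strayEnergy_inPlane t hm, strayEnergy_filmField t hm]
  have e : ∫ p, J 1 p = ∫ p : E2 × ℝ, ‖𝓕 (slab t) p.2‖ ^ 2 *
      ‖planarSymbol m p.1 + p.2 * realFourier (fun x => m x 2) p.1‖ ^ 2 /
        (‖p.1‖ ^ 2 + p.2 ^ 2) := by simp [J]
  linarith

end FilmEnergy

end ThinFilm

namespace ThinFilm

open FourierTransform

/-! ### Gaussian interaction energies in Fourier space and in real space. -/

section GaussianEnergy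

variable {V : Type*} [NormedAddCommGroup V] [InnerProductSpace ℝ V] [FiniteDimensional ℝ V]
  [MeasurableSpace V] [BorelSpace V]

/-- The bound |u v| ≤ u² + v² leaves K times one integrable function, which is the integrand of a
convolution in L¹. -/
theorem integrable_conv_mul {K u v : V → ℝ} (hK : Integrable K) (hu : MemLp u 2 volume)
    (hv : MemLp v 2 volume) :
    Integrable fun p : V × V => K (p.1 - p.2) * (u p.1 * v p.2) := by
  have h2 := hv.integrable_sq.convolution_integrand (ContinuousLinearMap.mul ℝ ℝ) hK
  have h1 := (hu.integrable_sq.convolution_integrand (ContinuousLinearMap.mul ℝ ℝ) hK.comp_neg).swap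
  refine (h1.norm.add h2.norm).mono' ?_ ?_
  · refine AEStronglyMeasurable.mul ?_ (hu.1.comp_fst.mul hv.1.comp_snd)
    exact hK.1.comp_quasiMeasurePreserving
      (quasiMeasurePreserving_sub_of_right_invariant volume volume)
  · filter_upwards with p
    simp only [Pi.add_apply, Function.comp_apply, Prod.fst_swap, Prod.snd_swap,
      ContinuousLinearMap.mul_apply', norm_mul, norm_pow, neg_sub]
    have : ‖u p.1‖ * ‖v p.2‖ ≤ ‖u p.1‖ ^ 2 + ‖v p.2‖ ^ 2 := by
      nlinarith [sq_nonneg (‖u p.1‖ - ‖v p.2‖), sq_nonneg ‖u p.1‖, sq_nonneg ‖v p.2‖]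
    have := mul_le_mul_of_nonneg_left this (norm_nonneg (K (p.1 - p.2)))
    linarith

theorem integrable_exp_neg_mul_norm_sq {c : ℝ} (hc : 0 < c) :
    Integrable fun v : V => Real.exp (-(c * ‖v‖ ^ 2)) := by
  have h := (GaussianFourier.integrable_cexp_neg_mul_sq_norm_add (V := V) (b := (c : ℂ))
    (by simpa using hc) 0 0).norm
  refine h.congr ?_
  filter_upwards with v
  rw [Complex.norm_exp]
  congr 1
  rw [show (-(c : ℂ) * (‖v‖ : ℂ) ^ 2 + 0 * ((inner ℝ (0 : V) v : ℝ) : ℂ)) =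
    ((-(c * ‖v‖ ^ 2) : ℝ) : ℂ) by push_cast; ring, Complex.ofReal_re]

theorem fourier_neg_eq_conj (u : V → ℝ) (ξ : V) :
    𝓕 (fun x => (u x : ℂ)) (-ξ) = starRingEnd ℂ (𝓕 (fun x => (u x : ℂ)) ξ) := by
  rw [Real.fourier_eq', Real.fourier_eq', ← integral_conj]
  congr 1 with x
  simp only [smul_eq_mul, map_mul, Complex.conj_ofReal, ← Complex.exp_conj, Complex.conj_I,
    inner_neg_right]
  push_cast
  ring_nf

theorem fourier_flip {f g : V → ℂ} (hf : Integrable f) (hg : Integrable g) :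
    ∫ ξ, 𝓕 f ξ * g ξ = ∫ x, f x * 𝓕 g x := by
  have := VectorFourier.integral_fourierIntegral_smul_eq_flip (L := innerₗ V)
    Real.continuous_fourierChar continuous_inner hf hg
  simpa using! this

theorem exists_bound_fourier {f : V → ℂ} (_hf : Integrable f) : ∃ C, ∀ ξ, ‖𝓕 f ξ‖ ≤ C :=
  ⟨_, fun ξ => VectorFourier.norm_fourierIntegral_le_integral_norm _ _ _ f ξ⟩

theorem continuous_fourier {f : V → ℂ} (hf : Integrable f) : Continuous (𝓕 f) :=
  VectorFourier.fourierIntegral_continuous Real.continuous_fourierChar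
    (by exact continuous_inner) hf

/-- For real u one has |û(ξ)|² = û(ξ) û(-ξ). Duality moves the transform from the first factor onto
û(-ξ) times the Gaussian, whose transform is u convolved with the dual Gaussian. -/
theorem gaussian_energy_of_integrable {u : V → ℝ} (hu : Integrable u) (hu2 : MemLp u 2 volume)
    {l : ℝ} (hl : 0 < l) :
    ∫ ξ : V, ‖𝓕 (fun x => (u x : ℂ)) ξ‖ ^ 2 * Real.exp (-(Real.pi / l ^ 2 * ‖ξ‖ ^ 2)) =
      l ^ Module.finrank ℝ V *
        ∫ p : V × V, Real.exp (-(Real.pi * l ^ 2 * ‖p.1 - p.2‖ ^ 2)) * (u p.1 * u p.2) := by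
  have hpi := Real.pi_pos
  set b : ℝ := Real.pi / l ^ 2 with hb
  have hbpos : 0 < b := by positivity
  set U : V → ℂ := 𝓕 (fun x => (u x : ℂ)) with hU
  have huc : Integrable (fun x => (u x : ℂ)) := hu.ofReal
  obtain ⟨C, hC⟩ := exists_bound_fourier huc
  have hUc : Continuous U := continuous_fourier huc
  let G : V → ℝ := fun ξ => Real.exp (-(b * ‖ξ‖ ^ 2))
  have hG : Integrable G := integrable_exp_neg_mul_norm_sq hbpos
  have hGc : Integrable (fun ξ => (G ξ : ℂ)) := hG.ofReal
  -- The modulated Gaussian, whose transform is a Gaussian centred at x.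
  let h : V → V → ℂ := fun x ξ =>
    Complex.exp (-(b : ℂ) * ‖ξ‖ ^ 2 + 2 * Real.pi * Complex.I * (inner ℝ x ξ : ℝ))
  have hh : ∀ x, Integrable (h x) := fun x =>
    GaussianFourier.integrable_cexp_neg_mul_sq_norm_add (by simpa using hbpos) _ _
  have hhF : ∀ x y, 𝓕 (h x) y =
      ((l ^ Module.finrank ℝ V * Real.exp (-(Real.pi * l ^ 2 * ‖x - y‖ ^ 2)) : ℝ) : ℂ) := by
    intro x y
    rw [show 𝓕 (h x) y = _ from fourier_gaussian_innerProductSpace' (by simpa using hbpos) x y]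
    have e1 : (Real.pi : ℂ) / (b : ℂ) = ((l ^ 2 : ℝ) : ℂ) := by
      rw [← Complex.ofReal_div]; congr 1; rw [hb]; field_simp
    have e2 : (((l ^ 2 : ℝ) : ℂ)) ^ ((Module.finrank ℝ V : ℂ) / 2) =
        ((l ^ Module.finrank ℝ V : ℝ) : ℂ) := by
      rw [show ((Module.finrank ℝ V : ℂ) / 2) = (((Module.finrank ℝ V : ℝ) / 2 : ℝ) : ℂ) by
        push_cast; ring, ← Complex.ofReal_cpow (by positivity)]
      congr 1
      rw [← Real.rpow_natCast l 2, ← Real.rpow_mul hl.le, ← Real.rpow_natCast]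
      congr 1; push_cast; ring
    have e3 : -(Real.pi : ℂ) ^ 2 * (‖x - y‖ : ℂ) ^ 2 / (b : ℂ) =
        ((-(Real.pi * l ^ 2 * ‖x - y‖ ^ 2) : ℝ) : ℂ) := by
      rw [hb]; push_cast; field_simp
    rw [e1, e2, e3, ← Complex.ofReal_exp]
    push_cast; ring
  have hg : Integrable (fun ξ => U (-ξ) * (G ξ : ℂ)) :=
    hGc.bdd_mul (hUc.comp continuous_neg).aestronglyMeasurable
      (Eventually.of_forall fun ξ => hC (-ξ))
  have hgF : ∀ x, 𝓕 (fun ξ => U (-ξ) * (G ξ : ℂ)) x =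
      ((l ^ Module.finrank ℝ V *
        ∫ y, Real.exp (-(Real.pi * l ^ 2 * ‖x - y‖ ^ 2)) * u y : ℝ) : ℂ) := by
    intro x
    -- The substitution ξ ↦ -ξ turns the integrand into û times `h x`, so duality can be used a
    -- second time.
    rw [Real.fourier_eq', ← integral_neg_eq_self]
    have e : ∀ ξ : V, Complex.exp (((-2 * Real.pi * inner ℝ (-ξ) x : ℝ) : ℂ) * Complex.I) •
        (U (- -ξ) * (G (-ξ) : ℂ)) = U ξ * h x ξ := by
      intro ξ
      simp only [G, h, neg_neg, norm_neg, Complex.ofReal_exp, smul_eq_mul]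
      rw [mul_left_comm, ← Complex.exp_add]
      congr 2
      rw [inner_neg_left, real_inner_comm]
      push_cast; ring
    simp only [e]
    rw [hU, fourier_flip huc (hh x)]
    simp only [hhF, ← Complex.ofReal_mul]
    rw [integral_complex_ofReal, ← integral_const_mul]
    congr 2 with y
    ring
  have key := fourier_flip huc hg
  have e1 : ∀ ξ, U ξ * (U (-ξ) * (G ξ : ℂ)) = ((‖U ξ‖ ^ 2 * G ξ : ℝ) : ℂ) := by
    intro ξ
    rw [hU, fourier_neg_eq_conj, ← mul_assoc, Complex.mul_conj, Complex.normSq_eq_norm_sq]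
    push_cast; ring
  simp only [hgF, ← hU, e1, ← Complex.ofReal_mul] at key
  rw [integral_complex_ofReal, integral_complex_ofReal, Complex.ofReal_inj] at key
  refine key.trans ?_
  rw [Measure.volume_eq_prod, integral_prod]
  · rw [← integral_const_mul]
    congr 1 with x
    rw [mul_left_comm, ← integral_const_mul]
    congr 2 with y
    ring
  · exact integrable_conv_mul (K := fun v => Real.exp (-(Real.pi * l ^ 2 * ‖v‖ ^ 2)))
      (integrable_exp_neg_mul_norm_sq (by positivity)) hu2 hu2

/-- With the weight written as a square, the integral is the squared L² norm of w·u. Multiplication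
by w is a contraction, so convergence in L² is passed on. -/
theorem tendsto_integral_norm_sq_mul {X F : Type*} [MeasurableSpace X] {μ : Measure X}
    [NormedAddCommGroup F] [NormedSpace ℝ F] {a : ℕ → X → F} {b : X → F} (ha : ∀ k, MemLp (a k) 2 μ)
    (hb : MemLp b 2 μ) (h : Tendsto (fun k => eLpNorm (a k - b) 2 μ) atTop (𝓝 0)) {w : X → ℝ}
    (hw : AEStronglyMeasurable w μ) (hw1 : ∀ x, ‖w x‖ ≤ 1) :
    Tendsto (fun k => ∫ x, ‖a k x‖ ^ 2 * w x ^ 2 ∂μ) atTop (𝓝 (∫ x, ‖b x‖ ^ 2 * w x ^ 2 ∂μ)) := by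
  have hm : ∀ {u : X → F}, MemLp u 2 μ → MemLp (fun x => w x • u x) 2 μ := fun {u} hu =>
    hu.mono (hw.smul hu.1) (by
      filter_upwards with x
      rw [norm_smul]
      exact mul_le_of_le_one_left (norm_nonneg _) (hw1 x))
  have e : ∀ {u : X → F}, (hu : MemLp u 2 μ) →
      ∫ x, ‖u x‖ ^ 2 * w x ^ 2 ∂μ = ‖(hm hu).toLp‖ ^ 2 := by
    intro u hu
    rw [Lp.norm_toLp, ← integral_norm_sq_eq_eLpNorm (hm hu)]
    congr 1 with x
    rw [norm_smul, mul_pow, Real.norm_eq_abs, sq_abs, mul_comm]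
  rw [e hb]
  simp only [e (ha _)]
  refine Tendsto.pow (Tendsto.norm ?_) 2
  rw [Lp.tendsto_Lp_iff_tendsto_eLpNorm'']
  refine tendsto_of_tendsto_of_tendsto_of_le_of_le tendsto_const_nhds h (fun _ => bot_le)
    fun k => ?_
  refine eLpNorm_mono fun x => ?_
  simp only [Pi.sub_apply, ← smul_sub]
  rw [norm_smul]
  exact mul_le_of_le_one_left (norm_nonneg _) (hw1 x)

theorem tendsto_l2Fourier_truncate {u : V → ℝ} (hu : MemLp u 2 volume) :
    Tendsto (fun k => eLpNorm (l2Fourier (fun x => ((truncate k u x : ℝ) : ℂ)) -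
      l2Fourier (fun x => (u x : ℂ))) 2 volume) atTop (𝓝 0) := by
  have huc := memLp_ofReal hu
  have hcast : ∀ k, (fun x => ((truncate k u x : ℝ) : ℂ)) = truncate k (fun x => (u x : ℂ)) := by
    intro k
    ext x
    by_cases hx : x ∈ Metric.ball (0 : V) k
    · simp [truncate, indicator_of_mem hx]
    · simp [truncate, indicator_of_notMem hx]
  refine (tendsto_eLpNorm_truncate huc).congr fun k => ?_
  rw [eLpNorm_l2Fourier_sub (memLp_ofReal (memLp_truncate hu k)) huc, hcast]

theorem tendsto_gaussian_truncate {u : V → ℝ} (hu : MemLp u 2 volume) (l : ℝ) :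
    Tendsto (fun k => ∫ ξ : V, ‖l2Fourier (fun x => ((truncate k u x : ℝ) : ℂ)) ξ‖ ^ 2 *
      Real.exp (-(Real.pi / l ^ 2 * ‖ξ‖ ^ 2))) atTop (𝓝 (∫ ξ : V,
      ‖l2Fourier (fun x => (u x : ℂ)) ξ‖ ^ 2 * Real.exp (-(Real.pi / l ^ 2 * ‖ξ‖ ^ 2)))) := by
  have hw : ∀ ξ : V, Real.exp (-(Real.pi / l ^ 2 * ‖ξ‖ ^ 2)) =
      Real.exp (-(Real.pi / l ^ 2 * ‖ξ‖ ^ 2 / 2)) ^ 2 := by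
    intro ξ
    rw [← Real.exp_nat_mul]
    congr 1
    push_cast
    ring
  simp only [hw]
  refine tendsto_integral_norm_sq_mul (F := ℂ) (fun k => memLp_l2Fourier _) (memLp_l2Fourier _)
    (tendsto_l2Fourier_truncate hu) (Continuous.aestronglyMeasurable (by fun_prop)) fun ξ => ?_
  rw [Real.norm_eq_abs, Real.abs_exp, Real.exp_le_one_iff, neg_nonpos]
  have := Real.pi_pos
  positivity

/-- A Gaussian interaction energy in Fourier space. -/
theorem gaussian_energy {u : V → ℝ} (hu : MemLp u 2 volume) {l : ℝ} (hl : 0 < l) :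
    ∫ ξ : V, ‖l2Fourier (fun x => (u x : ℂ)) ξ‖ ^ 2 * Real.exp (-(Real.pi / l ^ 2 * ‖ξ‖ ^ 2)) =
      l ^ Module.finrank ℝ V *
        ∫ p : V × V, Real.exp (-(Real.pi * l ^ 2 * ‖p.1 - p.2‖ ^ 2)) * (u p.1 * u p.2) := by
  have hpi := Real.pi_pos
  have hT := fun k => memLp_truncate hu k
  have hTc := fun k => memLp_ofReal (hT k)
  have heq : ∀ k, ∫ ξ : V, ‖l2Fourier (fun x => ((truncate k u x : ℝ) : ℂ)) ξ‖ ^ 2 *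
      Real.exp (-(Real.pi / l ^ 2 * ‖ξ‖ ^ 2)) = l ^ Module.finrank ℝ V *
        ∫ p : V × V, Real.exp (-(Real.pi * l ^ 2 * ‖p.1 - p.2‖ ^ 2)) *
          (truncate k u p.1 * truncate k u p.2) := by
    intro k
    rw [← gaussian_energy_of_integrable (integrable_truncate hu k) (hT k) hl]
    apply integral_congr_ae
    filter_upwards [l2Fourier_ae_eq_fourier (hTc k) (integrable_truncate hu k).ofReal] with ξ hξ
    rw [hξ]
  have L1 := tendsto_gaussian_truncate hu l
  have L2 : Tendsto (fun k => l ^ Module.finrank ℝ V *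
        ∫ p : V × V, Real.exp (-(Real.pi * l ^ 2 * ‖p.1 - p.2‖ ^ 2)) *
          (truncate k u p.1 * truncate k u p.2)) atTop (𝓝 (l ^ Module.finrank ℝ V *
        ∫ p : V × V, Real.exp (-(Real.pi * l ^ 2 * ‖p.1 - p.2‖ ^ 2)) * (u p.1 * u p.2))) := by
    apply Tendsto.const_mul
    have hK := integrable_exp_neg_mul_norm_sq (V := V) (c := Real.pi * l ^ 2) (by positivity)
    apply tendsto_integral_of_dominated_convergence (fun p : V × V =>
      ‖Real.exp (-(Real.pi * l ^ 2 * ‖p.1 - p.2‖ ^ 2)) * (u p.1 * u p.2)‖)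
    · exact fun k => (integrable_conv_mul hK (hT k) (hT k)).1
    · exact (integrable_conv_mul hK hu hu).norm
    · intro k
      filter_upwards with p
      simp only [norm_mul]
      gcongr <;> exact norm_truncate_le _ _ _
    · filter_upwards with p
      refine tendsto_const_nhds.congr' ?_
      filter_upwards [truncate_eventually_eq u p.1, truncate_eventually_eq u p.2] with k h1 h2
      rw [h1, h2]
  simp only [heq] at L1
  exact tendsto_nhds_unique L1 L2

end GaussianEnergy

end ThinFilm

namespace ThinFilm

open FourierTransform

/-! ### The symbol 1/|ξ|² as a superposition of Gaussians. -/

section Superposition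

theorem measurable_l2Fourier {V : Type*} [NormedAddCommGroup V] [InnerProductSpace ℝ V]
    [FiniteDimensional ℝ V] [MeasurableSpace V] [BorelSpace V] (u : V → ℂ) :
    Measurable (l2Fourier u) := by
  unfold l2Fourier
  split_ifs with h
  · exact (Lp.stronglyMeasurable _).measurable
  · exact measurable_zero

/-- The function `1 / (4π² R)` as a superposition of Gaussians. -/
theorem lintegral_gaussian_superposition {R : ℝ} (hR : 0 < R) :
    ∫⁻ l in Ioi (0 : ℝ), ENNReal.ofReal (1 / (2 * Real.pi) * (l ^ 3)⁻¹ *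
      Real.exp (-(Real.pi / l ^ 2 * R))) = ENNReal.ofReal (1 / (4 * Real.pi ^ 2 * R)) := by
  have hpi := Real.pi_pos
  -- A primitive of the integrand, equal to 0 at l = 0 so that it is continuous from the right
  -- there; division by zero would give the wrong value.
  let g : ℝ → ℝ := fun l => if l = 0 then 0 else
    1 / (4 * Real.pi ^ 2 * R) * Real.exp (-(Real.pi / l ^ 2 * R))
  let g' : ℝ → ℝ := fun l => 1 / (2 * Real.pi) * (l ^ 3)⁻¹ * Real.exp (-(Real.pi / l ^ 2 * R))
  have hcont : ContinuousWithinAt g (Ici 0) 0 := by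
    refine (continuousAt_iff_punctured_nhds.2 ?_).continuousWithinAt
    have h1 : Tendsto (fun l : ℝ => (l ^ 2)⁻¹) (𝓝[≠] 0) atTop := by
      refine tendsto_inv_nhdsGT_zero.comp (tendsto_nhdsWithin_iff.2 ⟨?_, ?_⟩)
      · have : Tendsto (fun l : ℝ => l ^ 2) (𝓝 0) (𝓝 (0 ^ 2)) := (continuous_pow 2).tendsto 0
        simp only [ne_eq, OfNat.ofNat_ne_zero, not_false_eq_true, zero_pow] at this
        exact this.mono_left nhdsWithin_le_nhds
      · filter_upwards [self_mem_nhdsWithin] with l hl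
        have : l ≠ 0 := hl
        exact mem_Ioi.2 (by positivity)
    have h2 : Tendsto (fun l : ℝ => 1 / (4 * Real.pi ^ 2 * R) *
        Real.exp (-(Real.pi * R * (l ^ 2)⁻¹))) (𝓝[≠] 0) (𝓝 (1 / (4 * Real.pi ^ 2 * R) * 0)) :=
      (Real.tendsto_exp_neg_atTop_nhds_zero.comp
        (h1.const_mul_atTop (by positivity : 0 < Real.pi * R))).const_mul _
    rw [mul_zero] at h2
    have e : g 0 = 0 := by simp [g]
    rw [e]
    refine h2.congr' ?_
    filter_upwards [self_mem_nhdsWithin] with l hl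
    simp only [g, if_neg (show ¬ l = 0 from hl)]
    congr 3
    ring
  have hderiv : ∀ l ∈ Ioi (0 : ℝ), HasDerivAt g (g' l) l := by
    intro l hl
    have hl0 : l ≠ 0 := ne_of_gt hl
    have h1 : HasDerivAt (fun l : ℝ => -(Real.pi / l ^ 2 * R))
        (-((0 * l ^ 2 - Real.pi * (2 * l)) / (l ^ 2) ^ 2 * R)) l := by
      have := ((((hasDerivAt_const l Real.pi).div (hasDerivAt_pow 2 l)
        (pow_ne_zero 2 hl0)).mul_const R)).neg
      exact this.congr_deriv (by norm_num)
    have h2 := (h1.exp).const_mul (1 / (4 * Real.pi ^ 2 * R))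
    have h3 : HasDerivAt (fun l : ℝ => 1 / (4 * Real.pi ^ 2 * R) *
        Real.exp (-(Real.pi / l ^ 2 * R))) (g' l) l := by
      refine h2.congr_deriv ?_
      simp only [g']
      field_simp
      ring
    refine h3.congr_of_eventuallyEq ?_
    filter_upwards [eventually_ne_nhds hl0] with x hx
    simp [g, hx]
  have hpos : ∀ l ∈ Ioi (0 : ℝ), 0 ≤ g' l := by
    intro l hl
    have : 0 < l := hl
    simp only [g']; positivity
  have hlim : Tendsto g atTop (𝓝 (1 / (4 * Real.pi ^ 2 * R))) := by
    have h1 : Tendsto (fun l : ℝ => Real.pi / l ^ 2 * R) atTop (𝓝 0) := by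
      have : Tendsto (fun l : ℝ => l ^ 2) atTop atTop := tendsto_pow_atTop (by norm_num)
      simpa using (this.const_div_atTop Real.pi).mul_const R
    have h2 : Tendsto (fun l : ℝ => 1 / (4 * Real.pi ^ 2 * R) *
        Real.exp (-(Real.pi / l ^ 2 * R))) atTop (𝓝 (1 / (4 * Real.pi ^ 2 * R) * 1)) := by
      refine Tendsto.const_mul _ ?_
      have := (Real.continuous_exp.tendsto _).comp h1.neg
      simpa using! this
    rw [mul_one] at h2
    refine h2.congr' ?_
    filter_upwards [eventually_ne_atTop 0] with l hl
    simp [g, hl]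
  have hint := integrableOn_Ioi_deriv_of_nonneg hcont hderiv hpos hlim
  have hval := integral_Ioi_of_hasDerivAt_of_tendsto hcont hderiv hint hlim
  have h0 : g 0 = 0 := by simp [g]
  rw [h0, sub_zero] at hval
  rw [← hval, ofReal_integral_eq_lintegral_ofReal hint]
  filter_upwards [ae_restrict_mem measurableSet_Ioi] with l hl using hpos l hl

theorem ae_norm_sq_add_pos : ∀ᵐ p : E2 × ℝ, 0 < ‖p.1‖ ^ 2 + p.2 ^ 2 := by
  have h : ∀ᵐ ξ : E2, ξ ≠ 0 := by simp [ae_iff]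
  filter_upwards [(Measure.quasiMeasurePreserving_fst (ν := (volume : Measure ℝ))).ae h] with p hp
  have : 0 < ‖p.1‖ := norm_pos_iff.2 hp
  positivity

/-- Everything is nonnegative, so Tonelli applies with no integrability of the left side. The factor
l⁻³ is split as l⁻² · l⁻¹, the normalisations of `gaussian_energy` in dimensions two and one. -/
theorem integral_gaussian_superposition {w : E2 → ℝ} {v : ℝ → ℝ} (hw : Measurable w)
    (hv : Measurable v) (hw0 : ∀ ξ, 0 ≤ w ξ) (hv0 : ∀ k, 0 ≤ v k)
    (hwi : ∀ l : ℝ, 0 < l → Integrable fun ξ => w ξ * Real.exp (-(Real.pi / l ^ 2 * ‖ξ‖ ^ 2)))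
    (hvi : ∀ l : ℝ, 0 < l → Integrable fun k => v k * Real.exp (-(Real.pi / l ^ 2 * ‖k‖ ^ 2))) :
    ∫ p : E2 × ℝ, w p.1 * v p.2 / (4 * Real.pi ^ 2 * (‖p.1‖ ^ 2 + p.2 ^ 2)) =
      1 / (2 * Real.pi) * ∫ l in Ioi (0 : ℝ),
        ((l ^ 2)⁻¹ * ∫ ξ, w ξ * Real.exp (-(Real.pi / l ^ 2 * ‖ξ‖ ^ 2))) *
        (l⁻¹ * ∫ k, v k * Real.exp (-(Real.pi / l ^ 2 * ‖k‖ ^ 2))) := by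
  have hpi := Real.pi_pos
  rw [← integral_const_mul, integral_eq_lintegral_of_nonneg_ae, integral_eq_lintegral_of_nonneg_ae]
  rotate_left
  · filter_upwards [ae_restrict_mem measurableSet_Ioi] with l hl
    have : 0 < l := hl
    have h1 : 0 ≤ ∫ ξ, w ξ * Real.exp (-(Real.pi / l ^ 2 * ‖ξ‖ ^ 2)) :=
      integral_nonneg fun ξ => mul_nonneg (hw0 ξ) (Real.exp_nonneg _)
    have h2 : 0 ≤ ∫ k, v k * Real.exp (-(Real.pi / l ^ 2 * ‖k‖ ^ 2)) :=
      integral_nonneg fun ξ => mul_nonneg (hv0 ξ) (Real.exp_nonneg _)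
    simp only [Pi.zero_apply]
    positivity
  · refine AEStronglyMeasurable.const_mul ?_ _
    refine AEStronglyMeasurable.mul (AEStronglyMeasurable.mul ?_ ?_)
      (AEStronglyMeasurable.mul ?_ ?_)
    · exact (by fun_prop : Measurable fun l : ℝ => (l ^ 2)⁻¹).aestronglyMeasurable
    · refine (StronglyMeasurable.integral_prod_right (f := fun (l : ℝ) (ξ : E2) =>
        w ξ * Real.exp (-(Real.pi / l ^ 2 * ‖ξ‖ ^ 2))) ?_).aestronglyMeasurable
      exact Measurable.stronglyMeasurable (by unfold Function.uncurry; fun_prop)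
    · exact (by fun_prop : Measurable fun l : ℝ => l⁻¹).aestronglyMeasurable
    · refine (StronglyMeasurable.integral_prod_right (f := fun (l : ℝ) (k : ℝ) =>
        v k * Real.exp (-(Real.pi / l ^ 2 * ‖k‖ ^ 2))) ?_).aestronglyMeasurable
      exact Measurable.stronglyMeasurable (by unfold Function.uncurry; fun_prop)
  · filter_upwards with p
    have := hw0 p.1
    have := hv0 p.2
    simp only [Pi.zero_apply]
    positivity
  · exact Measurable.aestronglyMeasurable (by fun_prop)
  congr 1
  calc ∫⁻ p : E2 × ℝ, ENNReal.ofReal (w p.1 * v p.2 / (4 * Real.pi ^ 2 * (‖p.1‖ ^ 2 + p.2 ^ 2)))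
      = ∫⁻ p : E2 × ℝ, ∫⁻ l in Ioi (0 : ℝ), ENNReal.ofReal (w p.1 * v p.2) *
        ENNReal.ofReal (1 / (2 * Real.pi) * (l ^ 3)⁻¹ *
          Real.exp (-(Real.pi / l ^ 2 * (‖p.1‖ ^ 2 + p.2 ^ 2)))) := by
        apply lintegral_congr_ae
        filter_upwards [ae_norm_sq_add_pos] with p hp
        rw [lintegral_const_mul _ (by fun_prop), lintegral_gaussian_superposition hp,
          ← ENNReal.ofReal_mul (mul_nonneg (hw0 _) (hv0 _))]
        congr 1
        ring
    _ = ∫⁻ l in Ioi (0 : ℝ), ∫⁻ p : E2 × ℝ, ENNReal.ofReal (w p.1 * v p.2) *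
        ENNReal.ofReal (1 / (2 * Real.pi) * (l ^ 3)⁻¹ *
          Real.exp (-(Real.pi / l ^ 2 * (‖p.1‖ ^ 2 + p.2 ^ 2)))) := by
        apply lintegral_lintegral_swap
        exact Measurable.aemeasurable (by unfold Function.uncurry; fun_prop)
    _ = _ := by
        apply setLIntegral_congr_fun measurableSet_Ioi
        intro l hl
        have hl0 : 0 < l := hl
        have e : ∀ p : E2 × ℝ, ENNReal.ofReal (w p.1 * v p.2) *
            ENNReal.ofReal (1 / (2 * Real.pi) * (l ^ 3)⁻¹ *
              Real.exp (-(Real.pi / l ^ 2 * (‖p.1‖ ^ 2 + p.2 ^ 2)))) =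
            ENNReal.ofReal (1 / (2 * Real.pi) * (l ^ 3)⁻¹) *
            (ENNReal.ofReal (w p.1 * Real.exp (-(Real.pi / l ^ 2 * ‖p.1‖ ^ 2))) *
              ENNReal.ofReal (v p.2 * Real.exp (-(Real.pi / l ^ 2 * ‖p.2‖ ^ 2)))) := by
          intro p
          have h1 := hw0 p.1
          have h2 := hv0 p.2
          rw [← ENNReal.ofReal_mul (by positivity), ← ENNReal.ofReal_mul (by positivity),
            ← ENNReal.ofReal_mul (by positivity)]
          congr 1
          rw [mul_add, neg_add, Real.exp_add, Real.norm_eq_abs p.2, sq_abs]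
          ring
        simp only [e]
        rw [lintegral_const_mul _ (by fun_prop), Measure.volume_eq_prod,
          lintegral_prod_mul (f := fun ξ : E2 =>
            ENNReal.ofReal (w ξ * Real.exp (-(Real.pi / l ^ 2 * ‖ξ‖ ^ 2))))
            (g := fun k : ℝ => ENNReal.ofReal (v k * Real.exp (-(Real.pi / l ^ 2 * ‖k‖ ^ 2))))
            (by fun_prop) (by fun_prop),
          ← ofReal_integral_eq_lintegral_ofReal (hwi l hl0)
            (Eventually.of_forall fun ξ => mul_nonneg (hw0 ξ) (Real.exp_nonneg _)),
          ← ofReal_integral_eq_lintegral_ofReal (hvi l hl0)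
            (Eventually.of_forall fun ξ => mul_nonneg (hv0 ξ) (Real.exp_nonneg _)),
          ← ENNReal.ofReal_mul (integral_nonneg fun ξ => mul_nonneg (hw0 ξ) (Real.exp_nonneg _)),
          ← ENNReal.ofReal_mul (by positivity)]
        congr 1
        field_simp

end Superposition

/-! ### The two energies as superpositions of Gaussian interaction energies. -/

section EnergyFormulas

/-- The Gaussian interaction energy of a planar density. -/
noncomputable def planarGauss (u : E2 → ℝ) (l : ℝ) : ℝ :=
  ∫ p : E2 × E2, Real.exp (-(Real.pi * l ^ 2 * ‖p.1 - p.2‖ ^ 2)) * (u p.1 * u p.2)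

theorem planarGauss_eq {u : E2 → ℝ} (hu : MemLp u 2 volume) {l : ℝ} (hl : 0 < l) :
    planarGauss u l = (l ^ 2)⁻¹ *
      ∫ ξ, ‖realFourier u ξ‖ ^ 2 * Real.exp (-(Real.pi / l ^ 2 * ‖ξ‖ ^ 2)) := by
  rw [realFourier, gaussian_energy hu hl]
  simp only [finrank_euclideanSpace, Fintype.card_fin]
  rw [inv_mul_cancel_left₀ (by positivity), planarGauss]

theorem integrable_mul_gaussian {V : Type*} [NormedAddCommGroup V] [InnerProductSpace ℝ V]
    [FiniteDimensional ℝ V] [MeasurableSpace V] [BorelSpace V] {w : V → ℝ} (hw : Integrable w)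
    {c : ℝ} (hc : 0 ≤ c) : Integrable fun ξ => w ξ * Real.exp (-(c * ‖ξ‖ ^ 2)) := by
  refine hw.mul_bdd (c := 1) (Continuous.aestronglyMeasurable (by fun_prop))
    (Eventually.of_forall fun ξ => ?_)
  rw [Real.norm_eq_abs, Real.abs_exp, Real.exp_le_one_iff, neg_nonpos]
  positivity

/-- The real part of the Fourier transform of a one-dimensional Gaussian at t. -/
theorem integral_cos_mul_gaussian (t : ℝ) {l : ℝ} (hl : 0 < l) :
    ∫ k : ℝ, Real.cos (2 * Real.pi * t * k) * Real.exp (-(Real.pi / l ^ 2 * ‖k‖ ^ 2)) =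
      l * Real.exp (-(Real.pi * l ^ 2 * t ^ 2)) := by
  have hpi := Real.pi_pos
  have hb : 0 < Real.pi / l ^ 2 := by positivity
  have h := fourier_gaussian_innerProductSpace (V := ℝ) (b := ((Real.pi / l ^ 2 : ℝ) : ℂ))
    (by rwa [Complex.ofReal_re]) t
  rw [Real.fourier_eq'] at h
  have hi : Integrable fun v : ℝ => Complex.exp (((-2 * Real.pi * inner ℝ v t : ℝ) : ℂ) *
      Complex.I) •
      Complex.exp (-((Real.pi / l ^ 2 : ℝ) : ℂ) * (‖v‖ : ℂ) ^ 2) := by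
    have := GaussianFourier.integrable_cexp_neg_mul_sq_norm_add (V := ℝ)
      (b := ((Real.pi / l ^ 2 : ℝ) : ℂ)) (by rwa [Complex.ofReal_re]) (-2 * Real.pi * Complex.I) t
    refine this.congr ?_
    filter_upwards with v
    rw [smul_eq_mul, ← Complex.exp_add]
    congr 1
    rw [real_inner_comm]
    push_cast
    ring
  have hre := congrArg Complex.re h
  rw [← Complex.reCLM_apply, ← ContinuousLinearMap.integral_comp_comm _ hi] at hre
  have e1 : ∀ v : ℝ, Complex.reCLM (Complex.exp (((-2 * Real.pi * inner ℝ v t : ℝ) : ℂ) *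
      Complex.I) •
      Complex.exp (-((Real.pi / l ^ 2 : ℝ) : ℂ) * (‖v‖ : ℂ) ^ 2)) =
      Real.cos (2 * Real.pi * t * v) * Real.exp (-(Real.pi / l ^ 2 * ‖v‖ ^ 2)) := by
    intro v
    rw [show -((Real.pi / l ^ 2 : ℝ) : ℂ) * (‖v‖ : ℂ) ^ 2 =
      ((-(Real.pi / l ^ 2 * ‖v‖ ^ 2) : ℝ) : ℂ) by push_cast; ring, ← Complex.ofReal_exp,
      Complex.exp_mul_I, ← Complex.ofReal_cos, ← Complex.ofReal_sin, smul_eq_mul,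
      Complex.reCLM_apply, Complex.re_mul_ofReal, Complex.add_re, Complex.re_ofReal_mul,
      Complex.ofReal_re, Complex.I_re, mul_zero, add_zero]
    congr 1
    rw [← Real.cos_neg]
    congr 1
    simp
    ring
  simp only [e1] at hre
  rw [hre]
  have e2 : (Real.pi : ℂ) / ((Real.pi / l ^ 2 : ℝ) : ℂ) = ((l ^ 2 : ℝ) : ℂ) := by
    rw [← Complex.ofReal_div]; congr 1; field_simp
  have e3 : (((l ^ 2 : ℝ) : ℂ)) ^ ((Module.finrank ℝ ℝ : ℂ) / 2) = (l : ℂ) := by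
    rw [show ((Module.finrank ℝ ℝ : ℂ) / 2) = ((1 / 2 : ℝ) : ℂ) by simp,
      ← Complex.ofReal_cpow (by positivity), ← Real.sqrt_eq_rpow, Real.sqrt_sq hl.le]
  have e4 : -(Real.pi : ℂ) ^ 2 * (‖t‖ : ℂ) ^ 2 / ((Real.pi / l ^ 2 : ℝ) : ℂ) =
      ((-(Real.pi * l ^ 2 * t ^ 2) : ℝ) : ℂ) := by
    rw [Real.norm_eq_abs, ← Complex.ofReal_pow |t|, sq_abs]
    push_cast
    field_simp
  rw [e2, e3, e4, ← Complex.ofReal_exp, ← Complex.ofReal_mul, Complex.ofReal_re]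

variable {t : ℝ} {m : E2 → E3}

/-- The energy of the vertical part as a superposition of Gaussian interaction energies. -/
theorem strayEnergy_vertical_gauss (ht : 0 < t) (hm : MemLp m 2 volume) :
    strayEnergy (verticalPart (filmField t m)) = 1 / (2 * Real.pi) * ∫ l in Ioi (0 : ℝ),
      planarGauss (fun x => m x 2) l * (2 * (1 - Real.exp (-(Real.pi * l ^ 2 * t ^ 2)))) := by
  have hpi := Real.pi_pos
  rw [strayEnergy_vertical t hm]
  have hm2 := MemLp.apply_euclidean hm 2
  let w : E2 → ℝ := fun ξ => ‖realFourier (fun x => m x 2) ξ‖ ^ 2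
  -- This is 4π²k²|ŝ(k)|². It is not integrable over ℝ, hence the superposition lemma asks for
  -- integrability only after multiplication by a Gaussian.
  let v : ℝ → ℝ := fun k => 2 - 2 * Real.cos (2 * Real.pi * t * k)
  have hw : Measurable w := (measurable_l2Fourier _).norm.pow_const 2
  have hwi : Integrable w := (memLp_realFourier _).integrable_norm_pow (by simp)
  have hgi : ∀ l : ℝ, 0 < l → Integrable fun k : ℝ => Real.exp (-(Real.pi / l ^ 2 * ‖k‖ ^ 2)) :=
    fun l hl => integrable_exp_neg_mul_norm_sq (by positivity)
  have hci : ∀ l : ℝ, 0 < l → Integrable fun k : ℝ =>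
      Real.cos (2 * Real.pi * t * k) * Real.exp (-(Real.pi / l ^ 2 * ‖k‖ ^ 2)) := fun l hl =>
    (hgi l hl).bdd_mul (c := 1) (Continuous.aestronglyMeasurable (by fun_prop))
      (Eventually.of_forall fun k => Real.abs_cos_le_one _)
  have e : ∀ l : ℝ, (fun k : ℝ => v k * Real.exp (-(Real.pi / l ^ 2 * ‖k‖ ^ 2))) = fun k =>
      2 * Real.exp (-(Real.pi / l ^ 2 * ‖k‖ ^ 2)) -
      2 * (Real.cos (2 * Real.pi * t * k) * Real.exp (-(Real.pi / l ^ 2 * ‖k‖ ^ 2))) := by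
    intro l; ext k; simp only [v]; ring
  have h := integral_gaussian_superposition (w := w) (v := v) hw (by fun_prop)
    (fun ξ => by positivity) (fun k => by
      have := Real.cos_le_one (2 * Real.pi * t * k)
      simp only [v]; linarith)
    (fun l hl => integrable_mul_gaussian hwi (by positivity))
    (fun l hl => by
      rw [e]
      exact ((hgi l hl).const_mul 2).sub ((hci l hl).const_mul 2))
  have h1 : ∀ p : E2 × ℝ, ‖𝓕 (slab t) p.2‖ ^ 2 *
      (p.2 ^ 2 * ‖realFourier (fun x => m x 2) p.1‖ ^ 2) / (‖p.1‖ ^ 2 + p.2 ^ 2) =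
      w p.1 * v p.2 / (4 * Real.pi ^ 2 * (‖p.1‖ ^ 2 + p.2 ^ 2)) := by
    intro p
    simp only [w, v, ← sq_mul_norm_fourier_slab ht]
    rw [show ‖realFourier (fun x => m x 2) p.1‖ ^ 2 * (4 * Real.pi ^ 2 * p.2 ^ 2 *
      ‖𝓕 (slab t) p.2‖ ^ 2) = (4 * Real.pi ^ 2) * (‖𝓕 (slab t) p.2‖ ^ 2 *
      (p.2 ^ 2 * ‖realFourier (fun x => m x 2) p.1‖ ^ 2)) by ring,
      mul_div_mul_left _ _ (by positivity)]
  simp only [h1]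
  rw [h]
  congr 1
  apply setIntegral_congr_fun measurableSet_Ioi
  intro l hl
  have hl0 : 0 < l := hl
  -- The case of zero shift is the plain Gaussian integral.
  have h0 := integral_cos_mul_gaussian 0 hl0
  simp only [mul_zero, zero_mul, Real.cos_zero, one_mul, ne_eq, OfNat.ofNat_ne_zero,
    not_false_eq_true, zero_pow, neg_zero, Real.exp_zero, mul_one] at h0
  simp only [e]
  rw [← planarGauss_eq hm2 hl0, integral_sub ((hgi l hl0).const_mul 2) ((hci l hl0).const_mul 2),
    integral_const_mul, integral_const_mul, integral_cos_mul_gaussian t hl0, h0]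
  congr 1
  field_simp

/-- The Gaussian self-interaction of the interval `[0, t]`. -/
noncomputable def slabGauss (t l : ℝ) : ℝ :=
  ∫ p : ℝ × ℝ, Real.exp (-(Real.pi * l ^ 2 * ‖p.1 - p.2‖ ^ 2)) *
    ((Icc 0 t).indicator 1 p.1 * (Icc 0 t).indicator 1 p.2)

theorem memLp_indicator_Icc (t : ℝ) : MemLp ((Icc 0 t).indicator (1 : ℝ → ℝ)) 2 volume :=
  memLp_indicator_const 2 measurableSet_Icc 1 (Or.inr (by simp))

theorem slabGauss_eq (t : ℝ) {l : ℝ} (hl : 0 < l) :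
    slabGauss t l = l⁻¹ * ∫ k, ‖𝓕 (slab t) k‖ ^ 2 * Real.exp (-(Real.pi / l ^ 2 * ‖k‖ ^ 2)) := by
  have h := gaussian_energy (memLp_indicator_Icc t) hl
  have e : (fun x => (((Icc 0 t).indicator (1 : ℝ → ℝ) x : ℝ) : ℂ)) = slab t := by
    ext x
    unfold slab
    by_cases hx : x ∈ Icc 0 t
    · simp only [indicator_of_mem hx]; simp
    · simp only [indicator_of_notMem hx]; simp
  rw [e] at h
  have h2 : ∫ k, ‖𝓕 (slab t) k‖ ^ 2 * Real.exp (-(Real.pi / l ^ 2 * ‖k‖ ^ 2)) =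
      ∫ k, ‖l2Fourier (slab t) k‖ ^ 2 * Real.exp (-(Real.pi / l ^ 2 * ‖k‖ ^ 2)) := by
    apply integral_congr_ae
    filter_upwards [l2Fourier_ae_eq_fourier (memLp_slab t) (integrable_slab t)] with k hk
    rw [hk]
  rw [h2, h, slabGauss]
  simp only [Module.finrank_self, pow_one]
  rw [inv_mul_cancel_left₀ hl.ne']

/-- The constant is |2πi|², left out of `planarSymbol`. -/
theorem realFourier_planarDiv {D : E2 → ℝ} (hm : MemLp m 2 volume) (hD : IsPlanarDiv m D) :
    ∀ᵐ ξ : E2, ‖realFourier D ξ‖ ^ 2 = 4 * Real.pi ^ 2 * ‖planarSymbol m ξ‖ ^ 2 := by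
  have h := realFourier_weakDiv (n := 2) (u := fun i x => m x (Fin.castSucc i)) (ρ := D)
    (fun i => MemLp.apply_euclidean hm _) hD.1 (fun φ hφ => by
      rw [← hD.2 φ hφ]
      simp [Fin.sum_univ_two])
  filter_upwards [h] with ξ hξ
  rw [hξ, norm_mul, mul_pow]
  simp [Fin.sum_univ_two, planarSymbol, mul_pow]
  norm_num

/-- The energy of the in-plane part as a superposition of Gaussian interaction energies. -/
theorem strayEnergy_inPlane_gauss (t : ℝ) {D : E2 → ℝ} (hm : MemLp m 2 volume)
    (hD : IsPlanarDiv m D) :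
    strayEnergy (inPlanePart (filmField t m)) = 1 / (2 * Real.pi) * ∫ l in Ioi (0 : ℝ),
      planarGauss D l * slabGauss t l := by
  have hpi := Real.pi_pos
  rw [strayEnergy_inPlane t hm]
  let w : E2 → ℝ := fun ξ => ‖realFourier D ξ‖ ^ 2
  let v : ℝ → ℝ := fun k => ‖𝓕 (slab t) k‖ ^ 2
  have hw : Measurable w := (measurable_l2Fourier _).norm.pow_const 2
  have hwi : Integrable w := (memLp_realFourier _).integrable_norm_pow (by simp)
  have hvi : Integrable v := (memLp_fourier_slab t).integrable_norm_pow (by simp)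
  have hv : Measurable v := (continuous_fourier_slab t).measurable.norm.pow_const 2
  have h := integral_gaussian_superposition (w := w) (v := v) hw hv
    (fun ξ => by positivity) (fun k => by positivity)
    (fun l hl => integrable_mul_gaussian hwi (by positivity))
    (fun l hl => integrable_mul_gaussian hvi (by positivity))
  have h1 : ∀ᵐ p : E2 × ℝ, ‖𝓕 (slab t) p.2‖ ^ 2 *
      ‖planarSymbol m p.1‖ ^ 2 / (‖p.1‖ ^ 2 + p.2 ^ 2) =
      w p.1 * v p.2 / (4 * Real.pi ^ 2 * (‖p.1‖ ^ 2 + p.2 ^ 2)) := by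
    have h0 := (Measure.quasiMeasurePreserving_fst (ν := (volume : Measure ℝ))).ae
      (realFourier_planarDiv hm hD)
    filter_upwards [h0] with p hp
    simp only [w, v, hp]
    rw [mul_assoc, mul_div_mul_left _ _ (by positivity), mul_comm]
  rw [integral_congr_ae h1, h]
  congr 1
  apply setIntegral_congr_fun measurableSet_Ioi
  intro l hl
  have hl0 : 0 < l := hl
  simp only [w, v]
  rw [← planarGauss_eq hD.1 hl0, ← slabGauss_eq t hl0]

end EnergyFormulas

end ThinFilm

namespace ThinFilm

/-! ### Integration over the Gaussian width: kernels in real space. -/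

section RealSpace

theorem integral_Ioi_gaussian {a : ℝ} (ha : 0 < a) :
    ∫ l in Ioi (0 : ℝ), Real.exp (-(Real.pi * l ^ 2 * a)) = 1 / (2 * √a) := by
  have hpi := Real.pi_pos
  have h := integral_gaussian_Ioi (Real.pi * a)
  rw [show Real.pi / (Real.pi * a) = a⁻¹ by field_simp, Real.sqrt_inv] at h
  simp only [show ∀ l : ℝ, -(Real.pi * a) * l ^ 2 = -(Real.pi * l ^ 2 * a) from
    fun l => by ring] at h
  rw [h]
  have : 0 < √a := Real.sqrt_pos.2 ha
  field_simp

theorem integrableOn_Ioi_gaussian {a : ℝ} (ha : 0 < a) :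
    IntegrableOn (fun l : ℝ => Real.exp (-(Real.pi * l ^ 2 * a))) (Ioi 0) := by
  have hpi := Real.pi_pos
  have h := integrable_exp_neg_mul_sq (b := Real.pi * a) (by positivity)
  refine (h.congr ?_).integrableOn
  filter_upwards with l
  congr 1
  ring

/-! ### Interchange of integrals, and quadratic forms with convolution kernels. -/

section Fubini

variable {V : Type*} [NormedAddCommGroup V] [InnerProductSpace ℝ V] [FiniteDimensional ℝ V]
  [MeasurableSpace V] [BorelSpace V]

/-- Fubini, in a form that serves the plane and the line. The weight η is 1 or the convergence
factor exp(-ε|z|²), and K is the Gaussian superposition with density g. -/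
theorem integral_gaussian_mul_swap {u η K : V → ℝ} {g : ℝ → ℝ}
    (hu : AEStronglyMeasurable u volume) (hη : Measurable η)
    (hg : Measurable g) (hg0 : ∀ l, 0 < l → 0 ≤ g l)
    (hK : ∀ᵐ p : V × V,
      IntegrableOn (fun l => Real.exp (-(Real.pi * l ^ 2 * ‖p.1 - p.2‖ ^ 2)) * g l) (Ioi 0) ∧
      ∫ l in Ioi (0 : ℝ), Real.exp (-(Real.pi * l ^ 2 * ‖p.1 - p.2‖ ^ 2)) * g l = K (p.1 - p.2))
    (hint : Integrable fun p : V × V => η (p.1 - p.2) * K (p.1 - p.2) * (u p.1 * u p.2)) :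
    ∫ l in Ioi (0 : ℝ), (∫ p : V × V, η (p.1 - p.2) *
        Real.exp (-(Real.pi * l ^ 2 * ‖p.1 - p.2‖ ^ 2)) * (u p.1 * u p.2)) * g l =
      ∫ p : V × V, η (p.1 - p.2) * K (p.1 - p.2) * (u p.1 * u p.2) := by
  let F : V × V → ℝ → ℝ := fun p l => (η (p.1 - p.2) * (u p.1 * u p.2)) *
    (Real.exp (-(Real.pi * l ^ 2 * ‖p.1 - p.2‖ ^ 2)) * g l)
  have huu : AEStronglyMeasurable (fun p : V × V => u p.1 * u p.2) volume :=
    hu.comp_fst.mul hu.comp_snd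
  have hF : AEStronglyMeasurable (Function.uncurry F)
      ((volume : Measure (V × V)).prod (volume.restrict (Ioi (0 : ℝ)))) := by
    refine AEStronglyMeasurable.mul ?_ ?_
    · exact ((hη.comp (measurable_fst.sub measurable_snd)).aestronglyMeasurable.mul huu).comp_fst
    · exact Measurable.aestronglyMeasurable (by fun_prop)
  have hFi : Integrable (Function.uncurry F)
      ((volume : Measure (V × V)).prod (volume.restrict (Ioi (0 : ℝ)))) := by
    rw [integrable_prod_iff hF]
    constructor
    · filter_upwards [hK] with p hp
      exact Integrable.const_mul hp.1 (η (p.1 - p.2) * (u p.1 * u p.2))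
    · refine hint.norm.congr ?_
      filter_upwards [hK] with p hp
      have e : ∀ l ∈ Ioi (0 : ℝ), ‖Function.uncurry F (p, l)‖ = ‖η (p.1 - p.2) * (u p.1 * u p.2)‖ *
          (Real.exp (-(Real.pi * l ^ 2 * ‖p.1 - p.2‖ ^ 2)) * g l) := by
        intro l hl
        simp only [Function.uncurry, F]
        rw [norm_mul, Real.norm_of_nonneg (mul_nonneg (Real.exp_nonneg _) (hg0 l hl))]
      -- K inherits nonnegativity from g, so integrating the absolute value over l reproduces the
      -- absolute value of the final integrand.
      have hK0 : 0 ≤ K (p.1 - p.2) := by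
        rw [← hp.2]
        exact setIntegral_nonneg measurableSet_Ioi fun l hl =>
          mul_nonneg (Real.exp_nonneg _) (hg0 l hl)
      rw [setIntegral_congr_fun measurableSet_Ioi e, integral_const_mul, hp.2, norm_mul, norm_mul,
        norm_mul (η (p.1 - p.2)), Real.norm_of_nonneg hK0]
      ring
  have h := integral_integral_swap hFi
  have e1 : ∫ p, ∫ l in Ioi (0 : ℝ), F p l =
      ∫ p : V × V, η (p.1 - p.2) * K (p.1 - p.2) * (u p.1 * u p.2) := by
    apply integral_congr_ae
    filter_upwards [hK] with p hp
    simp only [F]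
    rw [integral_const_mul, hp.2]
    ring
  rw [← e1, h]
  congr 1 with l
  rw [← integral_mul_const]
  congr 1 with p
  simp only [F]
  ring

theorem ae_fst_ne_snd [Nontrivial V] : ∀ᵐ p : V × V, p.1 - p.2 ≠ 0 := by
  have h : ∀ᵐ z : V, z ≠ 0 := by simp [ae_iff]
  exact (quasiMeasurePreserving_sub_of_right_invariant (volume : Measure V) volume).ae h

theorem integral_conv_fst {K v : V → ℝ} :
    ∫ x, ∫ y, K (x - y) * v x = (∫ z, K z) * ∫ x : V, v x := by
  simp only [integral_mul_const, integral_sub_left_eq_self K volume]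
  rw [integral_const_mul]

theorem integral_conv_snd {K v : V → ℝ} (hK : Integrable K) (hv : Integrable v) :
    ∫ p : V × V, K (p.1 - p.2) * v p.2 = (∫ z, K z) * ∫ x : V, v x := by
  have h2 := hv.convolution_integrand (ContinuousLinearMap.mul ℝ ℝ) hK
  have h3 : Integrable (fun p : V × V => K (p.1 - p.2) * v p.2) (volume.prod volume) :=
    h2.congr (Eventually.of_forall fun p => mul_comm _ _)
  rw [Measure.volume_eq_prod, integral_prod_symm _ h3]
  simp only [integral_mul_const, integral_sub_right_eq_self K]
  rw [integral_const_mul]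

theorem integrable_conv_snd {K v : V → ℝ} (hK : Integrable K) (hv : Integrable v) :
    Integrable fun p : V × V => K (p.1 - p.2) * v p.2 :=
  (hv.convolution_integrand (ContinuousLinearMap.mul ℝ ℝ) hK).congr
    (Eventually.of_forall fun _ => mul_comm _ _)

theorem integrable_conv_fst {K v : V → ℝ} (hK : Integrable K) (hv : Integrable v) :
    Integrable fun p : V × V => K (p.1 - p.2) * v p.1 := by
  refine (integrable_conv_snd hK.comp_neg hv).swap.congr (Eventually.of_forall fun _ => ?_)
  simp

theorem integral_conv_fst' {K v : V → ℝ} (hK : Integrable K) (hv : Integrable v) :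
    ∫ p : V × V, K (p.1 - p.2) * v p.1 = (∫ z, K z) * ∫ x : V, v x := by
  rw [Measure.volume_eq_prod, integral_prod _ (integrable_conv_fst hK hv), integral_conv_fst]

/-- Expansion of the quadratic form `∬ K(x - x') |f(x) - f(x')|²`. -/
theorem integral_conv_sub_sq {K f : V → ℝ} (hK : Integrable K) (hf : MemLp f 2 volume) :
    Integrable (fun p : V × V => K (p.1 - p.2) * (f p.1 - f p.2) ^ 2) ∧
    ∫ p : V × V, K (p.1 - p.2) * (f p.1 - f p.2) ^ 2 = 2 * ((∫ z, K z) * ∫ x, f x ^ 2) -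
      2 * ∫ p : V × V, K (p.1 - p.2) * (f p.1 * f p.2) := by
  have h1 := integrable_conv_fst hK hf.integrable_sq
  have h2 := integrable_conv_snd hK hf.integrable_sq
  have h3 := (integrable_conv_mul hK hf hf).const_mul 2
  have e : (fun p : V × V => K (p.1 - p.2) * (f p.1 - f p.2) ^ 2) = fun p =>
      (K (p.1 - p.2) * f p.1 ^ 2 + K (p.1 - p.2) * f p.2 ^ 2) -
      2 * (K (p.1 - p.2) * (f p.1 * f p.2)) := by
    ext p; ring
  rw [e]
  refine ⟨(h1.add h2).sub h3, ?_⟩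
  have e1 := integral_sub (h1.add h2) h3
  simp only [Pi.add_apply] at e1
  rw [e1, integral_add h1 h2, integral_const_mul,
    integral_conv_fst' (v := fun x => f x ^ 2) hK hf.integrable_sq,
    integral_conv_snd (v := fun x => f x ^ 2) hK hf.integrable_sq]
  ring

end Fubini

/-! ### The vertical part: the kernel of two parallel plates. -/

section Vertical

/-- The interaction kernel `1/|z| - 1/√(|z|² + t²)` of two parallel charged planes. -/
noncomputable def platesKernel (t r : ℝ) : ℝ := 1 / r - 1 / √(r ^ 2 + t ^ 2)

/-- A primitive of y ↦ y · `platesKernel t y`, the radial density of the kernel in planar polar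
coordinates. -/
theorem hasDerivAt_sub_sqrt {t : ℝ} (ht : 0 < t) (y : ℝ) :
    HasDerivAt (fun y => y - √(y ^ 2 + t ^ 2)) (1 - y / √(y ^ 2 + t ^ 2)) y := by
  have hp : y ^ 2 + t ^ 2 ≠ 0 := by positivity
  have h := ((hasDerivAt_pow 2 y).add_const (t ^ 2)).sqrt hp
  refine ((hasDerivAt_id y).sub h).congr_deriv ?_
  have : √(y ^ 2 + t ^ 2) ≠ 0 := by positivity
  field_simp
  norm_num
  ring

theorem tendsto_sub_sqrt (t : ℝ) :
    Tendsto (fun y : ℝ => y - √(y ^ 2 + t ^ 2)) atTop (𝓝 0) := by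
  have h1 : Tendsto (fun y : ℝ => -(t ^ 2) / (y + √(y ^ 2 + t ^ 2))) atTop (𝓝 0) := by
    refine Tendsto.const_div_atTop ?_ _
    exact tendsto_atTop_mono (fun y => le_add_of_nonneg_right (Real.sqrt_nonneg _)) tendsto_id
  refine h1.congr' ?_
  filter_upwards [eventually_gt_atTop 0] with y hy
  have hs : √(y ^ 2 + t ^ 2) ^ 2 = y ^ 2 + t ^ 2 := Real.sq_sqrt (by positivity)
  have : 0 < y + √(y ^ 2 + t ^ 2) := by positivity
  rw [div_eq_iff this.ne']
  linear_combination hs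

theorem div_sqrt_le_one {t : ℝ} (y : ℝ) : y / √(y ^ 2 + t ^ 2) ≤ 1 := by
  refine div_le_one_of_le₀ ?_ (Real.sqrt_nonneg _)
  exact Real.le_sqrt_of_sq_le (by nlinarith)

theorem mul_platesKernel {t y : ℝ} (hy : 0 < y) :
    y * platesKernel t y = 1 - y / √(y ^ 2 + t ^ 2) := by
  unfold platesKernel
  field_simp

/-- The primitive is -t at 0 and tends to 0 at infinity. Since its derivative is nonnegative,
convergence gives integrability. -/
theorem integral_mul_platesKernel {t : ℝ} (ht : 0 < t) :
    IntegrableOn (fun y => y * platesKernel t y) (Ioi 0) ∧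
      ∫ y in Ioi (0 : ℝ), y * platesKernel t y = t := by
  have hd : ∀ y ∈ Ici (0 : ℝ), HasDerivAt (fun y => y - √(y ^ 2 + t ^ 2))
      (1 - y / √(y ^ 2 + t ^ 2)) y := fun y _ => hasDerivAt_sub_sqrt ht y
  have hi := integrableOn_Ioi_deriv_of_nonneg' hd
    (fun y _ => sub_nonneg.2 (div_sqrt_le_one y)) (tendsto_sub_sqrt t)
  have e : EqOn (fun y => y * platesKernel t y) (fun y => 1 - y / √(y ^ 2 + t ^ 2)) (Ioi 0) :=
    fun y hy => mul_platesKernel hy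
  refine ⟨hi.congr_fun e.symm measurableSet_Ioi, ?_⟩
  rw [setIntegral_congr_fun measurableSet_Ioi e,
    integral_Ioi_of_hasDerivAt_of_tendsto' hd hi (tendsto_sub_sqrt t)]
  simp [Real.sqrt_sq ht.le]

theorem integrable_platesKernel {t : ℝ} (ht : 0 < t) :
    Integrable fun z : E2 => platesKernel t ‖z‖ := by
  rw [integrable_fun_norm_addHaar volume (f := platesKernel t)]
  simpa using (integral_mul_platesKernel ht).1

theorem integral_platesKernel {t : ℝ} (ht : 0 < t) :
    ∫ z : E2, platesKernel t ‖z‖ = 2 * Real.pi * t := by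
  rw [integral_fun_norm_addHaar volume (platesKernel t)]
  have h : ∫ y in Ioi (0 : ℝ), y ^ (Module.finrank ℝ E2 - 1) • platesKernel t y = t := by
    simpa using (integral_mul_platesKernel ht).2
  rw [h, measureReal_def, EuclideanSpace.volume_ball_fin_two]
  simp [Real.pi_pos.le]
  ring

/-- Gaussians in r and t multiply to one in √(r² + t²), and each Gaussian integrates over l to a
Coulomb term 1/(2√a). -/
theorem integral_gaussian_plates {t r : ℝ} (ht : 0 < t) (hr : 0 < r) :
    IntegrableOn (fun l => Real.exp (-(Real.pi * l ^ 2 * r ^ 2)) *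
      (2 * (1 - Real.exp (-(Real.pi * l ^ 2 * t ^ 2))))) (Ioi 0) ∧
    ∫ l in Ioi (0 : ℝ), Real.exp (-(Real.pi * l ^ 2 * r ^ 2)) *
      (2 * (1 - Real.exp (-(Real.pi * l ^ 2 * t ^ 2)))) = platesKernel t r := by
  have h1 := (integrableOn_Ioi_gaussian (a := r ^ 2) (by positivity)).const_mul 2
  have h2 := (integrableOn_Ioi_gaussian (a := r ^ 2 + t ^ 2) (by positivity)).const_mul 2
  have e : (fun l => Real.exp (-(Real.pi * l ^ 2 * r ^ 2)) *
      (2 * (1 - Real.exp (-(Real.pi * l ^ 2 * t ^ 2))))) = fun l =>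
      2 * Real.exp (-(Real.pi * l ^ 2 * r ^ 2)) -
      2 * Real.exp (-(Real.pi * l ^ 2 * (r ^ 2 + t ^ 2))) := by
    ext l
    rw [mul_add, neg_add, Real.exp_add]
    ring
  rw [e]
  refine ⟨h1.sub h2, ?_⟩
  rw [integral_sub h1 h2, integral_const_mul, integral_const_mul,
    integral_Ioi_gaussian (by positivity), integral_Ioi_gaussian (by positivity),
    Real.sqrt_sq hr.le, platesKernel]
  have : √(r ^ 2 + t ^ 2) ≠ 0 := by positivity
  field_simp

variable {t : ℝ} {m : E2 → E3}

theorem strayEnergy_vertical_plates (ht : 0 < t) (hm : MemLp m 2 volume) :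
    strayEnergy (verticalPart (filmField t m)) = 1 / (2 * Real.pi) *
      ∫ p : E2 × E2, platesKernel t ‖p.1 - p.2‖ * (m p.1 2 * m p.2 2) := by
  have hpi := Real.pi_pos
  have hm2 := MemLp.apply_euclidean hm 2
  rw [strayEnergy_vertical_gauss ht hm]
  congr 1
  have h := integral_gaussian_mul_swap (u := fun x => m x 2) (η := fun _ : E2 => 1)
    (K := fun z => platesKernel t ‖z‖)
    (g := fun l => 2 * (1 - Real.exp (-(Real.pi * l ^ 2 * t ^ 2))))
    hm2.1 measurable_const (by fun_prop)
    (fun l _ => by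
      have : Real.exp (-(Real.pi * l ^ 2 * t ^ 2)) ≤ 1 := by
        rw [Real.exp_le_one_iff, neg_nonpos]; positivity
      linarith)
    (by
      filter_upwards [ae_fst_ne_snd (V := E2)] with p hp
      exact integral_gaussian_plates ht (norm_pos_iff.2 hp))
    (by
      simp only [one_mul]
      exact integrable_conv_mul (integrable_platesKernel ht) hm2 hm2)
  simp only [one_mul] at h
  exact h

/-- The algebraic identity Γ(r/t)/r³ = (2/t²)(1/r - 1/√(r² + t²)); on the diagonal both sides
vanish. -/
theorem verticalIntegrand_eq (ht : 0 < t) (f : E2 → ℝ) (p : E2 × E2) :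
    verticalIntegrand t f p =
      2 / t ^ 2 * (platesKernel t ‖p.1 - p.2‖ * (f p.1 - f p.2) ^ 2) := by
  unfold verticalIntegrand
  rcases eq_or_ne p.1 p.2 with h | h
  · simp [h]
  have hr : 0 < ‖p.1 - p.2‖ := norm_pos_iff.2 (sub_ne_zero.2 h)
  set r := ‖p.1 - p.2‖
  have h1 : √(1 + (r / t) ^ 2) = √(r ^ 2 + t ^ 2) / t := by
    rw [eq_div_iff ht.ne', ← Real.sqrt_sq ht.le, ← Real.sqrt_mul (by positivity),
      Real.sqrt_sq ht.le]
    congr 1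
    field_simp
    ring
  have : 0 < √(r ^ 2 + t ^ 2) := by positivity
  rw [Gam, h1, platesKernel]
  field_simp

/-- Expanding the square replaces ∬ K f f' by (∫ K) ∫ f² - ½ ∬ K (f - f')², and ∫ K = 2πt supplies
the local term. -/
theorem strayEnergy_vertical_formula (ht : 0 < t) (hm : MemLp m 2 volume) :
    Integrable (verticalIntegrand t fun x => m x 2) ∧
    strayEnergy (verticalPart (filmField t m)) = t * (∫ x, m x 2 ^ 2) -
      t ^ 2 / (8 * Real.pi) * ∫ p, verticalIntegrand t (fun x => m x 2) p := by
  have hpi := Real.pi_pos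
  obtain ⟨h1, h2⟩ := integral_conv_sub_sq (integrable_platesKernel ht) (MemLp.apply_euclidean hm 2)
  constructor
  · exact (h1.const_mul (2 / t ^ 2)).congr
      (Eventually.of_forall fun p => (verticalIntegrand_eq ht (fun x => m x 2) p).symm)
  · simp only [verticalIntegrand_eq ht]
    rw [integral_const_mul, h2, integral_platesKernel ht, strayEnergy_vertical_plates ht hm]
    field_simp
    ring

end Vertical

end RealSpace

end ThinFilm

namespace ThinFilm

/-! ### The profile functions Γ and Θ. -/

section Profiles

/-- With x = α/√(1 + α²) one has α²(1 - x²) = x², hence Γ = 2x²/(1 + x). Both monotonicity and the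
limit are visible in x, which increases from 0 to 1. -/
theorem Gam_eq {α : ℝ} (hα : 0 ≤ α) :
    Gam α = 2 * (α / √(1 + α ^ 2)) ^ 2 / (1 + α / √(1 + α ^ 2)) := by
  have hs : 0 < √(1 + α ^ 2) := by positivity
  have h2 : √(1 + α ^ 2) ^ 2 = 1 + α ^ 2 := Real.sq_sqrt (by positivity)
  unfold Gam
  set s := √(1 + α ^ 2)
  have h3 : 0 < s + α := by positivity
  have e : 1 - α / s = 1 / (s * (s + α)) := by
    field_simp
    linear_combination h2
  rw [e]
  field_simp

theorem strictMono_div_sqrt {a b : ℝ} (ha : 0 ≤ a) (hab : a < b) :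
    a / √(1 + a ^ 2) < b / √(1 + b ^ 2) := by
  have hb : 0 ≤ b := ha.trans hab.le
  rw [div_lt_div_iff₀ (by positivity) (by positivity)]
  refine lt_of_pow_lt_pow_left₀ 2 (by positivity) ?_
  rw [mul_pow, mul_pow, Real.sq_sqrt (by positivity), Real.sq_sqrt (by positivity)]
  nlinarith

theorem strictMonoOn_Gam : StrictMonoOn Gam (Ici 0) := by
  intro a ha b hb hab
  rw [Gam_eq ha, Gam_eq hb]
  have h := strictMono_div_sqrt ha hab
  have h0 : 0 ≤ a / √(1 + a ^ 2) := div_nonneg ha (Real.sqrt_nonneg _)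
  set x := a / √(1 + a ^ 2)
  set y := b / √(1 + b ^ 2)
  rw [div_lt_div_iff₀ (by linarith) (by linarith)]
  have h1 : x ^ 2 < y ^ 2 := pow_lt_pow_left₀ h h0 two_ne_zero
  have h2 : x * y * x ≤ x * y * y := mul_le_mul_of_nonneg_left h.le (by nlinarith)
  nlinarith

theorem tendsto_div_sqrt : Tendsto (fun α : ℝ => α / √(1 + α ^ 2)) atTop (𝓝 1) := by
  have h : Tendsto (fun α : ℝ => 1 - α / √(1 + α ^ 2)) atTop (𝓝 0) := by
    refine tendsto_of_tendsto_of_tendsto_of_le_of_le' tendsto_const_nhds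
      tendsto_inv_atTop_zero ?_ ?_
    · filter_upwards with α
      rw [sub_nonneg]
      refine div_le_one_of_le₀ (Real.le_sqrt_of_sq_le (by linarith)) (Real.sqrt_nonneg _)
    · filter_upwards [eventually_gt_atTop 0] with α hα
      have hs : 1 ≤ √(1 + α ^ 2) := Real.one_le_sqrt.2 (by nlinarith)
      have h2 : √(1 + α ^ 2) ^ 2 = 1 + α ^ 2 := Real.sq_sqrt (by positivity)
      set s := √(1 + α ^ 2)
      have e : 1 - α / s = 1 / (s * (s + α)) := by
        have : 0 < s + α := by positivity
        field_simp
        linear_combination h2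
      rw [e, ← one_div]
      refine one_div_le_one_div_of_le hα ?_
      nlinarith
  simpa using h.const_sub 1

theorem tendsto_Gam : Tendsto Gam atTop (𝓝 1) := by
  have h := ((tendsto_div_sqrt.pow 2).const_mul 2).div (tendsto_div_sqrt.const_add 1)
    (by norm_num)
  norm_num at h
  refine h.congr' ?_
  filter_upwards [eventually_ge_atTop 0] with α hα
  exact (Gam_eq hα).symm

/-- Writing arsinh(1/α) through logarithms isolates the singular term α log α, whose continuity at 0
is known. -/
theorem Thet_eq {α : ℝ} (hα : 0 ≤ α) : Thet α =
    2 * (α * Real.log (1 + √(1 + α ^ 2)) - α * Real.log α + α ^ 2 - α * √(1 + α ^ 2)) := by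
  rcases hα.eq_or_lt with rfl | h
  · simp [Thet]
  have e : Real.arsinh (1 / α) = Real.log (1 + √(1 + α ^ 2)) - Real.log α := by
    rw [← Real.log_div (by positivity) h.ne', Real.arsinh]
    congr 1
    have : √(1 + (1 / α) ^ 2) = √(1 + α ^ 2) / α := by
      rw [eq_div_iff h.ne', ← Real.sqrt_sq h.le, ← Real.sqrt_mul (by positivity), Real.sqrt_sq h.le]
      congr 1
      field_simp
      ring
    rw [this, add_div]
  rw [Thet, e]
  ring

theorem continuousOn_Thet : ContinuousOn Thet (Ici 0) := by
  have h : Continuous fun α : ℝ => 2 * (α * Real.log (1 + √(1 + α ^ 2)) - α * Real.log α + α ^ 2 -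
      α * √(1 + α ^ 2)) := by
    have h1 : Continuous fun α : ℝ => Real.log (1 + √(1 + α ^ 2)) :=
      Continuous.log (by fun_prop) fun α => by positivity
    have h2 := Real.continuous_mul_log
    fun_prop
  exact h.continuousOn.congr fun α hα => Thet_eq hα

theorem sinh_lt_mul_cosh {z : ℝ} (hz : 0 < z) : Real.sinh z < z * Real.cosh z := by
  have hmono : StrictMonoOn (fun z : ℝ => z * Real.cosh z - Real.sinh z) (Ici 0) := by
    apply strictMonoOn_of_deriv_pos (convex_Ici 0)
    · exact Continuous.continuousOn (by fun_prop)
    · intro x hx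
      rw [interior_Ici] at hx
      have h : HasDerivAt (fun z : ℝ => z * Real.cosh z - Real.sinh z) (x * Real.sinh x) x := by
        refine (((hasDerivAt_id x).mul (Real.hasDerivAt_cosh x)).sub
          (Real.hasDerivAt_sinh x)).congr_deriv ?_
        simp
      rw [h.deriv]
      exact mul_pos hx (Real.sinh_pos_iff.2 hx)
  have := hmono self_mem_Ici hz.le hz
  simp at this
  exact this

/-- With β = sinh y and the half-angle formulas this becomes tanh(y/2) < y/2. For β = 1/α it is the
positivity of Θ'(α). -/
theorem lt_arsinh {β : ℝ} (hβ : 0 < β) : 2 * (√(1 + β ^ 2) - 1) < β * Real.arsinh β := by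
  set y := Real.arsinh β with hy
  have hy0 : 0 < y := Real.arsinh_pos_iff.2 hβ
  have h1 : β = Real.sinh y := (Real.sinh_arsinh β).symm
  have h2 : √(1 + β ^ 2) = Real.cosh y := by rw [hy, Real.cosh_arsinh]
  rw [h2, h1]
  have e1 : Real.sinh y = 2 * Real.sinh (y / 2) * Real.cosh (y / 2) := by
    rw [← Real.sinh_two_mul]; congr 1; ring
  have e2 : Real.cosh y = 1 + 2 * Real.sinh (y / 2) ^ 2 := by
    have := Real.cosh_two_mul (y / 2)
    rw [show 2 * (y / 2) = y by ring, Real.cosh_sq] at this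
    linarith
  have h3 := sinh_lt_mul_cosh (half_pos hy0)
  have h4 : 0 < Real.sinh (y / 2) := Real.sinh_pos_iff.2 (half_pos hy0)
  have h5 := mul_lt_mul_of_pos_left h3 h4
  rw [e1, e2]
  nlinarith

theorem hasDerivAt_Thet {α : ℝ} (hα : 0 < α) :
    HasDerivAt Thet (2 * (Real.arsinh (1 / α) + 2 * α - 2 * √(1 + α ^ 2))) α := by
  have hp : 1 + α ^ 2 ≠ 0 := by positivity
  have h1 : HasDerivAt (fun α : ℝ => √(1 + α ^ 2)) (α / √(1 + α ^ 2)) α := by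
    refine (((hasDerivAt_pow 2 α).const_add 1).sqrt hp).congr_deriv ?_
    field_simp
    norm_num
  have h2 : HasDerivAt (fun α : ℝ => Real.arsinh (1 / α)) (-1 / (α * √(1 + α ^ 2))) α := by
    have h3 := ((hasDerivAt_inv hα.ne').arsinh)
    simp only [one_div]
    refine h3.congr_deriv ?_
    have : √(1 + (α⁻¹) ^ 2) = √(1 + α ^ 2) / α := by
      rw [eq_div_iff hα.ne', ← Real.sqrt_sq hα.le, ← Real.sqrt_mul (by positivity),
        Real.sqrt_sq hα.le]
      congr 1
      field_simp
      ring
    rw [this]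
    simp only [smul_eq_mul]
    field_simp
  have h := ((((hasDerivAt_id α).mul h2).add (hasDerivAt_pow 2 α)).sub
    ((hasDerivAt_id α).mul h1)).const_mul 2
  refine HasDerivAt.congr_deriv (f := Thet) h ?_
  have hs : √(1 + α ^ 2) ^ 2 = 1 + α ^ 2 := Real.sq_sqrt (by positivity)
  have hs0 : √(1 + α ^ 2) ≠ 0 := by positivity
  simp only [id]
  set s := √(1 + α ^ 2)
  field_simp
  norm_num
  linear_combination hs

theorem strictMonoOn_Thet : StrictMonoOn Thet (Ici 0) := by
  apply strictMonoOn_of_deriv_pos (convex_Ici 0) continuousOn_Thet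
  intro α hα
  rw [interior_Ici] at hα
  have hα0 : 0 < α := hα
  rw [(hasDerivAt_Thet hα0).deriv]
  have h := lt_arsinh (β := 1 / α) (by positivity)
  have : √(1 + (1 / α) ^ 2) = √(1 + α ^ 2) / α := by
    rw [eq_div_iff hα0.ne', ← Real.sqrt_sq hα0.le, ← Real.sqrt_mul (by positivity),
      Real.sqrt_sq hα0.le]
    congr 1
    field_simp
    ring
  rw [this] at h
  have h' := mul_lt_mul_of_pos_left h hα0
  have e1 : α * (2 * (√(1 + α ^ 2) / α - 1)) = 2 * √(1 + α ^ 2) - 2 * α := by field_simp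
  have e2 : α * (1 / α * Real.arsinh (1 / α)) = Real.arsinh (1 / α) := by field_simp
  rw [e1, e2] at h'
  linarith

theorem Thet_zero : Thet 0 = 0 := by simp [Thet]

theorem Gam_zero : Gam 0 = 0 := by simp [Gam]

theorem tendsto_Thet_zero : Tendsto Thet (𝓝[>] 0) (𝓝 0) := by
  have h := continuousOn_Thet 0 self_mem_Ici
  rw [ContinuousWithinAt, Thet_zero] at h
  exact h.mono_left (nhdsWithin_mono _ Ioi_subset_Ici_self)

theorem tendsto_Thet : Tendsto Thet atTop (𝓝 1) := by
  have h1 : Tendsto (fun α : ℝ => α * Real.arsinh (1 / α)) atTop (𝓝 1) := by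
    -- α arsinh(1/α) is a difference quotient of arsinh at 0, where the derivative is 1.
    have h := (Real.hasDerivAt_arsinh 0).tendsto_slope_zero
    have hc : Tendsto (fun α : ℝ => α⁻¹) atTop (𝓝[≠] 0) := by
      refine tendsto_nhdsWithin_iff.2 ⟨tendsto_inv_atTop_zero, ?_⟩
      filter_upwards [eventually_ne_atTop 0] with α hα using inv_ne_zero hα
    have := h.comp hc
    simp at this
    refine this.congr fun α => ?_
    simp
  -- The remaining difference α² - α√(1 + α²), rewritten so that its limit -1/2 can be read off.
  have h2 : Tendsto (fun α : ℝ => -((α / √(1 + α ^ 2)) / (1 + α / √(1 + α ^ 2)))) atTop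
      (𝓝 (-(1 / (1 + 1)))) :=
    (tendsto_div_sqrt.div (tendsto_div_sqrt.const_add 1) (by norm_num)).neg
  have h := (h1.add h2).const_mul 2
  norm_num at h
  refine h.congr' ?_
  filter_upwards [eventually_gt_atTop 0] with α hα
  have hs0 : 0 < √(1 + α ^ 2) := by positivity
  have hs : √(1 + α ^ 2) ^ 2 = 1 + α ^ 2 := Real.sq_sqrt (by positivity)
  unfold Thet
  rw [one_div]
  set s := √(1 + α ^ 2)
  have e : α / s / (1 + α / s) = α * s - α ^ 2 := by
    have : 0 < s + α := by positivity
    field_simp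
    linear_combination -hs
  rw [e]
  ring

theorem Thet_nonneg {α : ℝ} (hα : 0 ≤ α) : 0 ≤ Thet α := by
  rw [← Thet_zero]
  exact strictMonoOn_Thet.monotoneOn self_mem_Ici hα hα

theorem Thet_le_one {α : ℝ} (hα : 0 ≤ α) : Thet α ≤ 1 := by
  refine ge_of_tendsto tendsto_Thet ?_
  filter_upwards [eventually_ge_atTop α] with β hβ
  exact strictMonoOn_Thet.monotoneOn hα (hα.trans hβ) hβ

theorem measurable_Thet : Measurable Thet := by
  unfold Thet
  have := Real.continuous_arsinh.measurable
  fun_prop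

end Profiles

end ThinFilm

namespace ThinFilm

/-! ### The self-interaction of the interval [0,t] and the origin of Θ. -/

section SlabInteraction

theorem sqrt_one_add_div_sq {r : ℝ} (hr : 0 < r) (s : ℝ) :
    √(1 + (s / r) ^ 2) = √(r ^ 2 + s ^ 2) / r := by
  rw [eq_div_iff hr.ne', ← Real.sqrt_sq hr.le, ← Real.sqrt_mul (by positivity), Real.sqrt_sq hr.le]
  congr 1
  field_simp

theorem hasDerivAt_arsinh_div {r : ℝ} (hr : 0 < r) (s : ℝ) :
    HasDerivAt (fun s => Real.arsinh (s / r)) (1 / √(r ^ 2 + s ^ 2)) s := by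
  refine (((hasDerivAt_id s).div_const r).arsinh).congr_deriv ?_
  simp only [id, sqrt_one_add_div_sq hr, smul_eq_mul]
  field_simp

/-- Together with `hasDerivAt_arsinh_div` this gives a second primitive of 1/√(r² + s²), which is
what the double integral over [0,t]² requires. -/
theorem hasDerivAt_mul_arsinh_sub {r : ℝ} (hr : 0 < r) (s : ℝ) :
    HasDerivAt (fun s => s * Real.arsinh (s / r) - √(r ^ 2 + s ^ 2)) (Real.arsinh (s / r)) s := by
  have hp : r ^ 2 + s ^ 2 ≠ 0 := by positivity
  have h1 := ((hasDerivAt_pow 2 s).const_add (r ^ 2)).sqrt hp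
  refine (((hasDerivAt_id s).mul (hasDerivAt_arsinh_div hr s)).sub h1).congr_deriv ?_
  simp only [id]
  field_simp
  norm_num
  ring

theorem integral_slab_kernel {t r : ℝ} (hr : 0 < r) (x : ℝ) :
    ∫ y in (0 : ℝ)..t, 1 / (2 * √(r ^ 2 + (x - y) ^ 2)) =
      (Real.arsinh (x / r) - Real.arsinh ((x - t) / r)) / 2 := by
  have hd : ∀ y ∈ uIcc 0 t, HasDerivAt (fun y => -(Real.arsinh ((x - y) / r) / 2))
      (1 / (2 * √(r ^ 2 + (x - y) ^ 2))) y := by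
    intro y _
    have h := (((hasDerivAt_arsinh_div hr (x - y)).comp y
      ((hasDerivAt_id y).const_sub x)).div_const 2).neg
    refine HasDerivAt.congr_deriv h ?_
    field_simp
  have hc : Continuous fun y : ℝ => 1 / (2 * √(r ^ 2 + (x - y) ^ 2)) :=
    continuous_const.div (by fun_prop) fun y => by positivity
  rw [intervalIntegral.integral_eq_sub_of_hasDerivAt hd (hc.intervalIntegrable _ _)]
  simp
  ring

theorem integral_slab_kernel' {t r : ℝ} (hr : 0 < r) :
    ∫ x in (0 : ℝ)..t, (Real.arsinh (x / r) - Real.arsinh ((x - t) / r)) / 2 =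
      t * Real.arsinh (t / r) + r - √(r ^ 2 + t ^ 2) := by
  have hd : ∀ x ∈ uIcc 0 t, HasDerivAt (fun x => ((x * Real.arsinh (x / r) - √(r ^ 2 + x ^ 2)) -
      ((x - t) * Real.arsinh ((x - t) / r) - √(r ^ 2 + (x - t) ^ 2))) / 2)
      ((Real.arsinh (x / r) - Real.arsinh ((x - t) / r)) / 2) x := by
    intro x _
    have h := ((hasDerivAt_mul_arsinh_sub hr x).sub ((hasDerivAt_mul_arsinh_sub hr (x - t)).comp x
      ((hasDerivAt_id x).sub_const t))).div_const 2
    refine HasDerivAt.congr_deriv h ?_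
    simp
  have hc : Continuous fun x : ℝ => (Real.arsinh (x / r) - Real.arsinh ((x - t) / r)) / 2 := by
    have := Real.continuous_arsinh
    fun_prop
  rw [intervalIntegral.integral_eq_sub_of_hasDerivAt hd (hc.intervalIntegrable _ _)]
  simp only [sub_self, zero_div, Real.arsinh_zero, mul_zero, zero_sub, neg_div,
    Real.arsinh_neg, neg_sq]
  rw [show (0 : ℝ) ^ 2 = 0 by norm_num, add_zero, Real.sqrt_sq hr.le]
  ring

theorem Thet_div {t r : ℝ} (ht : 0 < t) (hr : 0 < r) :
    t * Real.arsinh (t / r) + r - √(r ^ 2 + t ^ 2) = t ^ 2 / 2 * (Thet (r / t) / r) := by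
  rw [Thet, sqrt_one_add_div_sq ht, one_div_div, add_comm (t ^ 2)]
  field_simp

theorem slab_indicator_nonneg (t x : ℝ) : 0 ≤ (Icc 0 t).indicator (1 : ℝ → ℝ) x :=
  indicator_nonneg (fun _ _ => zero_le_one) x

theorem integrable_slab_indicator (t : ℝ) : Integrable ((Icc 0 t).indicator (1 : ℝ → ℝ)) :=
  (integrable_indicator_iff measurableSet_Icc).2
    (continuous_const (y := (1 : ℝ))).integrableOn_Icc

theorem integral_slab_indicator {t : ℝ} (ht : 0 < t) (f : ℝ → ℝ) :
    ∫ x, f x * (Icc 0 t).indicator (1 : ℝ → ℝ) x = ∫ x in (0 : ℝ)..t, f x := by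
  rw [intervalIntegral.integral_of_le ht.le, ← integral_Icc_eq_integral_Ioc,
    ← integral_indicator measurableSet_Icc]
  congr 1 with x
  by_cases hx : x ∈ Icc 0 t
  · simp [indicator_of_mem hx]
  · simp [indicator_of_notMem hx]

theorem integrable_slab_indicator_prod (t : ℝ) : Integrable fun p : ℝ × ℝ =>
    (Icc 0 t).indicator (1 : ℝ → ℝ) p.1 * (Icc 0 t).indicator (1 : ℝ → ℝ) p.2 :=
  (integrable_slab_indicator t).mul_prod (integrable_slab_indicator t)

theorem integrable_slab_kernel (t : ℝ) {r : ℝ} (hr : 0 < r) : Integrable fun p : ℝ × ℝ =>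
    1 / (2 * √(r ^ 2 + ‖p.1 - p.2‖ ^ 2)) *
      ((Icc 0 t).indicator (1 : ℝ → ℝ) p.1 * (Icc 0 t).indicator (1 : ℝ → ℝ) p.2) := by
  have hc : Continuous fun p : ℝ × ℝ => 1 / (2 * √(r ^ 2 + ‖p.1 - p.2‖ ^ 2)) :=
    continuous_const.div (by fun_prop) fun y => by positivity
  refine (integrable_slab_indicator_prod t).bdd_mul (c := 1 / (2 * r)) hc.aestronglyMeasurable
    (Eventually.of_forall fun p => ?_)
  rw [Real.norm_of_nonneg (by positivity)]
  refine one_div_le_one_div_of_le (by positivity) ?_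
  have : r ≤ √(r ^ 2 + ‖p.1 - p.2‖ ^ 2) :=
    Real.le_sqrt_of_sq_le (by nlinarith [sq_nonneg ‖p.1 - p.2‖])
  linarith

theorem integral_slab_kernel_prod {t r : ℝ} (ht : 0 < t) (hr : 0 < r) :
    ∫ p : ℝ × ℝ, 1 / (2 * √(r ^ 2 + ‖p.1 - p.2‖ ^ 2)) *
      ((Icc 0 t).indicator (1 : ℝ → ℝ) p.1 * (Icc 0 t).indicator (1 : ℝ → ℝ) p.2) =
      t ^ 2 / 2 * (Thet (r / t) / r) := by
  rw [Measure.volume_eq_prod, integral_prod _ (integrable_slab_kernel t hr)]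
  have e : ∀ x : ℝ, ∫ y : ℝ, 1 / (2 * √(r ^ 2 + ‖x - y‖ ^ 2)) *
      ((Icc 0 t).indicator (1 : ℝ → ℝ) x * (Icc 0 t).indicator (1 : ℝ → ℝ) y) =
      (Real.arsinh (x / r) - Real.arsinh ((x - t) / r)) / 2 *
        (Icc 0 t).indicator (1 : ℝ → ℝ) x := by
    intro x
    rw [← integral_slab_kernel hr, ← integral_slab_indicator ht, ← integral_mul_const]
    congr 1 with y
    rw [Real.norm_eq_abs, sq_abs]
    ring
  simp only [e]
  rw [integral_slab_indicator ht, integral_slab_kernel' hr, Thet_div ht hr]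

theorem measurable_slabGauss (t : ℝ) : Measurable (slabGauss t) := by
  refine (StronglyMeasurable.integral_prod_right (f := fun (l : ℝ) (p : ℝ × ℝ) =>
    Real.exp (-(Real.pi * l ^ 2 * ‖p.1 - p.2‖ ^ 2)) *
    ((Icc 0 t).indicator 1 p.1 * (Icc 0 t).indicator 1 p.2)) ?_).measurable
  have : Measurable ((Icc 0 t).indicator (1 : ℝ → ℝ)) := measurable_one.indicator measurableSet_Icc
  exact Measurable.stronglyMeasurable (by unfold Function.uncurry; fun_prop)

theorem slabGauss_nonneg (t l : ℝ) : 0 ≤ slabGauss t l :=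
  integral_nonneg fun _ => mul_nonneg (Real.exp_nonneg _)
    (mul_nonneg (slab_indicator_nonneg _ _) (slab_indicator_nonneg _ _))

theorem slabGauss_le {t : ℝ} (ht : 0 < t) (l : ℝ) : slabGauss t l ≤ t ^ 2 := by
  have h : ∫ p : ℝ × ℝ, (Icc 0 t).indicator (1 : ℝ → ℝ) p.1 * (Icc 0 t).indicator (1 : ℝ → ℝ) p.2 =
      t ^ 2 := by
    have h1 : ∫ x, (Icc 0 t).indicator (1 : ℝ → ℝ) x = t := by
      have := integral_slab_indicator ht fun _ => 1
      simpa using this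
    rw [Measure.volume_eq_prod, integral_prod_mul, h1, sq]
  rw [← h]
  refine integral_mono_of_nonneg (Eventually.of_forall fun _ => ?_)
    (integrable_slab_indicator_prod t) (Eventually.of_forall fun p => ?_)
  · exact mul_nonneg (Real.exp_nonneg _)
      (mul_nonneg (slab_indicator_nonneg _ _) (slab_indicator_nonneg _ _))
  · refine mul_le_of_le_one_left
      (mul_nonneg (slab_indicator_nonneg _ _) (slab_indicator_nonneg _ _)) ?_
    rw [Real.exp_le_one_iff, neg_nonpos]
    have := Real.pi_pos
    positivity

/-- `integral_gaussian_mul_swap` on the line, with the planar Gaussian exp(-πl²r²) as density in l: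
the inner integral becomes 1/(2√(r² + s²)), leaving the double integral over the slab. -/
theorem integral_gaussian_slab {t r : ℝ} (ht : 0 < t) (hr : 0 < r) :
    IntegrableOn (fun l => Real.exp (-(Real.pi * l ^ 2 * r ^ 2)) * slabGauss t l) (Ioi 0) ∧
    ∫ l in Ioi (0 : ℝ), Real.exp (-(Real.pi * l ^ 2 * r ^ 2)) * slabGauss t l =
      t ^ 2 / 2 * (Thet (r / t) / r) := by
  have hpi := Real.pi_pos
  constructor
  · refine (integrableOn_Ioi_gaussian (a := r ^ 2) (by positivity)).mul_bdd (c := t ^ 2)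
      (measurable_slabGauss t).aestronglyMeasurable (Eventually.of_forall fun l => ?_)
    rw [Real.norm_of_nonneg (slabGauss_nonneg t l)]
    exact slabGauss_le ht l
  · have h := integral_gaussian_mul_swap (u := (Icc 0 t).indicator (1 : ℝ → ℝ))
      (η := fun _ : ℝ => 1) (K := fun s => 1 / (2 * √(r ^ 2 + ‖s‖ ^ 2)))
      (g := fun l => Real.exp (-(Real.pi * l ^ 2 * r ^ 2)))
      (integrable_slab_indicator t).1 measurable_const (by fun_prop)
      (fun l _ => Real.exp_nonneg _)
      (by
        filter_upwards with p
        have e : ∀ l : ℝ, Real.exp (-(Real.pi * l ^ 2 * ‖p.1 - p.2‖ ^ 2)) *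
            Real.exp (-(Real.pi * l ^ 2 * r ^ 2)) =
            Real.exp (-(Real.pi * l ^ 2 * (r ^ 2 + ‖p.1 - p.2‖ ^ 2))) := by
          intro l
          rw [← Real.exp_add]
          congr 1
          ring
        simp only [e]
        exact ⟨integrableOn_Ioi_gaussian (by positivity), integral_Ioi_gaussian (by positivity)⟩)
      (by simpa only [one_mul] using integrable_slab_kernel t hr)
    simp only [one_mul] at h
    rw [integral_slab_kernel_prod ht hr] at h
    rw [← h]
    congr 1 with l
    rw [mul_comm, slabGauss]

end SlabInteraction

end ThinFilm

namespace ThinFilm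

/-! ### The in-plane part: regularisation and its removal. -/

section InPlane

variable {t : ℝ} {m : E2 → E3} {D : E2 → ℝ}

theorem integrable_exp_div_norm {ε : ℝ} (hε : 0 < ε) :
    Integrable fun z : E2 => Real.exp (-(ε * ‖z‖ ^ 2)) / ‖z‖ := by
  rw [integrable_fun_norm_addHaar volume (f := fun y => Real.exp (-(ε * y ^ 2)) / y)]
  have h := (integrable_exp_neg_mul_norm_sq (V := ℝ) hε).integrableOn (s := Ioi 0)
  refine h.congr_fun (fun y hy => ?_) measurableSet_Ioi
  have : 0 < y := hy
  simp only [finrank_euclideanSpace, Fintype.card_fin, Nat.add_one_sub_one, pow_one, smul_eq_mul,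
    Real.norm_eq_abs, sq_abs]
  field_simp

theorem Thet_norm_div_nonneg (ht : 0 < t) (z : E2) : 0 ≤ Thet (‖z‖ / t) / ‖z‖ :=
  div_nonneg (Thet_nonneg (by positivity)) (norm_nonneg _)

theorem Thet_norm_div_le (ht : 0 < t) (z : E2) : Thet (‖z‖ / t) / ‖z‖ ≤ 1 / ‖z‖ :=
  div_le_div_of_nonneg_right (Thet_le_one (by positivity)) (norm_nonneg _)

theorem measurable_Thet_norm_div (t : ℝ) : Measurable fun z : E2 => Thet (‖z‖ / t) / ‖z‖ := by
  have := measurable_Thet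
  fun_prop

theorem integrable_exp_mul_Thet (ht : 0 < t) {ε : ℝ} (hε : 0 < ε) :
    Integrable fun z : E2 => Real.exp (-(ε * ‖z‖ ^ 2)) * (Thet (‖z‖ / t) / ‖z‖) := by
  refine (integrable_exp_div_norm hε).mono' ?_ (Eventually.of_forall fun z => ?_)
  · have := measurable_Thet_norm_div t
    exact Measurable.aestronglyMeasurable (by fun_prop)
  · rw [Real.norm_of_nonneg (mul_nonneg (Real.exp_nonneg _) (Thet_norm_div_nonneg ht z)),
      div_eq_mul_one_div (Real.exp _)]
    exact mul_le_mul_of_nonneg_left (Thet_norm_div_le ht z) (Real.exp_nonneg _)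

theorem inPlaneIntegrand_eq (t : ℝ) (D : E2 → ℝ) (p : E2 × E2) : inPlaneIntegrand t D p =
    Thet (‖p.1 - p.2‖ / t) / ‖p.1 - p.2‖ * (D p.1 * D p.2) := by
  rw [inPlaneIntegrand]
  ring

/-- The regularised double integral converges absolutely. -/
theorem integrable_regularised (ht : 0 < t) (hD : MemLp D 2 volume) {ε : ℝ} (hε : 0 < ε) :
    Integrable (fun p : E2 × E2 => Real.exp (-(ε * ‖p.1 - p.2‖ ^ 2)) * inPlaneIntegrand t D p) := by
  refine (integrable_conv_mul (integrable_exp_mul_Thet ht hε) hD hD).congr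
    (Eventually.of_forall fun p => ?_)
  simp only [inPlaneIntegrand_eq]
  ring

/-- The kernel is at most 1/|z|. Its singular part is an integrable kernel and is handled by D ∈ L²;
the rest is bounded and is handled by D ∈ L¹. -/
theorem integrable_inPlaneIntegrand (ht : 0 < t) (hD : MemLp D 2 volume) (hD1 : Integrable D) :
    Integrable (inPlaneIntegrand t D) := by
  have h1 := (integrable_conv_mul (integrable_exp_div_norm one_pos) hD hD).norm.const_mul
    (Real.exp 1)
  have h2 := (hD1.mul_prod hD1).norm
  refine (h1.add h2).mono' ?_ (Eventually.of_forall fun p => ?_)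
  · have hm := (measurable_Thet_norm_div t).comp
      (measurable_fst.sub measurable_snd : Measurable fun p : E2 × E2 => p.1 - p.2)
    refine (hm.aestronglyMeasurable.mul (hD.1.comp_fst.mul hD.1.comp_snd)).congr
      (Eventually.of_forall fun p => ?_)
    exact (inPlaneIntegrand_eq t D p).symm
  · rw [inPlaneIntegrand_eq, norm_mul]
    simp only [Pi.add_apply]
    rw [norm_mul _ (D p.1 * D p.2), Real.norm_of_nonneg (Thet_norm_div_nonneg ht _), ← mul_assoc]
    set z := p.1 - p.2
    -- The factor e makes e · exp(-|z|²) ≥ 1 on the unit ball; outside it 1/|z| ≤ 1.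
    have hb : Thet (‖z‖ / t) / ‖z‖ ≤ Real.exp 1 * ‖Real.exp (-(1 * ‖z‖ ^ 2)) / ‖z‖‖ + 1 := by
      refine (Thet_norm_div_le ht z).trans ?_
      rw [Real.norm_of_nonneg (by positivity), ← mul_div_assoc, ← Real.exp_add]
      rcases le_total ‖z‖ 1 with h | h
      · have : 1 ≤ Real.exp (1 + -(1 * ‖z‖ ^ 2)) :=
          Real.one_le_exp (by nlinarith [norm_nonneg z])
        have := div_le_div_of_nonneg_right this (norm_nonneg z)
        linarith
      · have h3 : 1 / ‖z‖ ≤ 1 := by rw [div_le_one (by linarith)]; exact h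
        have : 0 ≤ Real.exp (1 + -(1 * ‖z‖ ^ 2)) / ‖z‖ := by positivity
        linarith
    have := mul_le_mul_of_nonneg_right hb (norm_nonneg (D p.1 * D p.2))
    linarith

/-- The convergence factor only shifts l² by ε/π, so regularised energies remain Gaussian
interaction energies. -/
theorem exp_mul_gaussian {ε : ℝ} (hε : 0 ≤ ε) (l r : ℝ) :
    Real.exp (-(ε * r ^ 2)) * Real.exp (-(Real.pi * l ^ 2 * r ^ 2)) =
      Real.exp (-(Real.pi * √(l ^ 2 + ε / Real.pi) ^ 2 * r ^ 2)) := by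
  have hpi := Real.pi_pos
  rw [Real.sq_sqrt (by positivity), ← Real.exp_add]
  congr 1
  field_simp
  ring

/-- The regularised double integral as a superposition of Gaussian interaction energies. -/
theorem integral_regularised (ht : 0 < t) (hD : MemLp D 2 volume) {ε : ℝ} (hε : 0 < ε) :
    t ^ 2 / (4 * Real.pi) *
      ∫ p : E2 × E2, Real.exp (-(ε * ‖p.1 - p.2‖ ^ 2)) * inPlaneIntegrand t D p =
    1 / (2 * Real.pi) * ∫ l in Ioi (0 : ℝ),
      planarGauss D √(l ^ 2 + ε / Real.pi) * slabGauss t l := by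
  have hpi := Real.pi_pos
  have h := integral_gaussian_mul_swap (u := D) (η := fun z : E2 => Real.exp (-(ε * ‖z‖ ^ 2)))
    (K := fun z => t ^ 2 / 2 * (Thet (‖z‖ / t) / ‖z‖)) (g := slabGauss t)
    hD.1 (by fun_prop) (measurable_slabGauss t) (fun l _ => slabGauss_nonneg t l)
    (by
      filter_upwards [ae_fst_ne_snd (V := E2)] with p hp
      exact integral_gaussian_slab ht (norm_pos_iff.2 hp))
    (by
      refine ((integrable_regularised ht hD hε).const_mul (t ^ 2 / 2)).congr
        (Eventually.of_forall fun p => ?_)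
      simp only [inPlaneIntegrand_eq]
      ring)
  simp only [exp_mul_gaussian hε.le] at h
  have e : ∀ p : E2 × E2, Real.exp (-(ε * ‖p.1 - p.2‖ ^ 2)) *
      (t ^ 2 / 2 * (Thet (‖p.1 - p.2‖ / t) / ‖p.1 - p.2‖)) * (D p.1 * D p.2) =
      t ^ 2 / 2 * (Real.exp (-(ε * ‖p.1 - p.2‖ ^ 2)) * inPlaneIntegrand t D p) := by
    intro p
    rw [inPlaneIntegrand_eq]
    ring
  simp only [e] at h
  rw [integral_const_mul] at h
  unfold planarGauss
  rw [h]
  field_simp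
  ring

theorem planarGauss_nonneg (hD : MemLp D 2 volume) {l : ℝ} (hl : 0 < l) : 0 ≤ planarGauss D l := by
  rw [planarGauss_eq hD hl]
  exact mul_nonneg (by positivity) (integral_nonneg fun ξ => by positivity)

theorem mul_exp_neg_le_one (x : ℝ) : x * Real.exp (-x) ≤ 1 := by
  rw [Real.exp_neg, ← div_eq_mul_inv, div_le_one (Real.exp_pos x)]
  linarith [Real.add_one_le_exp x]

/-- The Gaussian interaction energy of a planar divergence is bounded and has quadratic decay. -/
theorem exists_planarGauss_le (hm : MemLp m 2 volume) (hD : IsPlanarDiv m D) :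
    ∃ C, 0 ≤ C ∧ ∀ l : ℝ, 0 < l → planarGauss D l ≤ C / (1 + l ^ 2) := by
  have hpi := Real.pi_pos
  let w : E2 → ℝ := fun ξ =>
    ‖realFourier (fun x => m x 0) ξ‖ ^ 2 + ‖realFourier (fun x => m x 1) ξ‖ ^ 2
  have hw : Integrable w := ((memLp_realFourier fun x => m x 0).integrable_norm_pow (by simp)).add
    ((memLp_realFourier fun x => m x 1).integrable_norm_pow (by simp))
  have hDi : Integrable fun ξ => ‖realFourier D ξ‖ ^ 2 :=
    (memLp_realFourier D).integrable_norm_pow (by simp)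
  have hw0 : 0 ≤ ∫ ξ, w ξ := integral_nonneg fun ξ => by positivity
  have hD0 : 0 ≤ ∫ ξ, ‖realFourier D ξ‖ ^ 2 := integral_nonneg fun ξ => by positivity
  refine ⟨4 * Real.pi * (∫ ξ, w ξ) + ∫ ξ, ‖realFourier D ξ‖ ^ 2, by positivity, fun l hl => ?_⟩
  -- Here |D̂|² ≤ 4π²|ξ|² w is used: with x = π|ξ|²/l², the factor |ξ|²/l² is absorbed by x exp(-x)
  -- ≤ 1. This controls small l.
  have h1 : planarGauss D l ≤ 4 * Real.pi * ∫ ξ, w ξ := by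
    rw [planarGauss_eq hD.1 hl, ← integral_const_mul, ← integral_const_mul]
    refine integral_mono_ae ((integrable_mul_gaussian hDi (by positivity)).const_mul _)
      (hw.const_mul _) ?_
    filter_upwards [realFourier_planarDiv hm hD] with ξ hξ
    simp only [hξ]
    have h2 := norm_planarSymbol_sq_le m ξ
    have h3 := mul_exp_neg_le_one (Real.pi / l ^ 2 * ‖ξ‖ ^ 2)
    have hwξ : 0 ≤ w ξ := by positivity
    calc (l ^ 2)⁻¹ * (4 * Real.pi ^ 2 * ‖planarSymbol m ξ‖ ^ 2 *
          Real.exp (-(Real.pi / l ^ 2 * ‖ξ‖ ^ 2)))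
        ≤ (l ^ 2)⁻¹ * (4 * Real.pi ^ 2 * (‖ξ‖ ^ 2 * w ξ) *
          Real.exp (-(Real.pi / l ^ 2 * ‖ξ‖ ^ 2))) := by gcongr
      _ = 4 * Real.pi * w ξ * (Real.pi / l ^ 2 * ‖ξ‖ ^ 2 *
          Real.exp (-(Real.pi / l ^ 2 * ‖ξ‖ ^ 2))) := by field_simp
      _ ≤ 4 * Real.pi * w ξ := mul_le_of_le_one_right (by positivity) h3
  -- Decay for large l uses only that D is square integrable.
  have h2 : l ^ 2 * planarGauss D l ≤ ∫ ξ, ‖realFourier D ξ‖ ^ 2 := by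
    rw [planarGauss_eq hD.1 hl, mul_inv_cancel_left₀ (by positivity)]
    refine integral_mono (integrable_mul_gaussian hDi (by positivity)) hDi fun ξ => ?_
    refine mul_le_of_le_one_right (by positivity) ?_
    rw [Real.exp_le_one_iff, neg_nonpos]
    positivity
  rw [le_div_iff₀ (by positivity)]
  linarith

theorem tendsto_planarGauss (hD : MemLp D 2 volume) {l : ℝ} (hl : 0 < l) :
    Tendsto (fun ε : ℝ => planarGauss D √(l ^ 2 + ε / Real.pi)) (𝓝[>] 0)
      (𝓝 (planarGauss D l)) := by
  have hpi := Real.pi_pos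
  have hint := integrable_conv_mul (integrable_exp_neg_mul_norm_sq (V := E2)
    (c := Real.pi * l ^ 2) (by positivity)) hD hD
  unfold planarGauss
  apply tendsto_integral_filter_of_dominated_convergence (fun p : E2 × E2 =>
    ‖Real.exp (-(Real.pi * l ^ 2 * ‖p.1 - p.2‖ ^ 2)) * (D p.1 * D p.2)‖)
  · filter_upwards with ε
    exact (Continuous.aestronglyMeasurable (by fun_prop)).mul (hD.1.comp_fst.mul hD.1.comp_snd)
  · filter_upwards [self_mem_nhdsWithin] with ε hε
    filter_upwards with p
    have hε0 : 0 < ε := hε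
    rw [← exp_mul_gaussian hε0.le l ‖p.1 - p.2‖, mul_assoc, norm_mul]
    refine mul_le_of_le_one_left (norm_nonneg _) ?_
    rw [Real.norm_eq_abs, Real.abs_exp, Real.exp_le_one_iff, neg_nonpos]
    positivity
  · exact hint.norm
  · filter_upwards with p
    refine Tendsto.mono_left ?_ nhdsWithin_le_nhds
    have hc : Continuous fun ε : ℝ => Real.exp (-(Real.pi * √(l ^ 2 + ε / Real.pi) ^ 2 *
      ‖p.1 - p.2‖ ^ 2)) * (D p.1 * D p.2) := by fun_prop
    have := hc.tendsto 0
    simpa [Real.sqrt_sq hl.le] using this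

/-- Removal of the Gaussian convergence factor. -/
theorem tendsto_regularised (ht : 0 < t) (hm : MemLp m 2 volume) (hD : IsPlanarDiv m D) :
    Tendsto (fun ε : ℝ => t ^ 2 / (4 * Real.pi) *
      ∫ p : E2 × E2, Real.exp (-(ε * ‖p.1 - p.2‖ ^ 2)) * inPlaneIntegrand t D p) (𝓝[>] 0)
      (𝓝 (strayEnergy (inPlanePart (filmField t m)))) := by
  have hpi := Real.pi_pos
  rw [strayEnergy_inPlane_gauss t hm hD]
  have h : Tendsto (fun ε : ℝ => 1 / (2 * Real.pi) * ∫ l in Ioi (0 : ℝ),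
      planarGauss D √(l ^ 2 + ε / Real.pi) * slabGauss t l) (𝓝[>] 0)
      (𝓝 (1 / (2 * Real.pi) * ∫ l in Ioi (0 : ℝ), planarGauss D l * slabGauss t l)) := by
    apply Tendsto.const_mul
    obtain ⟨C, hC0, hC⟩ := exists_planarGauss_le hm hD
    -- The shift l² + ε/π only enlarges the denominator, so the bound is uniform in ε; t² bounds the
    -- slab factor.
    apply tendsto_integral_filter_of_dominated_convergence (fun l : ℝ => C * (1 + l ^ 2)⁻¹ * t ^ 2)
    · filter_upwards with ε
      have h1 : AEStronglyMeasurable (fun q : ℝ × E2 × E2 =>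
          Real.exp (-(Real.pi * √(q.1 ^ 2 + ε / Real.pi) ^ 2 * ‖q.2.1 - q.2.2‖ ^ 2)) *
            (D q.2.1 * D q.2.2)) ((volume.restrict (Ioi 0)).prod volume) :=
        (Continuous.aestronglyMeasurable (by fun_prop)).mul
          (hD.1.1.comp_fst.mul hD.1.1.comp_snd).comp_snd
      exact h1.integral_prod_right'.mul (measurable_slabGauss t).aestronglyMeasurable
    · filter_upwards [self_mem_nhdsWithin] with ε hε
      have hε0 : 0 < ε := hε
      filter_upwards [ae_restrict_mem measurableSet_Ioi] with l hl
      have hl0 : 0 < l := hl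
      have hpos : 0 < √(l ^ 2 + ε / Real.pi) := by positivity
      rw [norm_mul, Real.norm_of_nonneg (planarGauss_nonneg hD.1 hpos),
        Real.norm_of_nonneg (slabGauss_nonneg t l)]
      refine mul_le_mul ((hC _ hpos).trans ?_) (slabGauss_le ht l) (slabGauss_nonneg t l)
        (by positivity)
      rw [← div_eq_mul_inv, Real.sq_sqrt (by positivity)]
      refine div_le_div_of_nonneg_left hC0 (by positivity) ?_
      have : 0 < ε / Real.pi := by positivity
      linarith
    · exact ((integrable_inv_one_add_sq.const_mul C).mul_const _).integrableOn
    · filter_upwards [ae_restrict_mem measurableSet_Ioi] with l hl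
      exact (tendsto_planarGauss hD.1 hl).mul_const _
  refine h.congr' ?_
  filter_upwards [self_mem_nhdsWithin] with ε hε
  exact (integral_regularised ht hD.1 hε).symm

/-- Under absolute convergence the regularised integrals also tend to the plain one, so uniqueness
of limits identifies it with the energy. -/
theorem strayEnergy_inPlane_formula (ht : 0 < t) (hm : MemLp m 2 volume) (hD : IsPlanarDiv m D)
    (hi : Integrable (inPlaneIntegrand t D)) :
    strayEnergy (inPlanePart (filmField t m)) =
      t ^ 2 / (4 * Real.pi) * ∫ p, inPlaneIntegrand t D p := by
  refine tendsto_nhds_unique (tendsto_regularised ht hm hD) (Tendsto.const_mul _ ?_)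
  apply tendsto_integral_filter_of_dominated_convergence (fun p => ‖inPlaneIntegrand t D p‖)
  · filter_upwards with ε
    exact (Continuous.aestronglyMeasurable (by fun_prop)).mul hi.1
  · filter_upwards [self_mem_nhdsWithin] with ε hε
    filter_upwards with p
    rw [norm_mul]
    refine mul_le_of_le_one_left (norm_nonneg _) ?_
    rw [Real.norm_eq_abs, Real.abs_exp, Real.exp_le_one_iff, neg_nonpos]
    have : 0 < ε := hε
    positivity
  · exact hi.norm
  · filter_upwards with p
    refine Tendsto.mono_left ?_ nhdsWithin_le_nhds
    have hc : Continuous fun ε : ℝ =>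
        Real.exp (-(ε * ‖p.1 - p.2‖ ^ 2)) * inPlaneIntegrand t D p := by
      fun_prop
    have := hc.tendsto 0
    simpa using this

end InPlane

end ThinFilm

namespace ThinFilm

/-! ### The thickness average. -/

section Average

/-- Weighted fibre integrals of square integrable functions are square integrable. -/
theorem memLp_integral_smul {X Y F : Type*} [MeasurableSpace X] [MeasurableSpace Y]
    {μ : Measure X} {ν : Measure Y} [SFinite μ] [SFinite ν] [NormedAddCommGroup F]
    [NormedSpace ℝ F] {w : Y → ℝ} (hw : MemLp w 2 ν) {u : X × Y → F}
    (hu : MemLp u 2 (μ.prod ν)) : MemLp (fun x => ∫ y, w y • u (x, y) ∂ν) 2 μ := by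
  refine ⟨AEStronglyMeasurable.integral_prod_right' (f := fun p : X × Y => w p.2 • u p)
    (hw.1.comp_snd.smul hu.1), ?_⟩
  have hfin : ∫⁻ p, ‖u p‖ₑ ^ 2 ∂(μ.prod ν) < ⊤ := by
    have h := hu.2
    rw [eLpNorm_two_eq] at h
    exact (ENNReal.rpow_lt_top_iff_of_pos (by norm_num)).1 h
  rw [eLpNorm_two_eq]
  refine ENNReal.rpow_lt_top_of_nonneg (by norm_num) (ne_of_lt ?_)
  calc ∫⁻ x, ‖∫ y, w y • u (x, y) ∂ν‖ₑ ^ 2 ∂μ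
      ≤ ∫⁻ x, eLpNorm w 2 ν ^ 2 * ∫⁻ y, ‖u (x, y)‖ₑ ^ 2 ∂ν ∂μ := by
        refine lintegral_mono_ae ?_
        filter_upwards [hu.1.prodMk_left] with x hx
        have h1 : ‖∫ y, w y • u (x, y) ∂ν‖ₑ ≤ eLpNorm w 2 ν * eLpNorm (fun y => u (x, y)) 2 ν := by
          refine (enorm_integral_le_lintegral_enorm _).trans ?_
          rw [← eLpNorm_one_eq_lintegral_enorm]
          exact eLpNorm_smul_le_mul_eLpNorm hx hw.1
        refine (pow_le_pow_left' h1 2).trans_eq ?_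
        rw [mul_pow, eLpNorm_two_eq fun y => u (x, y), ← ENNReal.rpow_natCast _ 2,
          ← ENNReal.rpow_natCast _ 2, ← ENNReal.rpow_mul]
        simp
    _ = eLpNorm w 2 ν ^ 2 * ∫⁻ p, ‖u p‖ₑ ^ 2 ∂(μ.prod ν) := by
        rw [lintegral_const_mul' _ _ (ENNReal.pow_ne_top hw.2.ne),
          lintegral_prod _ (hu.1.enorm.pow_const _)]
    _ < ⊤ := ENNReal.mul_lt_top (ENNReal.pow_lt_top hw.2) hfin

variable {t : ℝ} {M : E3 → E3}

theorem memLp_comp_splitEquiv_symm {F : Type*} [NormedAddCommGroup F] {u : E3 → F}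
    (hu : MemLp u 2 volume) : MemLp (fun p => u (splitEquiv.symm p)) 2 volume :=
  hu.comp_measurePreserving measurePreserving_splitEquiv.symm

theorem memLp_thicknessAverage (ht : 0 < t) (hM : MemLp M 2 volume) :
    MemLp (thicknessAverage t M) 2 volume := by
  have hw : MemLp ((Ioc 0 t).indicator fun _ => (1 : ℝ)) 2 volume :=
    memLp_indicator_const 2 measurableSet_Ioc 1 (Or.inr (by simp))
  have h := (memLp_integral_smul (μ := (volume : Measure E2)) hw
    (memLp_comp_splitEquiv_symm hM)).const_smul t⁻¹
  refine h.ae_eq (Eventually.of_forall fun x => ?_)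
  simp only [thicknessAverage, Pi.smul_apply]
  rw [intervalIntegral.integral_of_le ht.le, ← integral_indicator measurableSet_Ioc]
  congr 2 with s
  by_cases hs : s ∈ Ioc 0 t <;> simp [hs, splitEquiv_symm_apply]

theorem ae_splitEquiv_symm {p : E3 → Prop} (h : ∀ᵐ y, p y) :
    ∀ᵐ x : E2, ∀ᵐ s : ℝ, p (splitEquiv.symm (x, s)) :=
  Measure.ae_ae_of_ae_prod (measurePreserving_splitEquiv.symm.quasiMeasurePreserving.ae h)

/-- Since M vanishes off the film, the sharp cutoff to [0,t] may be replaced by any η equal to 1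
there. A smooth η turns planar test functions into test functions on space. -/
theorem thicknessAverage_ae (ht : 0 < t) (hM : ∀ᵐ y : E3, y 2 ∉ Icc 0 t → M y = 0) {η : ℝ → ℝ}
    (hη : ∀ s ∈ Icc 0 t, η s = 1) : ∀ᵐ x : E2,
      thicknessAverage t M x = t⁻¹ • ∫ s, η s • M (splitEquiv.symm (x, s)) := by
  filter_upwards [ae_splitEquiv_symm hM] with x hx
  rw [thicknessAverage, intervalIntegral.integral_of_le ht.le, ← integral_Icc_eq_integral_Ioc,
    ← integral_indicator measurableSet_Icc]
  congr 1
  refine integral_congr_ae ?_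
  filter_upwards [hx] with s hs
  by_cases h : s ∈ Icc 0 t
  · rw [indicator_of_mem h, hη s h, one_smul, splitEquiv_symm_apply]
  · rw [indicator_of_notMem h, hs h, smul_zero]

theorem thicknessAverage_eq_zero {R : ℝ} (h : ∀ᵐ y : E3, R < ‖y‖ → M y = 0) :
    ∀ᵐ x : E2, R < ‖x‖ → thicknessAverage t M x = 0 := by
  filter_upwards [ae_splitEquiv_symm h] with x hx hR
  rw [thicknessAverage, intervalIntegral.integral_zero_ae, smul_zero]
  filter_upwards [hx] with s hs _
  refine hs (hR.trans_le ?_)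
  have := norm_sq_E3_eq (splitEquiv.symm (x, s))
  rw [MeasurableEquiv.apply_symm_apply] at this
  exact (sq_le_sq₀ (norm_nonneg _) (norm_nonneg _)).1 (by nlinarith [sq_nonneg s])

end Average

/-! ### Product test functions φ(x) η(x₃). -/

section TestFunctions

/-- The function `φ(x) η(x₃)` on space. -/
noncomputable def realTensor (φ : E2 → ℝ) (η : ℝ → ℝ) (y : E3) : ℝ :=
  φ (splitEquiv y).1 * η (splitEquiv y).2

/-- The orthogonal projection of space onto the plane. -/
noncomputable def planeProj : E3 →L[ℝ] E2 :=
  LinearMap.toContinuousLinearMap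
    { toFun := fun y => !₂[y 0, y 1]
      map_add' := fun y z => by ext i; fin_cases i <;> rfl
      map_smul' := fun c y => by ext i; fin_cases i <;> rfl }

theorem realTensor_eq (φ : E2 → ℝ) (η : ℝ → ℝ) : realTensor φ η =
    fun y => φ (planeProj y) * η ((EuclideanSpace.proj 2 : E3 →L[ℝ] ℝ) y) := rfl

theorem continuous_splitEquiv_symm : Continuous splitEquiv.symm := by
  have : Continuous fun p : E2 × ℝ => (!₂[p.1 0, p.1 1, p.2] : E3) := by
    refine (PiLp.continuous_toLp 2 _).comp (continuous_pi fun i => ?_)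
    fin_cases i <;> simp <;> fun_prop
  exact this

variable {φ : E2 → ℝ} {η : ℝ → ℝ}

theorem isTest_realTensor (hφ : IsTest φ) (hη : ContDiff ℝ ∞ η) (hc : HasCompactSupport η) :
    IsTest (realTensor φ η) := by
  refine ⟨?_, ?_⟩
  · rw [realTensor_eq]
    exact (hφ.1.comp planeProj.contDiff).mul (hη.comp (ContinuousLinearMap.contDiff _))
  · refine HasCompactSupport.intro ((hφ.2.isCompact.prod hc.isCompact).image
      continuous_splitEquiv_symm) fun y hy => ?_
    by_contra h
    obtain ⟨h1, h2⟩ := mul_ne_zero_iff.1 h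
    exact hy ⟨splitEquiv y, ⟨subset_tsupport _ h1, subset_tsupport _ h2⟩,
      splitEquiv.symm_apply_apply y⟩

/-- A horizontal derivative leaves the vertical factor η untouched. -/
theorem partialDeriv_realTensor (hφ : IsTest φ) (hη : ContDiff ℝ ∞ η) {i : Fin 3} {j : Fin 2}
    (h1 : planeProj (EuclideanSpace.single i 1) = EuclideanSpace.single j 1) (h2 : i ≠ 2) :
    partialDeriv i (realTensor φ η) = realTensor (partialDeriv j φ) η := by
  ext y
  have d1 := ((hφ.1.differentiable (by simp) (planeProj y)).hasFDerivAt).comp y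
    planeProj.hasFDerivAt
  have d2 := ((hη.differentiable (by simp)
    ((EuclideanSpace.proj 2 : E3 →L[ℝ] ℝ) y)).hasFDerivAt).comp y
    (EuclideanSpace.proj 2 : E3 →L[ℝ] ℝ).hasFDerivAt
  have d := d1.mul d2
  rw [partialDeriv, realTensor_eq]
  erw [d.fderiv]
  simp [h1, h2.symm, realTensor_eq, partialDeriv, mul_comm]

theorem integral_realTensor_mul (hψ : IsTest (realTensor φ η)) {f : E3 → ℝ}
    (hf : MemLp f 2 volume) :
    Integrable (fun x => φ x * ∫ s, η s * f (splitEquiv.symm (x, s))) ∧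
    ∫ y, realTensor φ η y * f y = ∫ x, φ x * ∫ s, η s * f (splitEquiv.symm (x, s)) := by
  have hi := measurePreserving_splitEquiv.symm.integrable_comp_of_integrable
    ((hψ.memLp 2).integrable_mul hf)
  have e : ∀ x : E2, ∫ s, ((fun y => realTensor φ η y * f y) ∘ splitEquiv.symm) (x, s) =
      φ x * ∫ s, η s * f (splitEquiv.symm (x, s)) := by
    intro x
    rw [← integral_const_mul]
    congr 1 with s
    simp [realTensor, mul_assoc]
  refine ⟨?_, ?_⟩
  · exact hi.integral_prod_left.congr (Eventually.of_forall e)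
  · rw [← measurePreserving_splitEquiv.symm.integral_comp splitEquiv.symm.measurableEmbedding]
    exact (integral_prod _ hi).trans (integral_congr_ae (Eventually.of_forall e))

theorem isWeakPartial_apply {n k : ℕ} {i : Fin n}
    {M G : EuclideanSpace ℝ (Fin n) → EuclideanSpace ℝ (Fin k)} (hM : MemLp M 2 volume)
    (hG : MemLp G 2 volume) (h : IsWeakPartial i M G) (j : Fin k)
    {φ : EuclideanSpace ℝ (Fin n) → ℝ} (hφ : IsTest φ) :
    ∫ x, partialDeriv i φ x * M x j = -∫ x, φ x * G x j := by
  have h1 := congrArg (EuclideanSpace.proj j : EuclideanSpace ℝ (Fin k) →L[ℝ] ℝ) (h φ hφ)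
  rw [map_neg, ← ContinuousLinearMap.integral_comp_comm, ← ContinuousLinearMap.integral_comp_comm]
    at h1
  · simpa using h1
  · exact memLp_one_iff_integrable.1 (hG.smul (hφ.memLp 2))
  · exact memLp_one_iff_integrable.1 (hM.smul ((hφ.partialDeriv i).memLp 2))

end TestFunctions

/-! ### Existence and integrability of the planar divergence. -/

section Divergence

variable {t : ℝ} {M : E3 → E3}

/-- The average of an `H¹` field that lives in the film has a square integrable divergence. -/
theorem exists_isPlanarDiv (ht : 0 < t) (hM : MemH1 M)
    (hM0 : ∀ᵐ y : E3, y 2 ∉ Icc 0 t → M y = 0) :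
    ∃ D, IsPlanarDiv (thicknessAverage t M) D := by
  obtain ⟨hM2, hG⟩ := hM
  obtain ⟨G₀, hG₀, hw₀⟩ := hG 0
  obtain ⟨G₁, hG₁, hw₁⟩ := hG 1
  -- The bump is 1 on [-t, t], which contains the film.
  let η : ContDiffBump (0 : ℝ) := ⟨t, 2 * t, ht, by linarith⟩
  have hη1 : ∀ s ∈ Icc 0 t, η s = 1 := fun s hs => η.one_of_mem_closedBall (by
    rw [mem_closedBall_zero_iff, Real.norm_eq_abs, abs_of_nonneg hs.1]; exact hs.2)
  have hηs : ContDiff ℝ ∞ (η : ℝ → ℝ) := η.contDiff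
  have hη2 : MemLp (η : ℝ → ℝ) 2 volume :=
    η.continuous.memLp_of_hasCompactSupport η.hasCompactSupport
  have hg : MemLp (fun y => G₀ y 0 + G₁ y 1) 2 volume :=
    (MemLp.apply_euclidean hG₀ 0).add (MemLp.apply_euclidean hG₁ 1)
  have hav : ∀ᵐ x : E2, ∀ i, thicknessAverage t M x i =
      t⁻¹ * ∫ s, η s * M (splitEquiv.symm (x, s)) i := by
    -- Almost every vertical slice is square integrable, so η · M is integrable along it and taking
    -- a coordinate commutes with the integral.
    have hi : ∀ᵐ x : E2, MemLp (fun s => M (splitEquiv.symm (x, s))) 2 volume := by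
      have h := memLp_comp_splitEquiv_symm hM2
      have h' : Integrable (fun p : E2 × ℝ => ‖M (splitEquiv.symm p)‖ ^ 2) :=
        h.integrable_norm_pow (by simp)
      filter_upwards [h.1.prodMk_left, h'.prod_right_ae] with x h1 h2
      exact (memLp_two_iff_integrable_sq_norm h1).2 h2
    filter_upwards [thicknessAverage_ae ht hM0 hη1, hi] with x hx hix i
    rw [hx]
    have h := (EuclideanSpace.proj i : E3 →L[ℝ] ℝ).integral_comp_comm
      (memLp_one_iff_integrable.1 (hix.smul hη2))
    simp only [Pi.smul_apply', map_smul, smul_eq_mul] at h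
    exact congrArg (t⁻¹ * ·) h.symm
  -- The divergence is the η-weighted vertical integral of ∂₁M₁ + ∂₂M₂, up to t⁻¹. Testing M with φ
  -- ⊗ η verifies this without differentiating across the film faces.
  refine ⟨fun x => t⁻¹ * ∫ s, η s * (G₀ (splitEquiv.symm (x, s)) 0 +
    G₁ (splitEquiv.symm (x, s)) 1), ?_, fun φ hφ => ?_⟩
  · exact (memLp_integral_smul (μ := (volume : Measure E2)) hη2
      (memLp_comp_splitEquiv_symm hg)).const_mul t⁻¹
  · have hψ := isTest_realTensor hφ hηs η.hasCompactSupport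
    have hψ₀ := isTest_realTensor (hφ.partialDeriv 0) hηs η.hasCompactSupport
    have hψ₁ := isTest_realTensor (hφ.partialDeriv 1) hηs η.hasCompactSupport
    have p₀ : partialDeriv 0 (realTensor φ η) = realTensor (partialDeriv 0 φ) η :=
      partialDeriv_realTensor hφ hηs (by ext i; fin_cases i <;> simp [planeProj]) (by decide)
    have p₁ : partialDeriv 1 (realTensor φ η) = realTensor (partialDeriv 1 φ) η :=
      partialDeriv_realTensor hφ hηs (by ext i; fin_cases i <;> simp [planeProj]) (by decide)
    have w₀ := isWeakPartial_apply hM2 hG₀ hw₀ 0 hψ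
    have w₁ := isWeakPartial_apply hM2 hG₁ hw₁ 1 hψ
    obtain ⟨i₀, e₀⟩ := integral_realTensor_mul hψ₀ (MemLp.apply_euclidean hM2 0)
    obtain ⟨i₁, e₁⟩ := integral_realTensor_mul hψ₁ (MemLp.apply_euclidean hM2 1)
    rw [p₀, e₀] at w₀
    rw [p₁, e₁] at w₁
    have eg := (integral_realTensor_mul hψ hg).2
    have hsum : ∫ y, realTensor φ η y * (G₀ y 0 + G₁ y 1) =
        (∫ y, realTensor φ η y * G₀ y 0) + ∫ y, realTensor φ η y * G₁ y 1 := by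
      simp only [mul_add]
      exact integral_add ((hψ.memLp 2).integrable_mul (MemLp.apply_euclidean hG₀ 0))
        ((hψ.memLp 2).integrable_mul (MemLp.apply_euclidean hG₁ 1))
    have hl : ∫ x, (thicknessAverage t M x 0 * partialDeriv 0 φ x +
        thicknessAverage t M x 1 * partialDeriv 1 φ x) =
        t⁻¹ * ((∫ x, partialDeriv 0 φ x * ∫ s, η s * M (splitEquiv.symm (x, s)) 0) +
          ∫ x, partialDeriv 1 φ x * ∫ s, η s * M (splitEquiv.symm (x, s)) 1) := by
      rw [← integral_add i₀ i₁, ← integral_const_mul]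
      refine integral_congr_ae ?_
      filter_upwards [hav] with x hx
      rw [hx 0, hx 1]
      ring
    have hr : ∫ x, (t⁻¹ * ∫ s, η s * (G₀ (splitEquiv.symm (x, s)) 0 +
        G₁ (splitEquiv.symm (x, s)) 1)) * φ x =
        t⁻¹ * ∫ y, realTensor φ η y * (G₀ y 0 + G₁ y 1) := by
      rw [eg, ← integral_const_mul]
      congr 1 with x
      ring
    rw [hl, hr, w₀, w₁, hsum]
    ring

/-- The divergence of a field of bounded support is integrable. -/
theorem integrable_of_isPlanarDiv {m : E2 → E3} {D : E2 → ℝ} (hD : IsPlanarDiv m D) {R : ℝ}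
    (hm : ∀ᵐ x, R < ‖x‖ → m x = 0) : Integrable D := by
  have hU : IsOpen {x : E2 | R < ‖x‖} := isOpen_lt continuous_const continuous_norm
  -- Test functions supported where m vanishes pair to zero with D, so D vanishes outside the ball;
  -- on the ball L² is contained in L¹.
  have h0 := hU.ae_eq_zero_of_integral_contDiff_smul_eq_zero (μ := volume) (f := D)
    ((hD.1.locallyIntegrable (by norm_num)).locallyIntegrableOn _) (fun φ hφ hc hs => by
      have h := hD.2 φ ⟨hφ, hc⟩
      rw [integral_eq_zero_of_ae, eq_comm, neg_eq_zero] at h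
      · simpa [mul_comm] using h
      · filter_upwards [hm] with x hx
        by_cases hxt : x ∈ tsupport φ
        · simp [hx (hs hxt)]
        · have : fderiv ℝ φ x = 0 := by
            by_contra hne
            exact hxt (support_fderiv_subset ℝ hne)
          simp [partialDeriv, this])
  have hfin : Integrable ((Metric.closedBall 0 R).indicator D) := by
    have : IsFiniteMeasure (volume.restrict (Metric.closedBall (0 : E2) R)) :=
      ⟨by rw [Measure.restrict_apply_univ]; exact measure_closedBall_lt_top⟩
    exact IntegrableOn.integrable_indicator ((hD.1.restrict _).integrable (by norm_num))
      measurableSet_closedBall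
  refine hfin.congr ?_
  filter_upwards [h0] with x hx
  by_cases h : x ∈ Metric.closedBall 0 R
  · rw [indicator_of_mem h]
  · rw [indicator_of_notMem h, hx (by simpa using h)]

end Divergence

end ThinFilm

/-! ### Assembly of the theorem. -/

theorem mainTheorem4 :
    -- the functions `Γ` and `Θ`
    (StrictMonoOn Gam (Ici 0) ∧ Gam 0 = 0 ∧ Tendsto Gam atTop (𝓝 1)) ∧
    (StrictMonoOn Thet (Ici 0) ∧ Thet 0 = 0 ∧ Tendsto Thet (𝓝[>] 0) (𝓝 0) ∧
      Tendsto Thet atTop (𝓝 1)) ∧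
    -- the stray field
    ∀ (t : ℝ), 0 < t → ∀ (M : E3 → E3), MemH1 M →
      (∀ᵐ y ∂(volume : Measure E3), y 2 ∉ Icc 0 t → M y = 0) →
      -- the averaged magnetization and its two parts are square integrable
      MemLp (filmField t (thicknessAverage t M)) 2 volume ∧
      MemLp (verticalPart (filmField t (thicknessAverage t M))) 2 volume ∧
      MemLp (inPlanePart (filmField t (thicknessAverage t M))) 2 volume ∧
      -- splitting of the energy
      strayEnergy (filmField t (thicknessAverage t M)) =
        strayEnergy (verticalPart (filmField t (thicknessAverage t M))) +
          strayEnergy (inPlanePart (filmField t (thicknessAverage t M))) ∧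
      -- the vertical part
      Integrable (fun x => (thicknessAverage t M x 2) ^ 2) (volume : Measure E2) ∧
      Integrable (verticalIntegrand t (fun x => thicknessAverage t M x 2))
        (volume : Measure (E2 × E2)) ∧
      strayEnergy (verticalPart (filmField t (thicknessAverage t M))) =
        t * (∫ x, (thicknessAverage t M x 2) ^ 2) -
          t ^ 2 / (8 * Real.pi) *
            ∫ p, verticalIntegrand t (fun x => thicknessAverage t M x 2) p ∧
      -- the in-plane part
      (∃ D : E2 → ℝ, IsPlanarDiv (thicknessAverage t M) D) ∧
      ∀ D : E2 → ℝ, IsPlanarDiv (thicknessAverage t M) D →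
        -- the double integral with a Gaussian convergence factor that is removed in the limit
        (∀ ε : ℝ, 0 < ε →
          Integrable (fun p : E2 × E2 =>
            Real.exp (-(ε * ‖p.1 - p.2‖ ^ 2)) * inPlaneIntegrand t D p) volume) ∧
        Tendsto (fun ε : ℝ => t ^ 2 / (4 * Real.pi) *
            ∫ p : E2 × E2, Real.exp (-(ε * ‖p.1 - p.2‖ ^ 2)) * inPlaneIntegrand t D p)
          (𝓝[>] 0)
          (𝓝 (strayEnergy (inPlanePart (filmField t (thicknessAverage t M))))) ∧
        -- the plain formula, whenever the double integral converges absolutely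
        (Integrable (inPlaneIntegrand t D) (volume : Measure (E2 × E2)) →
          strayEnergy (inPlanePart (filmField t (thicknessAverage t M))) =
            t ^ 2 / (4 * Real.pi) * ∫ p, inPlaneIntegrand t D p) ∧
        -- it does for an integrable divergence, in particular for a film of bounded extent
        (Integrable D (volume : Measure E2) →
          Integrable (inPlaneIntegrand t D) (volume : Measure (E2 × E2))) ∧
        ((∃ R : ℝ, ∀ᵐ y ∂(volume : Measure E3), R < ‖y‖ → M y = 0) →
          Integrable D (volume : Measure E2)) := by
  refine ⟨⟨strictMonoOn_Gam, Gam_zero, tendsto_Gam⟩,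
    ⟨strictMonoOn_Thet, Thet_zero, tendsto_Thet_zero, tendsto_Thet⟩, fun t ht M hM hM0 => ?_⟩
  have hm := memLp_thicknessAverage ht hM.1
  obtain ⟨hv, hvE⟩ := strayEnergy_vertical_formula ht hm
  refine ⟨memLp_filmField t hm, ?_, ?_, strayEnergy_split ht hm,
    (MemLp.apply_euclidean hm 2).integrable_sq, hv, hvE, exists_isPlanarDiv ht hM hM0,
    fun D hD => ⟨fun ε hε => integrable_regularised ht hD.1 hε, tendsto_regularised ht hm hD,
      strayEnergy_inPlane_formula ht hm hD, integrable_inPlaneIntegrand ht hD.1,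
      fun ⟨R, hR⟩ => integrable_of_isPlanarDiv hD (thicknessAverage_eq_zero hR)⟩⟩
  · rw [verticalPart_filmField]
    exact memLp_filmField t (memLp_verticalPart hm)
  · rw [inPlanePart_filmField]
    exact memLp_filmField t (memLp_inPlanePart hm)
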